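/- **Theorem (QPTAS for constant size support).** In the prophet secretary problem, independent non-negative random variables $X_1,\dots,X_n$ with known finite distributions arrive in uniformly random order; the value of each is revealed on arrival and must be taken (which ends the game) or irrevocably discarded. For a finite set $\mathcal B$ of variables let $\mathrm{OPT}(\mathcal B)$ be the maximum expected value obtained by an online policy; it is given by $\mathrm{OPT}(\emptyset)=0$ and $\mathrm{OPT}(\mathcal B)=\frac1{|\mathcal B|}\sum_{X\in\mathcal B}\mathbb E\big[\max(X,\mathrm{OPT}(\mathcal B\setminus\{X\}))\big]$. Running time is counted as the number of steps on a real RAM: unit-cost exact arithmetic and comparisons on reals, no rounding of reals to integers; integer registers, with addition, subtraction and comparison, for addressing; natural and rational constants only. (a) There is an absolute constant $C>0$ such that for every integer $c\ge1$ there are a program $P$ and constants $K$ and $A\in\mathbb N$, depending only on $c$, with the following properties. The input of $P$ consists of $\varepsilon\in(0,1)$ and any number $n\ge0$ of non-negative random variables, each with support of size at most $c$, given by tables of values and probabilities. 1. $P$ always halts, with an output $\mathrm{est}_\varepsilon(X_1,\dots,X_n)$ satisfying $(1-\varepsilon)\,\mathrm{OPT}\le \mathrm{est}_\varepsilon\le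 \mathrm{OPT}$. The online policy that at each arrival runs $P$ on the set of remaining variables and stops if and only if the current value is at least the output has expected reward at least $(1-\varepsilon)\,\mathrm{OPT}(X_1,\dots,X_n)$. 2. There are bounds $\tau(\varepsilon,m)\in\mathbb N$ on the number of steps of $P$ on every input with $m$ variables such that, for all $\varepsilon\in(0,1)$ and all $n\ge (A/\varepsilon)^A$ (so, for every fixed $\varepsilon$, for all sufficiently large $n$), $$\sum_{m=0}^{n}\tau(\varepsilon,m)\le K\Big(\frac ng\Big)^g,\qquad g=C\cdot\frac{\log^{2c}(n/\varepsilon)}{(c-1)!\,\log^{2c}(1+\varepsilon)} .$$ The sum bounds the total time of the run on all $n$ variables and of the runs on the $n-1,\dots,1,0$ remaining variables that the online policy needs. (b) For two-point variables, with the values $0$ and $v_i>0$ (where $v_i$ may differ between variables), the same holds, for some program $P$ and absolute constants $C>0$, $K$, $A$, with $$g=C\cdot\frac{\log^{2}(n/\varepsilon)}{\log^{2}(1+\varepsilon)} .$$ -/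

import Mathlib

namespace ProphetSecretary

/-! ### Instances and the online optimum -/

/-- A non-negative random variable with at most `c` support points, given by the table of its
values and their probabilities (entries may have probability `0`, so every support size `κ ≤ c`
is covered). An instance of the prophet secretary problem is a list of such variables, which are
independent. -/
structure DiscreteVar (c : ℕ) where
  val : Fin c → ℝ
  prob : Fin c → ℝ
  val_nonneg : ∀ j, 0 ≤ val j
  prob_nonneg : ∀ j, 0 ≤ prob j
  sum_prob : ∑ j, prob j = 1

/-- The expected reward of the online optimum on the instance `l`, by the dynamic program:
the next variable is uniform among the remaining ones, and after its value `v` is seen one takes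
the better of `v` and the optimum for the other variables. For the empty list the value is
`0 / 0 = 0`, so that the last variable contributes its expectation. -/
noncomputable def opt {c : ℕ} (l : List (DiscreteVar c)) : ℝ :=
  (∑ i : Fin l.length, ∑ j : Fin c,
    l[i].prob j * max (l[i].val j) (opt (l.eraseIdx i))) / l.length
termination_by l.length
decreasing_by
  have := i.isLt
  rw [List.length_eraseIdx_of_lt this]
  omega

/-- An online policy: given the variables seen before with the outcomes they had, the variable that
has just arrived with its outcome, and the list of the variables still to come (but not their
outcomes or order), it says whether to stop and take the current value. -/
abbrev Policy (c : ℕ) : Type :=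
  List (DiscreteVar c × Fin c) → DiscreteVar c × Fin c → List (DiscreteVar c) → Prop

open Classical in
/-- The expected reward of the policy `σ` when the variables in `h` have been seen and rejected and
those in `l` are still to come, in uniformly random order. -/
noncomputable def Policy.rewardFrom {c : ℕ} (σ : Policy c) (h : List (DiscreteVar c × Fin c))
    (l : List (DiscreteVar c)) : ℝ :=
  (∑ i : Fin l.length, ∑ j : Fin c,
    l[i].prob j * (if σ h (l[i], j) (l.eraseIdx i) then l[i].val j
      else Policy.rewardFrom σ ((l[i], j) :: h) (l.eraseIdx i))) / l.length
termination_by l.length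
decreasing_by
  have := i.isLt
  rw [List.length_eraseIdx_of_lt this]
  omega

/-- The expected reward of the policy `σ` on the instance `l`. -/
noncomputable def Policy.reward {c : ℕ} (σ : Policy c) (l : List (DiscreteVar c)) : ℝ :=
  σ.rewardFrom [] l

/-- The policy that stops as soon as the current value is at least the number that `T` assigns to
the list of the remaining variables. -/
def thresholdPolicy {c : ℕ} (T : List (DiscreteVar c) → ℝ) : Policy c :=
  fun _ cur rest => T rest ≤ cur.1.val cur.2

theorem rewardFrom_le_opt {c : ℕ} (σ : Policy c) (n : ℕ) (l : List (DiscreteVar c))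
    (hl : l.length = n) (h : List (DiscreteVar c × Fin c)) : σ.rewardFrom h l ≤ opt l := by
  induction n generalizing l h with
  | zero =>
    rw [Policy.rewardFrom, opt]
    simp [hl]
  | succ n ih =>
    rw [Policy.rewardFrom, opt]
    gcongr with i _ j _
    · exact l[i].prob_nonneg j
    · split_ifs
      · exact le_max_left _ _
      · refine (ih _ ?_ _).trans (le_max_right _ _)
        rw [List.length_eraseIdx_of_lt i.isLt]
        omega

theorem rewardFrom_thresholdPolicy_opt {c : ℕ} (n : ℕ) (l : List (DiscreteVar c))
    (hl : l.length = n) (h : List (DiscreteVar c × Fin c)) :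
    (thresholdPolicy opt).rewardFrom h l = opt l := by
  induction n generalizing l h with
  | zero =>
    rw [Policy.rewardFrom, opt]
    simp [hl]
  | succ n ih =>
    rw [Policy.rewardFrom, opt]
    congr 1
    refine Finset.sum_congr rfl fun i _ => Finset.sum_congr rfl fun j _ => ?_
    congr 1
    have hlen : (l.eraseIdx i).length = n := by
      rw [List.length_eraseIdx_of_lt i.isLt]
      omega
    rw [ih _ hlen]
    by_cases hc : opt (l.eraseIdx i) ≤ l[i].val j
    · exact (if_pos hc).trans (max_eq_left hc).symm
    · exact (if_neg hc).trans (max_eq_right (le_of_not_ge hc)).symm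

/-- The dynamic program computes the best expected reward of an online policy. -/
theorem isGreatest_opt {c : ℕ} (l : List (DiscreteVar c)) :
    IsGreatest (Set.range fun σ : Policy c => σ.reward l) (opt l) :=
  ⟨⟨thresholdPolicy opt, rewardFrom_thresholdPolicy_opt _ l rfl []⟩, by
    rintro _ ⟨σ, rfl⟩
    exact rewardFrom_le_opt σ _ l rfl []⟩

/-! ### The machine model: a real RAM

The memory consists of index cells (natural numbers) and number cells (real numbers). Index cells
can be used as addresses. Exact real arithmetic and comparisons take unit time; there is no
rounding of reals to integers, and indices can only be added, subtracted and compared. A program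
is a finite object whose only constants are natural and rational numbers. -/

/-- The memory of the machine. -/
structure Mem where
  idx : ℕ → ℕ
  num : ℕ → ℝ

/-- A reference to a cell: the cell at the fixed address `k`, or the cell whose address is stored
in index cell `k`. -/
inductive Ref where
  | dir (k : ℕ)
  | ind (k : ℕ)

/-- The address that a reference denotes. -/
def Ref.addr (m : Mem) : Ref → ℕ
  | .dir k => k
  | .ind k => m.idx k

/-- The index stored in the index cell that is referred to. -/
def Mem.getIdx (m : Mem) (r : Ref) : ℕ := m.idx (r.addr m)

/-- The number stored in the number cell that is referred to. -/
def Mem.getNum (m : Mem) (r : Ref) : ℝ := m.num (r.addr m)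

/-- Overwrite an index cell. -/
def Mem.setIdx (m : Mem) (r : Ref) (x : ℕ) : Mem :=
  { m with idx := Function.update m.idx (r.addr m) x }

/-- Overwrite a number cell. -/
noncomputable def Mem.setNum (m : Mem) (r : Ref) (x : ℝ) : Mem :=
  { m with num := Function.update m.num (r.addr m) x }

/-- The elementary instructions; the first argument is the destination. -/
inductive Instr where
  | constIdx (d : Ref) (k : ℕ)
  | copyIdx (d a : Ref)
  | addIdx (d a b : Ref)
  | subIdx (d a b : Ref)
  | constNum (d : Ref) (q : ℚ)
  | castNum (d a : Ref)
  | copyNum (d a : Ref)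
  | addNum (d a b : Ref)
  | subNum (d a b : Ref)
  | mulNum (d a b : Ref)
  | divNum (d a b : Ref)

/-- The effect of an elementary instruction. Subtraction of indices is truncated, and division by
zero gives zero. -/
noncomputable def Instr.apply (m : Mem) : Instr → Mem
  | .constIdx d k => m.setIdx d k
  | .copyIdx d a => m.setIdx d (m.getIdx a)
  | .addIdx d a b => m.setIdx d (m.getIdx a + m.getIdx b)
  | .subIdx d a b => m.setIdx d (m.getIdx a - m.getIdx b)
  | .constNum d q => m.setNum d (q : ℝ)
  | .castNum d a => m.setNum d (m.getIdx a : ℝ)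
  | .copyNum d a => m.setNum d (m.getNum a)
  | .addNum d a b => m.setNum d (m.getNum a + m.getNum b)
  | .subNum d a b => m.setNum d (m.getNum a - m.getNum b)
  | .mulNum d a b => m.setNum d (m.getNum a * m.getNum b)
  | .divNum d a b => m.setNum d (m.getNum a / m.getNum b)

/-- The tests on which a program can branch. -/
inductive Test where
  | ltIdx (a b : Ref)
  | leIdx (a b : Ref)
  | ltNum (a b : Ref)
  | leNum (a b : Ref)

/-- The outcome of a test. -/
def Test.Holds (m : Mem) : Test → Prop
  | .ltIdx a b => m.getIdx a < m.getIdx b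
  | .leIdx a b => m.getIdx a ≤ m.getIdx b
  | .ltNum a b => m.getNum a < m.getNum b
  | .leNum a b => m.getNum a ≤ m.getNum b

/-- Programs. -/
inductive Prog where
  | skip
  | instr (i : Instr)
  | seq (p q : Prog)
  | ite (b : Test) (p q : Prog)
  | loop (b : Test) (p : Prog)

/-- `Exec p m t m'`: started with memory `m`, the program `p` halts with memory `m'` after `t`
steps. Each instruction and each evaluation of a test counts as one step. `loop b p` repeats `p` as
long as `b` holds. -/
inductive Exec : Prog → Mem → ℕ → Mem → Prop where
  | skip (m : Mem) : Exec .skip m 1 m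
  | instr (i : Instr) (m : Mem) : Exec (.instr i) m 1 (i.apply m)
  | seq {p q : Prog} {m m' m'' : Mem} {t u : ℕ} :
      Exec p m t m' → Exec q m' u m'' → Exec (.seq p q) m (t + u) m''
  | ite_true {b : Test} {p q : Prog} {m m' : Mem} {t : ℕ} :
      b.Holds m → Exec p m t m' → Exec (.ite b p q) m (t + 1) m'
  | ite_false {b : Test} {p q : Prog} {m m' : Mem} {t : ℕ} :
      ¬ b.Holds m → Exec q m t m' → Exec (.ite b p q) m (t + 1) m'
  | loop_true {b : Test} {p : Prog} {m m' m'' : Mem} {t u : ℕ} :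
      b.Holds m → Exec p m t m' → Exec (.loop b p) m' u m'' → Exec (.loop b p) m (t + u + 1) m''
  | loop_false {b : Test} {p : Prog} {m : Mem} :
      ¬ b.Holds m → Exec (.loop b p) m 1 m

/-- The initial memory for the input `(ε, l)`: index cell `0` holds the number of variables, the
number cells hold `ε` and then, variable by variable, the values followed by the probabilities; all
other cells hold `0`. -/
noncomputable def inputMem {c : ℕ} (ε : ℝ) (l : List (DiscreteVar c)) : Mem where
  idx := fun k => if k = 0 then l.length else 0
  num := fun k => (ε :: l.flatMap fun X => List.ofFn X.val ++ List.ofFn X.prob).getD k 0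

/-- On input `(ε, l)` the program halts after `t` steps with the number `y` in number cell `0`. -/
def Prog.Outputs {c : ℕ} (P : Prog) (ε : ℝ) (l : List (DiscreteVar c)) (y : ℝ) (t : ℕ) : Prop :=
  ∃ m : Mem, Exec P (inputMem ε l) t m ∧ m.num 0 = y

/-! ### Approximation algorithms -/

/-- The program `P` is a `(1 - ε)`-approximation algorithm against the online optimum, for every
`ε ∈ (0, 1)` (which is part of its input), on all instances whose variables satisfy `S`, and needs
at most `τ ε n` steps on instances with `n` variables: its output lies between `(1 - ε) * opt` and
`opt`, and the online policy that at each arrival runs it on the remaining variables and uses its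
output as the threshold has expected reward at least `(1 - ε) * opt`. -/
def IsApproxAlgorithm {c : ℕ} (S : DiscreteVar c → Prop) (P : Prog) (τ : ℝ → ℕ → ℕ) : Prop :=
  ∃ est : ℝ → List (DiscreteVar c) → ℝ,
    ∀ ε : ℝ, 0 < ε → ε < 1 → ∀ l : List (DiscreteVar c), (∀ X ∈ l, S X) →
      (∃ t ≤ τ ε l.length, P.Outputs ε l (est ε l) t) ∧
      (1 - ε) * opt l ≤ est ε l ∧ est ε l ≤ opt l ∧
      (1 - ε) * opt l ≤ (thresholdPolicy (est ε)).reward l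

end ProphetSecretary

/-! The value of the dynamic program depends only on the multiset of remaining variables. If the n
variables fall into k classes of equal ones, a state is a vector of k multiplicities, and a table
with (n+1)^k entries suffices (`gopt_eq_countOpt`). The task is to round the variables to few
classes while losing at most a factor 1-ε.

Let M be the largest product of a value and its probability. Then M ≤ OPT ≤ ncM (`mul_le_opt`,
`opt_le`). Put δ = ε/8. Values below lo = δM may be dropped at an additive cost of order δM. A value
v above hi = ncM/δ may be lowered to hi if its probability is multiplied by v/hi, because every
threshold that occurs is at most ncM = δ·hi. Probabilities below q = δ²/(nc)² are negligible. What
is left is rounded down to geometric grids of ratio 1+δ. The multiplicative loss does not compound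
through the recursion, since the thresholds have shrunk by the same factor; only additive errors add
up (`mul_gopt_sub_le`, `gopt_rounded`). The result lies below OPT and serves as a threshold
(`le_reward_thresholdPolicy`).

With x = log(n/ε)/log(1+ε) the grids have O(x) levels, so there are O(x^(2c)) classes, with a
constant depending on c. The exponent g tolerates no such constant and even carries 1/(c-1)!. The
gain comes from one support point of probability at least 1/c, whose rounded probability has a
number of levels independent of n (`count_le`). This saves a factor of order log(n/ε), which beats
every constant depending on c and the factorial once n ≥ (A/ε)^A. For two-point variables only one
pair varies (`count_two_point_le`), and the constant goes into C. Finally g ≤ √n, so (n/g)^g ≥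
n^(g/2), which dominates all running times together (`mul_runtimeBound_le`).

On the machine the states are numbered in base n+1. Removing a variable of class t lowers the number
by (n+1)^t, so the table can be filled in increasing order. The data occupy even number cells and
the table odd ones, so neither needs a size bound in advance. -/

namespace ProphetSecretary

/-! ### Timed total correctness of programs -/

/-- Started with memory `m`, the program `p` halts after at most `T` steps with a memory that
satisfies `Q`. -/
def Runs (p : Prog) (m : Mem) (T : ℕ) (Q : Mem → Prop) : Prop :=
  ∃ t m', t ≤ T ∧ Exec p m t m' ∧ Q m'

/-- A straight-line program. -/
def block : List Instr → Prog
  | [] => .skip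
  | i :: is => .seq (.instr i) (block is)

/-- The program that runs `p` a fixed number of times. -/
def repeated (p : Prog) : ℕ → Prog
  | 0 => .skip
  | k + 1 => .seq (repeated p k) p

namespace Runs

variable {p q : Prog} {m : Mem} {T U : ℕ} {Q R : Mem → Prop} {b : Test}

theorem mono (h : Runs p m T Q) (hT : T ≤ U) (hQ : ∀ m', Q m' → R m') : Runs p m U R := by
  obtain ⟨t, m', ht, he, hq⟩ := h
  exact ⟨t, m', ht.trans hT, he, hQ _ hq⟩

theorem skip (h : Q m) (hT : 1 ≤ T) : Runs .skip m T Q :=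
  ⟨1, m, hT, .skip m, h⟩

theorem seq (h : Runs p m T fun m' => Runs q m' U Q) : Runs (.seq p q) m (T + U) Q := by
  obtain ⟨t, m', ht, he, u, m'', hu, he', hq⟩ := h
  exact ⟨t + u, m'', by omega, .seq he he', hq⟩

theorem block {is : List Instr} (h : Q (is.foldl Instr.apply m)) (hT : is.length + 1 ≤ T) :
    Runs (block is) m T Q := by
  induction is generalizing m T with
  | nil => exact skip h hT
  | cons i is ih =>
    have h1 := seq (p := .instr i) (q := ProphetSecretary.block is) (m := m) (T := 1)
      (U := is.length + 1) (Q := Q) ⟨1, _, le_rfl, .instr i m, ih h le_rfl⟩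
    exact h1.mono (by simp at hT; omega) fun _ h => h

theorem ite (h₁ : b.Holds m → Runs p m T Q) (h₂ : ¬ b.Holds m → Runs q m T Q) :
    Runs (.ite b p q) m (T + 1) Q := by
  by_cases hb : b.Holds m
  · obtain ⟨t, m', ht, he, hq⟩ := h₁ hb
    exact ⟨t + 1, m', by omega, .ite_true hb he, hq⟩
  · obtain ⟨t, m', ht, he, hq⟩ := h₂ hb
    exact ⟨t + 1, m', by omega, .ite_false hb he, hq⟩

/-- A loop with an invariant `I` that is indexed by a bound for the number of rounds to come. -/
theorem loop (I : ℕ → Mem → Prop)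
    (h : ∀ j m, I j m → (¬ b.Holds m ∧ Q m) ∨
      (b.Holds m ∧ ∃ j', j = j' + 1 ∧ Runs p m T (I j'))) {j : ℕ} (hI : I j m) :
    Runs (.loop b p) m (j * (T + 1) + 1) Q := by
  induction j generalizing m with
  | zero =>
    rcases h 0 m hI with ⟨hb, hq⟩ | ⟨_, j', hj, _⟩
    · exact ⟨1, m, by omega, .loop_false hb, hq⟩
    · omega
  | succ j ih =>
    rcases h _ m hI with ⟨hb, hq⟩ | ⟨hb, j', hj, t, m', ht, he, hI'⟩
    · exact ⟨1, m, by omega, .loop_false hb, hq⟩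
    · obtain rfl : j' = j := by omega
      obtain ⟨u, m'', hu, he', hq⟩ := ih hI'
      refine ⟨t + u + 1, m'', ?_, .loop_true hb he he', hq⟩
      rw [add_mul]
      omega

theorem repeated (I : ℕ → Mem → Prop) {k : ℕ}
    (h : ∀ j m, j < k → I j m → Runs p m T (I (j + 1))) (hI : I 0 m) :
    Runs (repeated p k) m (k * T + 1) (I k) := by
  induction k with
  | zero => exact skip hI (by omega)
  | succ k ih =>
    have h1 := seq ((ih fun j m hj => h j m (by omega)).mono le_rfl
      fun m' hm' => h k m' (by omega) hm')
    exact h1.mono (by rw [add_mul]; omega) fun _ h => h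

end Runs

end ProphetSecretary

namespace ProphetSecretary

/-! ### The dynamic program for arbitrary transition functions -/

/-- The dynamic program in which a remaining variable is given by the function that maps the value
of the game without it to the value of the game at its arrival. -/
noncomputable def gopt (l : List (ℝ → ℝ)) : ℝ :=
  (∑ i : Fin l.length, l[i] (gopt (l.eraseIdx i))) / l.length
termination_by l.length
decreasing_by
  have := i.isLt
  rw [List.length_eraseIdx_of_lt this]
  omega

/-- The expected maximum of the variable `X` and the number `T`. -/
noncomputable def DiscreteVar.expMax {c : ℕ} (X : DiscreteVar c) (T : ℝ) : ℝ :=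
  ∑ j, X.prob j * max (X.val j) T

theorem length_eraseIdx_fin {α : Type*} (l : List α) (i : Fin l.length) :
    (l.eraseIdx i).length + 1 = l.length := by
  have := i.isLt
  rw [List.length_eraseIdx_of_lt this]
  omega

theorem gopt_map {α : Type*} (F : α → ℝ → ℝ) (l : List α) :
    gopt (l.map F) = (∑ i : Fin l.length, F l[i] (gopt ((l.eraseIdx i).map F))) / l.length := by
  have hlen : ((l.map F).length : ℝ) = l.length := by simp
  rw [gopt, hlen]
  congr 1
  refine Fintype.sum_equiv (finCongr (List.length_map F)) _ _ fun i => ?_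
  simp [List.eraseIdx_map]

theorem opt_eq_gopt {c : ℕ} (l : List (DiscreteVar c)) :
    opt l = gopt (l.map DiscreteVar.expMax) := by
  induction hn : l.length generalizing l with
  | zero => rw [opt, gopt_map]; simp [hn]
  | succ n ih =>
    rw [opt, gopt_map]
    congr 1
    refine Finset.sum_congr rfl fun i _ => ?_
    have := length_eraseIdx_fin l i
    rw [DiscreteVar.expMax, ih _ (by omega)]

/-- An induction principle for linear inequalities between two dynamic programs. -/
theorem gopt_linear_le {α : Type*} (F G : α → ℝ → ℝ) (a b : ℝ) (γ : ℕ → ℝ) (hγ : 0 ≤ γ 0)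
    (l : List α)
    (h : ∀ l' : List α, l'.length < l.length → (∀ X ∈ l', X ∈ l) →
      a * gopt (l'.map F) + b * gopt (l'.map G) ≤ γ l'.length → ∀ X ∈ l,
      a * F X (gopt (l'.map F)) + b * G X (gopt (l'.map G)) ≤ γ (l'.length + 1)) :
    a * gopt (l.map F) + b * gopt (l.map G) ≤ γ l.length := by
  induction hn : l.length generalizing l with
  | zero =>
    rw [gopt_map, gopt_map]
    simpa [hn] using hγ
  | succ n ih =>
    have hpos : (0 : ℝ) < l.length := by rw [hn]; positivity
    rw [gopt_map, gopt_map, mul_div_assoc', mul_div_assoc', ← add_div, div_le_iff₀ hpos,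
      Finset.mul_sum, Finset.mul_sum, ← Finset.sum_add_distrib]
    calc _ ≤ ∑ i : Fin l.length, γ (n + 1) := by
          refine Finset.sum_le_sum fun i _ => ?_
          have hlen := length_eraseIdx_fin l i
          have hmem : ∀ X ∈ l.eraseIdx i, X ∈ l := fun X hX => List.mem_of_mem_eraseIdx hX
          -- Averaging over the first arrival preserves a linear inequality, so a bound for each
          -- summand is enough. The induction hypothesis for the shorter list is handed to `h`.
          have := h (l.eraseIdx i) (by omega) hmem ?_ l[i] (List.getElem_mem _)
          · rwa [show (l.eraseIdx i).length = n by omega] at this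
          · rw [show (l.eraseIdx i).length = n by omega]
            refine ih _ (fun l' h1 h2 h3 X hX => h l' (by omega) (fun X hX => hmem X (h2 X hX)) h3
              X (hmem X hX)) (by omega)
      _ = _ := by simp; ring

theorem gopt_nonneg {α : Type*} (F : α → ℝ → ℝ) (l : List α)
    (h : ∀ X ∈ l, ∀ T, 0 ≤ T → 0 ≤ F X T) : 0 ≤ gopt (l.map F) := by
  have := gopt_linear_le F F (-1) 0 (fun _ => 0) le_rfl l fun l' _ _ h0 X hX => by
    have := h X hX (gopt (l'.map F)) (by linarith)
    linarith
  linarith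

theorem gopt_le_gopt {α : Type*} (F G : α → ℝ → ℝ) (l : List α)
    (h0 : ∀ X ∈ l, ∀ T, 0 ≤ T → 0 ≤ F X T)
    (h : ∀ X ∈ l, ∀ s t, 0 ≤ s → s ≤ t → F X s ≤ G X t) : gopt (l.map F) ≤ gopt (l.map G) := by
  have := gopt_linear_le F G 1 (-1) (fun _ => 0) le_rfl l fun l' _ hl' h1 X hX => by
    have := h X hX (gopt (l'.map F)) (gopt (l'.map G))
      (gopt_nonneg F l' fun X hX => h0 X (hl' X hX)) (by linarith)
    linarith
  linarith

theorem gopt_le_length_mul {α : Type*} (F : α → ℝ → ℝ) (u : ℝ) (l : List α)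
    (h0 : ∀ X ∈ l, ∀ T, 0 ≤ T → 0 ≤ F X T)
    (h : ∀ X ∈ l, ∀ T, 0 ≤ T → F X T ≤ T + u) : gopt (l.map F) ≤ l.length * u := by
  have := gopt_linear_le F F 1 0 (fun m => m * u) (by simp) l fun l' _ hl' h1 X hX => by
    have := h X hX (gopt (l'.map F)) (gopt_nonneg F l' fun X hX => h0 X (hl' X hX))
    push_cast
    linarith
  linarith

/-- Multiplicative and additive errors do not accumulate beyond the sum of the additive ones. -/
theorem mul_gopt_sub_le {α : Type*} (F G : α → ℝ → ℝ) (a b e u : ℝ) (hb : 0 ≤ b) (he : 0 ≤ e)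
    (hu : 0 ≤ u) (l : List α)
    (h0F : ∀ X ∈ l, ∀ T, 0 ≤ T → 0 ≤ F X T) (h0G : ∀ X ∈ l, ∀ T, 0 ≤ T → 0 ≤ G X T)
    (hG : ∀ X ∈ l, ∀ T, 0 ≤ T → G X T ≤ T + u)
    (h : ∀ X ∈ l, ∀ s t b', b ≤ b' → 0 ≤ s → 0 ≤ t → t ≤ l.length * u → a * t - b' ≤ s →
      a * G X t - b' - e ≤ F X s) :
    a * gopt (l.map G) - (b + l.length * e) ≤ gopt (l.map F) := by
  -- The slack `b` is paid once and only `e` is paid per variable. The one-step hypothesis is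
  -- required for every `b' ≥ b`, since the error accumulated so far takes the place of `b`.
  have := gopt_linear_le F G (-1) a (fun m => b + m * e) (by simpa using hb) l
    fun l' hlt hl' h1 X hX => by
    have hb' : b ≤ b + l'.length * e := le_add_of_nonneg_right (by positivity)
    have h2 := gopt_le_length_mul G u l' (fun X hX => h0G X (hl' X hX)) fun X hX => hG X (hl' X hX)
    have h3 : (l'.length : ℝ) * u ≤ l.length * u := by gcongr
    have := h X hX (gopt (l'.map F)) (gopt (l'.map G)) _ hb'
      (gopt_nonneg F l' fun X hX => h0F X (hl' X hX))
      (gopt_nonneg G l' fun X hX => h0G X (hl' X hX)) (h2.trans h3) (by linarith)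
    push_cast
    linarith
  linarith

/-! ### Elementary properties of the optimum -/

section
variable {c : ℕ} (X : DiscreteVar c)

theorem DiscreteVar.le_expMax (T : ℝ) : T ≤ X.expMax T := by
  calc T = ∑ j, X.prob j * T := by rw [← Finset.sum_mul, X.sum_prob, one_mul]
    _ ≤ _ := Finset.sum_le_sum fun j _ =>
      mul_le_mul_of_nonneg_left (le_max_right _ _) (X.prob_nonneg j)

theorem DiscreteVar.expMax_mono {s t : ℝ} (h : s ≤ t) : X.expMax s ≤ X.expMax t :=
  Finset.sum_le_sum fun j _ =>
    mul_le_mul_of_nonneg_left (max_le_max le_rfl h) (X.prob_nonneg j)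

theorem DiscreteVar.mul_le_expMax (j : Fin c) {T : ℝ} (hT : 0 ≤ T) :
    X.prob j * X.val j ≤ X.expMax T := by
  refine le_trans (mul_le_mul_of_nonneg_left (le_max_left _ T) (X.prob_nonneg j)) ?_
  exact Finset.single_le_sum (f := fun j => X.prob j * max (X.val j) T)
    (fun j _ => mul_nonneg (X.prob_nonneg j) (hT.trans (le_max_right _ _))) (Finset.mem_univ j)

/-- Written as `T` plus the expected excess over `T`, the transition function makes sense without
total mass one, so that probabilities may later be lowered. -/
theorem DiscreteVar.expMax_eq (T : ℝ) :
    X.expMax T = T + ∑ j, X.prob j * max (X.val j - T) 0 := by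
  have : T = ∑ j, X.prob j * T := by rw [← Finset.sum_mul, X.sum_prob, one_mul]
  conv_rhs => rw [this]
  rw [← Finset.sum_add_distrib, ← this]
  refine Finset.sum_congr rfl fun j _ => ?_
  rw [← mul_add, ← max_add_add_left]
  simp

theorem DiscreteVar.expMax_le {M : ℝ} (hM : ∀ j, X.prob j * X.val j ≤ M) {T : ℝ} (hT : 0 ≤ T) :
    X.expMax T ≤ T + c * M := by
  rw [X.expMax_eq]
  gcongr
  calc _ ≤ ∑ j : Fin c, M := Finset.sum_le_sum fun j _ => by
        refine le_trans (mul_le_mul_of_nonneg_left (max_le ?_ (X.val_nonneg j)) (X.prob_nonneg j))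
          (hM j)
        linarith
    _ = _ := by simp

end

theorem opt_nonneg {c : ℕ} (l : List (DiscreteVar c)) : 0 ≤ opt l := by
  rw [opt_eq_gopt]
  exact gopt_nonneg _ _ fun X _ T hT => hT.trans (X.le_expMax T)

theorem opt_le {c : ℕ} (l : List (DiscreteVar c)) (M : ℝ)
    (hM : ∀ X ∈ l, ∀ j, X.prob j * X.val j ≤ M) : opt l ≤ l.length * (c * M) := by
  rw [opt_eq_gopt]
  exact gopt_le_length_mul _ _ _ (fun X _ T hT => hT.trans (X.le_expMax T))
    fun X hX T hT => X.expMax_le (hM X hX) hT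

/-- One can wait for the variable `l[i]` and take its `j`-th value. In the induction the first
arrival is either this variable, or it is passed over and `l[i]` stays in the list, perhaps at a
shifted index. Together with `opt_le` this fixes the scale of the optimum up to a factor `n * c`. -/
theorem mul_le_opt {c : ℕ} (l : List (DiscreteVar c)) (i : Fin l.length) (j : Fin c) :
    l[i].prob j * l[i].val j ≤ opt l := by
  obtain ⟨n, hn⟩ : ∃ n, l.length = n := ⟨_, rfl⟩
  induction n generalizing l with
  | zero => have := i.isLt; omega
  | succ n ih =>
    have hpos : (0 : ℝ) < l.length := by rw [hn]; positivity
    rw [opt_eq_gopt, gopt_map, le_div_iff₀ hpos]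
    calc _ = ∑ _i' : Fin l.length, l[i].prob j * l[i].val j := by simp; ring
      _ ≤ _ := by
        refine Finset.sum_le_sum fun i' _ => ?_
        rw [← opt_eq_gopt]
        by_cases hi : i' = i
        · subst hi
          exact DiscreteVar.mul_le_expMax _ _ (opt_nonneg _)
        · refine le_trans ?_ (DiscreteVar.le_expMax _ _)
          have hlen := length_eraseIdx_fin l i'
          have hmem : l[i] ∈ l.eraseIdx i' := by
            rw [List.mem_eraseIdx_iff_getElem]
            exact ⟨i, i.isLt, fun h => hi (Fin.ext h).symm, rfl⟩
          obtain ⟨a, ha, he⟩ := List.getElem_of_mem hmem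
          have := ih (l.eraseIdx i') ⟨a, ha⟩ (by omega)
          simpa [he] using this

/-- A threshold policy with approximately optimal thresholds is approximately optimal. -/
theorem le_reward_thresholdPolicy {c : ℕ} (T : List (DiscreteVar c) → ℝ) (ε : ℝ) (h0 : 0 ≤ ε)
    (S : DiscreteVar c → Prop)
    (hT : ∀ l : List (DiscreteVar c), (∀ X ∈ l, S X) → (1 - ε) * opt l ≤ T l ∧ T l ≤ opt l)
    (l : List (DiscreteVar c)) (hl : ∀ X ∈ l, S X) (h : List (DiscreteVar c × Fin c)) :
    (1 - ε) * opt l ≤ (thresholdPolicy T).rewardFrom h l := by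
  induction hn : l.length generalizing l h with
  | zero =>
    rw [Policy.rewardFrom, opt]
    simp [hn]
  | succ n ih =>
    rw [Policy.rewardFrom, opt, mul_div_assoc', Finset.mul_sum]
    refine div_le_div_of_nonneg_right (Finset.sum_le_sum fun i _ => ?_) (Nat.cast_nonneg _)
    rw [Finset.mul_sum]
    refine Finset.sum_le_sum fun j _ => ?_
    have hlen := length_eraseIdx_fin l i
    have hS : ∀ X ∈ l.eraseIdx i, S X := fun X hX => hl X (List.mem_of_mem_eraseIdx hX)
    obtain ⟨h1, h2⟩ := hT _ hS
    have h3 := ih _ hS ((l[i], j) :: h) (by omega)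
    have hp := l[i].prob_nonneg j
    have hv := l[i].val_nonneg j
    rw [mul_left_comm]
    refine mul_le_mul_of_nonneg_left ?_ hp
    -- After stopping, the value is at least the threshold and hence at least `(1 - ε) * opt` of the
    -- rest. After continuing, it lies below the threshold and hence below `opt`, so the maximum is
    -- `opt` and the induction hypothesis applies.
    split_ifs with hc
    · have hc' : T (l.eraseIdx i) ≤ l[i].val j := hc
      rcases max_cases (l[i].val j) (opt (l.eraseIdx i)) with ⟨he, _⟩ | ⟨he, _⟩
      · rw [he]; nlinarith
      · rw [he]; linarith
    · have hc' : ¬ T (l.eraseIdx i) ≤ l[i].val j := hc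
      rw [max_eq_right (by linarith)]
      exact h3

/-! ### The dynamic program on multiplicities -/

/-- The value of the dynamic program when `d t` variables with transition function `F t` are left,
`m` in total. -/
noncomputable def countOptAux (k : ℕ) (F : ℕ → ℝ → ℝ) : ℕ → (ℕ → ℕ) → ℝ
  | 0, _ => 0
  | m + 1, d => (∑ t ∈ Finset.range k,
      d t * F t (countOptAux k F m (Function.update d t (d t - 1)))) / (m + 1)

/-- The value of the dynamic program when `d t` variables with transition function `F t` are left,
for `t < k`. -/
noncomputable def countOpt (k : ℕ) (F : ℕ → ℝ → ℝ) (d : ℕ → ℕ) : ℝ :=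
  countOptAux k F (∑ t ∈ Finset.range k, d t) d

/-- Used with `w = 1` for the number of remaining variables and with `w t = (n + 1) ^ t` for the
position of a state in the table. -/
theorem sum_update_pred {k : ℕ} {d : ℕ → ℕ} {t : ℕ} (ht : t < k) (hd : 0 < d t) (w : ℕ → ℕ) :
    ∑ t' ∈ Finset.range k, Function.update d t (d t - 1) t' * w t' + w t =
      ∑ t' ∈ Finset.range k, d t' * w t' := by
  have ht' : t ∈ Finset.range k := Finset.mem_range.2 ht
  rw [← Finset.add_sum_erase _ _ ht', ← Finset.add_sum_erase _ _ ht',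
    Finset.sum_congr rfl (g := fun t' => d t' * w t') fun t' h => by
      rw [Function.update_of_ne (Finset.ne_of_mem_erase h)]]
  obtain ⟨x, hx⟩ : ∃ x, d t = x + 1 := ⟨d t - 1, by omega⟩
  simp [hx]
  ring

theorem countOpt_eq (k : ℕ) (F : ℕ → ℝ → ℝ) (d : ℕ → ℕ) :
    countOpt k F d = (∑ t ∈ Finset.range k,
      d t * F t (countOpt k F (Function.update d t (d t - 1)))) /
        (∑ t ∈ Finset.range k, d t : ℕ) := by
  rw [countOpt]
  rcases hs : ∑ t ∈ Finset.range k, d t with _ | m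
  · simp [countOptAux]
  · rw [countOptAux]
    push_cast
    congr 1
    refine Finset.sum_congr rfl fun t ht => ?_
    -- For an absent type the truncated `d t - 1` is meaningless, but the summand has the factor
    -- zero.
    rcases Nat.eq_zero_or_pos (d t) with h0 | h0
    · simp [h0]
    · have := sum_update_pred (Finset.mem_range.1 ht) h0 fun _ => 1
      simp only [mul_one] at this
      rw [countOpt, show ∑ t' ∈ Finset.range k, Function.update d t (d t - 1) t' = m by omega]

theorem sum_map_eq_sum_range_count {M : Type*} [AddCommMonoid M] {k : ℕ} (l : List ℕ)
    (hl : ∀ t ∈ l, t < k) (Φ : ℕ → M) :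
    (l.map Φ).sum = ∑ t ∈ Finset.range k, l.count t • Φ t := by
  rw [Finset.sum_list_map_count]
  refine Finset.sum_subset (fun t ht => Finset.mem_range.2 (hl t (by simpa using ht)))
    fun t _ ht => ?_
  rw [List.count_eq_zero_of_not_mem (by simpa using ht), zero_smul]

/-- Erasing any of the variables of type `t` leaves the same multiset, so equal summands can be
collected. This replaces the sublists by vectors of multiplicities and is the source of the running
time. -/
theorem gopt_eq_countOpt (k : ℕ) (F : ℕ → ℝ → ℝ) (l : List ℕ) (hl : ∀ t ∈ l, t < k) :
    gopt (l.map F) = countOpt k F fun t => l.count t := by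
  induction hn : l.length generalizing l with
  | zero =>
    obtain rfl := List.eq_nil_of_length_eq_zero hn
    rw [gopt, countOpt]
    simp [countOptAux]
  | succ n ih =>
    have hsum : ∀ Φ : ℕ → ℝ, ∑ i : Fin l.length, Φ l[i] =
        ∑ t ∈ Finset.range k, (l.count t : ℝ) * Φ t := by
      intro Φ
      have h1 : ∑ i : Fin l.length, Φ l[i] = (l.map Φ).sum := by
        rw [← List.sum_ofFn]
        congr 1
        apply List.ext_getElem <;> simp
      rw [h1, sum_map_eq_sum_range_count l hl]
      simp
    have hlen : ∑ t ∈ Finset.range k, l.count t = l.length := by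
      have := hsum fun _ => 1
      simp only [Finset.sum_const, Finset.card_univ, Fintype.card_fin, nsmul_eq_mul, mul_one]
        at this
      exact_mod_cast this.symm
    rw [gopt_map, countOpt_eq, hlen, ← hsum]
    congr 1
    refine Finset.sum_congr rfl fun i _ => ?_
    have hlen := length_eraseIdx_fin l i
    rw [ih _ (fun t ht => hl t (List.mem_of_mem_eraseIdx ht)) (by omega)]
    congr 2
    funext t
    have hp : l.Perm (l[i] :: l.eraseIdx i) := (List.getElem_cons_eraseIdx_perm i.isLt).symm
    have h1 := hp.count_eq t
    by_cases h : t = l[i]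
    · rw [h, List.count_cons_self] at h1
      rw [h, Function.update_self, h1, Nat.add_sub_cancel]
    · rw [List.count_cons_of_ne (Ne.symm h)] at h1
      rw [Function.update_of_ne h, h1]

end ProphetSecretary

namespace ProphetSecretary

/-! ### Rounding of values and probabilities -/

/-- The pair `(v', p')` arises from the value `v` with probability `p` by rounding down to
geometric grids of ratio `r`: values below `lo` are dropped, values above `hi` are reduced to `hi`
with the probability increased in proportion, and probabilities below `q` are dropped. -/
def RoundedPair (r lo hi q v p v' p' : ℝ) : Prop :=
  (v < lo ∧ v' = 0 ∧ p' = 0) ∨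
    (lo ≤ v ∧ (∃ i : ℕ, v' = hi / r ^ i) ∧ v' ≤ min v hi ∧ min v hi ≤ v' * r ∧
      ((p' = 0 ∧ p * (max v hi / hi) < q) ∨
        ((∃ i : ℕ, p' = 1 / r ^ i / r) ∧ q ≤ p * (max v hi / hi) ∧ p' * r ≤ p * (max v hi / hi) ∧
          p * (max v hi / hi) ≤ p' * r * r)))

namespace RoundedPair

variable {r lo hi q v p v' p' : ℝ}

theorem nonneg (h : RoundedPair r lo hi q v p v' p') (hr : 0 < r) (hhi : 0 < hi) :
    0 ≤ v' ∧ 0 ≤ p' := by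
  rcases h with ⟨-, rfl, rfl⟩ | ⟨-, ⟨i, rfl⟩, -, -, ⟨rfl, -⟩ | ⟨⟨j, rfl⟩, -, -, -⟩⟩
  · simp
  · exact ⟨by positivity, le_rfl⟩
  · exact ⟨by positivity, by positivity⟩

/-- Capping keeps the product of value and probability: above `hi` the new excess is `v - T * (v /
hi)`, which is at most `v - T`. -/
theorem scaled_term_le (hhi : 0 < hi) {T : ℝ} (hT : 0 ≤ T) :
    max v hi / hi * max (min v hi - T) 0 ≤ max (v - T) 0 := by
  rcases le_total v hi with h | h
  · rw [max_eq_right h, min_eq_left h, div_self hhi.ne', one_mul]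
  · rw [max_eq_left h, min_eq_right h]
    rcases le_total hi T with h1 | h1
    · rw [max_eq_right (a := hi - T) (by linarith), mul_zero]
      exact le_max_right _ _
    · rw [max_eq_left (a := hi - T) (by linarith), max_eq_left (a := v - T) (by linarith),
        div_mul_eq_mul_div, div_le_iff₀ hhi]
      nlinarith

/-- The threshold is small compared with the cap, so the subtracted term `T * (v / hi)` is at most
`δ * v`. -/
theorem scaled_term_ge (hhi : 0 < hi) (hv : 0 ≤ v) {T δ : ℝ} (hT : 0 ≤ T) (hTδ : T ≤ δ * hi)
    (hδ1 : δ ≤ 1) :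
    (1 - δ) * max (v - T) 0 ≤ max v hi / hi * max (min v hi - T) 0 := by
  rcases le_total v hi with h | h
  · rw [max_eq_right h, min_eq_left h, div_self hhi.ne', one_mul]
    have := le_max_right (v - T) 0
    nlinarith
  · have h1 : T ≤ hi := by nlinarith
    rw [max_eq_left h, min_eq_right h]
    rw [max_eq_left (a := hi - T) (by linarith), max_eq_left (a := v - T) (by linarith),
      div_mul_eq_mul_div, le_div_iff₀ hhi]
    have h2 : 0 ≤ (1 - δ) * T * hi := by
      have : 0 ≤ 1 - δ := by linarith
      positivity
    nlinarith [mul_le_mul_of_nonneg_left hTδ hv]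

theorem term_le (h : RoundedPair r lo hi q v p v' p') (hr : 1 < r) (hhi : 0 < hi)
    (hp : 0 ≤ p) {T : ℝ} (hT : 0 ≤ T) :
    p' * max (v' - T) 0 ≤ p * max (v - T) 0 := by
  have hpos : 0 ≤ p * max (v - T) 0 := mul_nonneg hp (le_max_right _ _)
  have hn := h.nonneg (by linarith) hhi
  rcases h with ⟨-, rfl, rfl⟩ | ⟨-, -, h1, -, ⟨rfl, -⟩ | ⟨-, -, h2, -⟩⟩
  · simpa using hpos
  · simpa using hpos
  · have h3 : p' ≤ p * (max v hi / hi) := by nlinarith [hn.2]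
    calc p' * max (v' - T) 0 ≤ p * (max v hi / hi) * max (min v hi - T) 0 := by gcongr
      _ ≤ _ := by
        rw [mul_assoc]
        exact mul_le_mul_of_nonneg_left (scaled_term_le hhi hT) hp

/-- The factor `1 - δ` pays for the cap, one factor `r` for the value and two for the probability. A
dropped value lies below `T` and has no excess; a dropped probability costs at most `q * hi`.
Rounding the value would be harmful for `v` close to `T`, but the threshold `s` on the rounded side
is smaller by the factor `a`, and `a * r ≤ 1`. -/
theorem term_ge (h : RoundedPair r lo hi q v p v' p') (hr : 1 < r) (hhi : 0 < hi) (hq : 0 ≤ q)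
    (hv : 0 ≤ v) (hp : 0 ≤ p) {δ a T s : ℝ} (hT0 : 0 ≤ T) (hT : lo ≤ T) (hTδ : T ≤ δ * hi)
    (hδ : 0 ≤ δ) (hδ1 : δ ≤ 1) (ha0 : 0 ≤ a) (ha : a * r ^ 3 ≤ 1 - δ) (hs : s ≤ a * T) :
    a * (p * max (v - T) 0) ≤ p' * max (v' - s) 0 + q * hi := by
  have hr0 : 0 < r := by linarith
  have hn := h.nonneg hr0 hhi
  have hr1 : r ≤ r ^ 3 := le_self_pow₀ hr.le (by norm_num)
  have har : a * r ≤ 1 := by nlinarith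
  have ha1 : a ≤ 1 := by nlinarith
  have hqh : 0 ≤ q * hi := by positivity
  have h' : p' * max (v' - s) 0 ≥ 0 := mul_nonneg hn.2 (le_max_right _ _)
  rcases le_or_gt v T with hvT | hvT
  · rw [max_eq_right (a := v - T) (by linarith)]
    simp only [mul_zero]
    linarith
  rcases h with ⟨hlt, -, -⟩ | ⟨-, -, h1, h2, ⟨rfl, h3⟩ | ⟨-, -, h3, h4⟩⟩
  · linarith
  · rw [max_eq_left (a := v - T) (by linarith), zero_mul, zero_add]
    have h5 : p * v ≤ q * hi := by
      calc p * v ≤ p * max v hi := by gcongr; exact le_max_left _ _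
        _ = p * (max v hi / hi) * hi := by field_simp
        _ ≤ _ := by gcongr
    calc a * (p * (v - T)) ≤ 1 * (p * v) := by gcongr; linarith
      _ ≤ _ := by linarith
  · have hge := scaled_term_ge hhi hv hT0 hTδ hδ1
    set ρ := max v hi / hi with hρ
    have hρ0 : 0 ≤ ρ := by positivity
    set m := min v hi
    have h6 : max (m - T) 0 ≤ max (v' - s) 0 * r := by
      rcases le_total m T with h | h
      · rw [max_eq_right (a := m - T) (by linarith)]
        exact mul_nonneg (le_max_right _ _) hr0.le
      · rw [max_eq_left (a := m - T) (by linarith)]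
        calc m - T ≤ (v' - s) * r := by nlinarith
          _ ≤ _ := by gcongr; exact le_max_left _ _
    have h7 : a * (r ^ 3 * max (v - T) 0) ≤ ρ * max (m - T) 0 := by
      have := le_max_right (v - T) 0
      nlinarith
    have h8 : r ^ 3 * (a * (p * max (v - T) 0)) ≤ r ^ 3 * (p' * max (v' - s) 0) := by
      calc r ^ 3 * (a * (p * max (v - T) 0)) = p * (a * (r ^ 3 * max (v - T) 0)) := by ring
        _ ≤ p * (ρ * max (m - T) 0) := by gcongr
        _ = (p * ρ) * max (m - T) 0 := by ring
        _ ≤ (p' * r * r) * (max (v' - s) 0 * r) := by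
          have := le_max_right (m - T) 0
          have := le_max_right (v' - s) 0
          have := hn.2
          gcongr
        _ = _ := by ring
    have := le_of_mul_le_mul_left h8 (by positivity)
    linarith

/-- Capping raises a probability to at most `M / hi`. The extra division by `r` in the rounded
probabilities compensates for this, so that their sum stays at most one. -/
theorem prob_le (h : RoundedPair r lo hi q v p v' p') (hhi : 0 < hi) (hp : 0 ≤ p) {M : ℝ} (hM : p * v ≤ M) (hM0 : 0 ≤ M) :
    p' * r ≤ p + M / hi := by
  have hpos : 0 ≤ p + M / hi := by positivity
  rcases h with ⟨-, rfl, rfl⟩ | ⟨-, -, -, -, ⟨rfl, -⟩ | ⟨-, -, h2, -⟩⟩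
  · simpa using hpos
  · simpa using hpos
  · refine h2.trans ?_
    rcases le_total v hi with h | h
    · rw [max_eq_right h, div_self hhi.ne', mul_one]
      have : 0 ≤ M / hi := by positivity
      linarith
    · rw [max_eq_left h, ← mul_div_assoc]
      have := div_le_div_of_nonneg_right hM hhi.le
      linarith

end RoundedPair

/-- The expected maximum of `T` and a variable that has the value `v j` with probability `p j` and
is `0` otherwise. -/
noncomputable def mixMax {c : ℕ} (v p : Fin c → ℝ) (T : ℝ) : ℝ :=
  T + ∑ j, p j * max (v j - T) 0

/-- When the threshold rises by `t - s`, the expected excess falls by at most `(t - s) * ∑ j, p j`;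
total mass at most one is what makes this harmless. -/
theorem mixMax_mono {c : ℕ} {v p : Fin c → ℝ} (hp : ∀ j, 0 ≤ p j) (hsum : ∑ j, p j ≤ 1) {s t : ℝ}
    (h : s ≤ t) : mixMax v p s ≤ mixMax v p t := by
  rw [mixMax, mixMax]
  have h1 : ∑ j, p j * max (v j - s) 0 ≤ ∑ j, (p j * max (v j - t) 0 + p j * (t - s)) := by
    refine Finset.sum_le_sum fun j _ => ?_
    rw [← mul_add]
    refine mul_le_mul_of_nonneg_left (max_le ?_ ?_) (hp j)
    · have := le_max_left (v j - t) 0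
      linarith
    · have := le_max_right (v j - t) 0
      linarith
  rw [Finset.sum_add_distrib, ← Finset.sum_mul] at h1
  nlinarith

/-- The value of the rounded instance approximates the optimum. -/
theorem gopt_rounded {c : ℕ} (l : List (DiscreteVar c)) {ε M r lo hi q : ℝ} (hε : 0 < ε)
    (hε1 : ε < 1) (hM0 : 0 < M)
    (hM : ∀ i : Fin l.length, ∀ j, l[i].prob j * l[i].val j ≤ M) (hMopt : M ≤ opt l)
    (hn : 0 < l.length) (hc : 0 < c)
    (hr : r = 1 + ε / 8) (hlo : lo = ε / 8 * M) (hhi : hi = l.length * c * M / (ε / 8))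
    (hq : q = (ε / 8) ^ 2 / (l.length * c : ℝ) ^ 2) (v p : Fin l.length → Fin c → ℝ)
    (h : ∀ i j, RoundedPair r lo hi q (l[i].val j) (l[i].prob j) (v i j) (p i j)) :
    (1 - ε) * opt l ≤ gopt ((List.finRange l.length).map fun i => mixMax (v i) (p i)) ∧
      gopt ((List.finRange l.length).map fun i => mixMax (v i) (p i)) ≤ opt l := by
  set δ := ε / 8 with hδ
  have hδ0 : 0 < δ := by positivity
  have hδ1 : δ < 1 / 8 := by linarith
  have hn' : (1 : ℝ) ≤ l.length := by exact_mod_cast hn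
  have hc' : (1 : ℝ) ≤ c := by exact_mod_cast hc
  have hr1 : 1 < r := by linarith
  have hr0 : 0 < r := by linarith
  have hhi0 : 0 < hi := by rw [hhi]; positivity
  have hlo0 : 0 < lo := by rw [hlo]; positivity
  have hq0 : 0 < q := by rw [hq]; positivity
  have hopt : opt l = gopt ((List.finRange l.length).map fun i => l[i].expMax) := by
    rw [opt_eq_gopt]
    congr 1
    apply List.ext_getElem <;> simp
  have hp0 : ∀ i j, 0 ≤ p i j := fun i j => ((h i j).nonneg hr0 hhi0).2
  have hMhi : M / hi = δ / (l.length * c) := by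
    rw [hhi]
    field_simp
  have hsum : ∀ i, ∑ j, p i j ≤ 1 := by
    intro i
    have h1 : ∑ j, p i j * r ≤ ∑ j : Fin c, (l[i].prob j + M / hi) :=
      Finset.sum_le_sum fun j _ =>
        (h i j).prob_le hhi0 (l[i].prob_nonneg j) (hM i j) hM0.le
    rw [Finset.sum_add_distrib, l[i].sum_prob, ← Finset.sum_mul] at h1
    simp only [Finset.sum_const, Finset.card_univ, Fintype.card_fin, nsmul_eq_mul, hMhi] at h1
    have h2 : (c : ℝ) * (δ / (l.length * c)) ≤ δ := by
      rw [mul_div_assoc', div_le_iff₀ (by positivity)]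
      nlinarith [mul_pos hδ0 (show (0 : ℝ) < c by linarith)]
    have h3 : (∑ j, p i j) * r ≤ 1 * r := by linarith
    exact le_of_mul_le_mul_right h3 hr0
  have hF0 : ∀ i T, 0 ≤ T → 0 ≤ mixMax (v i) (p i) T := fun i T hT =>
    add_nonneg hT (Finset.sum_nonneg fun j _ => mul_nonneg (hp0 i j) (le_max_right _ _))
  have hle : ∀ i T, 0 ≤ T → mixMax (v i) (p i) T ≤ l[i].expMax T := by
    intro i T hT
    rw [mixMax, DiscreteVar.expMax_eq]
    refine add_le_add le_rfl (Finset.sum_le_sum fun j _ => ?_)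
    exact (h i j).term_le hr1 hhi0 (l[i].prob_nonneg j) hT
  constructor
  -- Four times `δ` covers the cap and the three factors `r`: the product `(1 - 4δ)(1 + δ)³` equals
  -- `1 - δ` minus terms of higher order.
  · set a := (1 - 4 * δ) with ha
    have ha0 : 0 ≤ a := by linarith
    have har : a * r ^ 3 ≤ 1 - δ := by
      rw [ha, hr]
      nlinarith [pow_pos hδ0 2, pow_pos hδ0 3, pow_pos hδ0 4]
    have hqc : 0 ≤ c * (q * hi) := by positivity
    have key := mul_gopt_sub_le (fun i => mixMax (v i) (p i)) (fun i : Fin l.length => l[i].expMax)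
      a lo (c * (q * hi)) (c * M) hlo0.le hqc (by positivity) (List.finRange l.length)
      (fun i _ => hF0 i) (fun i _ T hT => hT.trans (l[i].le_expMax T))
      (fun i _ T hT => l[i].expMax_le (hM i) hT) ?_
    · rw [← hopt, List.length_finRange] at key
      -- The dropped probabilities cost `δ * M` in total and the slack `lo` another `δ * M`. Since
      -- `M ≤ opt l`, the overall loss is at most `6 * δ * opt l`, within the allowed `8 * δ * opt
      -- l`.
      have h1 : (l.length : ℝ) * (c * (q * hi)) = δ * M := by
        rw [hq, hhi]
        field_simp
      rw [h1, hlo] at key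
      have : (1 - ε) * opt l ≤ a * opt l - (δ * M + δ * M) := by
        rw [ha, show ε = 8 * δ by rw [hδ]; ring]
        nlinarith
      linarith
    · intro i _ s t b' hb' hs ht htU hst
      rw [List.length_finRange] at htU
      -- Thresholds below `lo` are raised to `lo`, so that dropped values have no excess. The raise
      -- is absorbed by the slack: `a * lo - b' ≤ 0 ≤ s`. Hence `lo` is paid once and not once per
      -- variable.
      set W := max t lo with hW
      have hU : l.length * (c * M) = δ * hi := by
        rw [hhi]
        field_simp
      have hloU : lo ≤ δ * hi := by
        rw [← hU, hlo]
        have h1 : δ * M ≤ M := mul_le_of_le_one_left hM0.le (by linarith)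
        have h2 : M ≤ c * M := le_mul_of_one_le_left hM0.le hc'
        have h3 : c * M ≤ l.length * (c * M) := le_mul_of_one_le_left (by positivity) hn'
        linarith
      have hWU : W ≤ δ * hi := max_le (by rw [← hU]; exact htU) hloU
      have hW0 : 0 ≤ W := ht.trans (le_max_left _ _)
      have hsW : a * W - b' ≤ s := by
        rcases max_cases t lo with ⟨he, _⟩ | ⟨he, _⟩
        · rw [hW, he]; exact hst
        · rw [hW, he]
          have : a * lo ≤ lo := mul_le_of_le_one_left hlo0.le (by linarith)
          linarith
      have h1 : a * l[i].expMax t ≤ a * l[i].expMax W :=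
        mul_le_mul_of_nonneg_left (l[i].expMax_mono (le_max_left _ _)) ha0
      have h2 := mixMax_mono (v := v i) (hp0 i) (hsum i) hsW
      have h3 : a * (∑ j, l[i].prob j * max (l[i].val j - W) 0) ≤
          (∑ j, p i j * max (v i j - (a * W - b')) 0) + c * (q * hi) := by
        rw [Finset.mul_sum]
        calc _ ≤ ∑ j, (p i j * max (v i j - (a * W - b')) 0 + q * hi) := by
              refine Finset.sum_le_sum fun j _ => ?_
              exact (h i j).term_ge hr1 hhi0 hq0.le (l[i].val_nonneg j) (l[i].prob_nonneg j) hW0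
                (le_max_right _ _) hWU hδ0.le (by linarith) ha0 har (by linarith)
          _ = _ := by simp [Finset.sum_add_distrib]
      rw [l[i].expMax_eq W] at h1
      change a * l[i].expMax t - b' - c * (q * hi) ≤ mixMax (v i) (p i) s
      refine le_trans ?_ h2
      rw [mixMax]
      linarith
  · rw [hopt]
    refine gopt_le_gopt _ _ _ (fun i _ => hF0 i) fun i _ s t hs hst => ?_
    exact (hle i s hs).trans (l[i].expMax_mono hst)

end ProphetSecretary

namespace ProphetSecretary

/-! ### The number of rounded variables -/

/-- The pairs of a rounded value and a rounded probability with levels at most `N + 1` and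
`K + 1`. -/
noncomputable def pairGrid (r hi : ℝ) (N K : ℕ) : Finset (ℝ × ℝ) :=
  insert (0, 0) ((Finset.range (N + 2)).image (fun i => hi / r ^ i) ×ˢ
    insert 0 ((Finset.range (K + 2)).image fun i => 1 / r ^ i / r))

theorem card_pairGrid_le (r hi : ℝ) (N K : ℕ) :
    (pairGrid r hi N K).card ≤ (N + 3) * (K + 3) := by
  refine (Finset.card_insert_le _ _).trans ?_
  rw [Finset.card_product]
  have h1 := Finset.card_image_le (s := Finset.range (N + 2)) (f := fun i => hi / r ^ i)
  have h2 := (Finset.card_insert_le (0 : ℝ) ((Finset.range (K + 2)).image fun i => 1 / r ^ i / r))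
  have h3 := Finset.card_image_le (s := Finset.range (K + 2)) (f := fun i => 1 / r ^ i / r)
  rw [Finset.card_range] at h1 h3
  have := Nat.mul_le_mul h1 (h2.trans (Nat.add_le_add_right h3 1))
  nlinarith

/-- Rounding down may pass `y` by one factor `r`, so the level `N + 1` can still occur. -/
theorem level_lt {r x y : ℝ} {i N : ℕ} (hr : 1 < r) (hy : 0 < y) (h : y ≤ x / r ^ i * r)
    (hN : x ≤ y * r ^ N) : i < N + 2 := by
  by_contra hi
  have hr0 : 0 < r := by linarith
  have h1 : y * r ^ i ≤ x * r := by
    rw [div_mul_eq_mul_div, le_div_iff₀ (by positivity)] at h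
    exact h
  have h2 : x * r ≤ y * r ^ (N + 1) := by
    rw [pow_succ, ← mul_assoc]
    gcongr
  have h3 : r ^ (N + 1) < r ^ i := pow_lt_pow_right₀ hr (by omega)
  nlinarith

/-- The number `x` is a lower bound for the scaled probability when it is not dropped: `q` in
general, but `1 / c` for a support point known to be likely. -/
theorem RoundedPair.mem_pairGrid {r lo hi q v p v' p' x : ℝ} {N K : ℕ}
    (h : RoundedPair r lo hi q v p v' p') (hr : 1 < r) (hlo : 0 < lo) (hlohi : lo ≤ hi)
    (hN : hi ≤ lo * r ^ N) (hx : 0 < x) (hxp : q ≤ p * (max v hi / hi) → x ≤ p * (max v hi / hi))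
    (hK : 1 ≤ x * r ^ K) : (v', p') ∈ pairGrid r hi N K := by
  rcases h with ⟨-, rfl, rfl⟩ | ⟨h0, ⟨i, rfl⟩, -, h1, h2⟩
  · exact Finset.mem_insert_self _ _
  · refine Finset.mem_insert_of_mem (Finset.mem_product.2 ⟨Finset.mem_image.2 ⟨i, ?_, rfl⟩, ?_⟩)
    · exact Finset.mem_range.2 (level_lt hr hlo ((le_min h0 hlohi).trans h1) hN)
    · rcases h2 with ⟨rfl, -⟩ | ⟨⟨j, rfl⟩, h2, -, h3⟩
      · exact Finset.mem_insert_self _ _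
      · refine Finset.mem_insert_of_mem (Finset.mem_image.2 ⟨j, ?_, rfl⟩)
        have hr0 : r ≠ 0 := by linarith
        rw [div_mul_cancel₀ _ hr0] at h3
        exact Finset.mem_range.2 (level_lt hr hx ((hxp h2).trans h3) hK)

variable {n c : ℕ} {r lo hi q : ℝ} {N K k : ℕ}

theorem count_le_of_mem (S : Finset (Fin c → ℝ × ℝ)) (w : Fin n → Fin c → ℝ × ℝ)
    (hS : ∀ i, w i ∈ S) (ρ : Fin k → Fin n) (hρ : Function.Injective fun t => w (ρ t)) :
    k ≤ S.card := by
  simpa using Finset.card_le_card_of_injOn (s := Finset.univ) (fun t => w (ρ t))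
    (fun t _ => hS (ρ t)) hρ.injOn

/-- Every variable has a support point of probability at least `1 / c`. Its rounded probability has
only about `K` levels, where `K` depends on `c` and `r` but not on `n`. The leading factor `c` is
the choice of this point; the other `c - 1` points use the full grids. -/
theorem count_le (hr : 1 < r) (hlo : 0 < lo) (hlohi : lo ≤ hi) (hq : 0 < q)
    (hN : hi ≤ lo * r ^ N) (hNq : 1 ≤ q * r ^ N) (hc : 0 < c) (hK : (c : ℝ) ≤ r ^ K)
    (X : Fin n → DiscreteVar c) (w : Fin n → Fin c → ℝ × ℝ)
    (h : ∀ i j, RoundedPair r lo hi q ((X i).val j) ((X i).prob j) (w i j).1 (w i j).2)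
    (ρ : Fin k → Fin n) (hρ : Function.Injective fun t => w (ρ t)) :
    k ≤ c * ((N + 3) * (K + 3) * ((N + 3) * (N + 3)) ^ (c - 1)) := by
  classical
  set S : Finset (Fin c → ℝ × ℝ) := Finset.univ.biUnion fun j : Fin c =>
    Fintype.piFinset fun j' => if j' = j then pairGrid r hi N K else pairGrid r hi N N with hSdef
  have hhi : 0 < hi := by linarith
  have hc' : (0 : ℝ) < c := by exact_mod_cast hc
  refine (count_le_of_mem S w (fun i => ?_) ρ hρ).trans ?_
  · obtain ⟨j, hj⟩ : ∃ j, 1 / (c : ℝ) ≤ (X i).prob j := by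
      by_contra! hcon
      have : ∑ j, (X i).prob j < ∑ _j : Fin c, 1 / (c : ℝ) :=
        Finset.sum_lt_sum_of_nonempty ⟨⟨0, hc⟩, Finset.mem_univ _⟩ fun j _ => hcon j
      rw [(X i).sum_prob] at this
      simp [hc.ne'] at this
    rw [hSdef, Finset.mem_biUnion]
    refine ⟨j, Finset.mem_univ _, Fintype.mem_piFinset.2 fun j' => ?_⟩
    split_ifs with hjj
    · subst hjj
      refine (h i j').mem_pairGrid hr hlo hlohi hN (x := 1 / c) (by positivity) (fun _ => ?_) ?_
      · refine hj.trans (le_mul_of_one_le_right ((X i).prob_nonneg _) ?_)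
        rw [le_div_iff₀ hhi, one_mul]
        exact le_max_right _ _
      · rw [one_div, inv_mul_eq_div, le_div_iff₀ hc', one_mul]
        exact hK
    · exact (h i j').mem_pairGrid hr hlo hlohi hN hq id hNq
  · refine Finset.card_biUnion_le.trans ?_
    calc _ ≤ ∑ _j : Fin c, (N + 3) * (K + 3) * ((N + 3) * (N + 3)) ^ (c - 1) := by
          refine Finset.sum_le_sum fun j _ => ?_
          rw [Fintype.card_piFinset, ← Finset.mul_prod_erase _ _ (Finset.mem_univ j), if_pos rfl]
          refine Nat.mul_le_mul (card_pairGrid_le _ _ _ _) ?_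
          calc _ ≤ ∏ _j' ∈ Finset.univ.erase j, (N + 3) * (N + 3) := by
                refine Finset.prod_le_prod' fun j' hj' => ?_
                rw [if_neg (Finset.ne_of_mem_erase hj')]
                exact card_pairGrid_le _ _ _ _
            _ = _ := by simp [Finset.card_erase_of_mem]
      _ = _ := by simp

/-- The value zero lies below `lo` and always becomes the pair `(0, 0)`, so only one pair is free.
-/
theorem count_two_point_le (hr : 1 < r) (hlo : 0 < lo) (hlohi : lo ≤ hi) (hq : 0 < q)
    (hN : hi ≤ lo * r ^ N) (hNq : 1 ≤ q * r ^ N)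
    (X : Fin n → DiscreteVar 2) (hX : ∀ i, (X i).val 0 = 0) (w : Fin n → Fin 2 → ℝ × ℝ)
    (h : ∀ i j, RoundedPair r lo hi q ((X i).val j) ((X i).prob j) (w i j).1 (w i j).2)
    (ρ : Fin k → Fin n) (hρ : Function.Injective fun t => w (ρ t)) :
    k ≤ (N + 3) * (N + 3) := by
  classical
  refine (count_le_of_mem (Fintype.piFinset ![{(0, 0)}, pairGrid r hi N N]) w (fun i => ?_)
    ρ hρ).trans ?_
  · refine Fintype.mem_piFinset.2 fun j => ?_
    fin_cases j
    · rcases h i 0 with ⟨-, h1, h2⟩ | ⟨h1, -⟩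
      · exact Finset.mem_singleton.2 (Prod.ext h1 h2)
      · rw [hX i] at h1
        linarith
    · exact (h i 1).mem_pairGrid hr hlo hlohi hN hq id hNq
  · rw [Fintype.card_piFinset, Fin.prod_univ_two]
    simpa using card_pairGrid_le r hi N N

end ProphetSecretary

namespace ProphetSecretary

/-! ### The dynamic program on the machine -/

/-- The registers that hold constants. -/
structure ConstRegs (c n : ℕ) (I : ℕ → ℕ) : Prop where
  h0 : I 0 = n
  h1 : I 1 = 1
  h2 : I 2 = 2
  h3 : I 3 = 2 * c
  h7 : I 7 = 0

theorem ConstRegs.congr {c n : ℕ} {I I' : ℕ → ℕ} (h : ConstRegs c n I)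
    (h' : ∀ a, a < 4 ∨ a = 7 → I' a = I a) : ConstRegs c n I' :=
  ⟨by rw [h' 0 (by omega), h.h0], by rw [h' 1 (by omega), h.h1], by rw [h' 2 (by omega), h.h2],
    by rw [h' 3 (by omega), h.h3], by rw [h' 7 (by omega), h.h7]⟩

/-- The transition function of the variable whose values are stored from cell `A` on. -/
noncomputable def cellMix (c : ℕ) (N : ℕ → ℝ) (A : ℕ) (T : ℝ) : ℝ :=
  T + ∑ j ∈ Finset.range c, N (A + 2 * c + 2 * j) * max (N (A + 2 * j) - T) 0

open Instr Ref in
/-- One summand of `cellMix`. -/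
def pairTerm : Prog :=
  .seq (block [subNum (dir 10) (ind 9) (dir 7)])
    (.seq (.ite (.ltNum (dir 9) (dir 10))
      (block [mulNum (dir 10) (dir 10) (ind 10), addNum (dir 8) (dir 8) (dir 10)]) .skip)
      (block [addIdx (dir 9) (dir 9) (dir 2), addIdx (dir 10) (dir 10) (dir 2)]))

attribute [local simp] Instr.apply Mem.setIdx Mem.setNum Mem.getIdx Mem.getNum Ref.addr Test.Holds

theorem runs_pairTerm (I : ℕ → ℕ) (N : ℕ → ℝ) (h2 : I 2 = 2) (h10 : 16 ≤ I 10)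
    (hz : N 9 = 0) :
    Runs pairTerm ⟨I, N⟩ 9 fun m =>
      (∀ a, a ≠ 9 → a ≠ 10 → m.idx a = I a) ∧ m.idx 9 = I 9 + 2 ∧ m.idx 10 = I 10 + 2 ∧
      (∀ a, a ≠ 8 → a ≠ 10 → m.num a = N a) ∧
      m.num 8 = N 8 + N (I 10) * max (N (I 9) - N 7) 0 := by
  refine (Runs.seq (U := 7) (Runs.block (T := 2) ?_ le_rfl)).mono le_rfl fun _ h => h
  refine (Runs.seq (U := 3) ((Runs.ite (T := 3) (fun hb => Runs.block ?_ le_rfl)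
    fun hb => Runs.skip ?_ (by omega)))).mono le_rfl fun _ h => h
  all_goals
    refine Runs.block ?_ le_rfl
    simp (disch := omega) [h2, hz] at hb ⊢
  · refine ⟨fun a h1 h2 => by simp [h1, h2], fun a h1 h2 => by simp [h1, h2], ?_⟩
    rw [max_eq_left (by linarith), mul_comm]
  · exact ⟨fun a h1 h2 => by simp [h1, h2], fun a h1 h2 => by simp [h2], Or.inr hb⟩

open Instr Ref in
/-- The contribution of one type of variables to the value of a state of the dynamic program. -/
def typeStep (c : ℕ) : Prog :=
  .seq (.ite (.ltIdx (dir 7) (ind 13))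
    (.seq (block [addIdx (dir 12) (dir 13) (dir 1), subIdx (dir 9) (dir 4) (ind 12),
        copyNum (dir 7) (ind 9), copyNum (dir 8) (dir 7), addIdx (dir 12) (dir 12) (dir 1),
        copyIdx (dir 9) (ind 12), addIdx (dir 10) (dir 9) (dir 3)])
      (.seq (repeated pairTerm c)
        (block [castNum (dir 10) (ind 13), mulNum (dir 10) (dir 10) (dir 8),
          addNum (dir 6) (dir 6) (dir 10), addIdx (dir 8) (dir 8) (ind 13)])))
    .skip)
    (block [addIdx (dir 13) (dir 13) (dir 1), addIdx (dir 13) (dir 13) (dir 2)])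

theorem runs_typeStep {c n : ℕ} (I : ℕ → ℕ) (N : ℕ → ℝ) (hI : ConstRegs c n I) (hz : N 9 = 0)
    {t s w A : ℕ} (h13 : I 13 = 16 + 3 * t) (h4 : I 4 = 17 + 2 * s) (hw : I (17 + 3 * t) = 2 * w)
    (hA : I (18 + 3 * t) = A) (hA16 : 16 ≤ A) (hws : 0 < I (16 + 3 * t) → w ≤ s) :
    Runs (typeStep c) ⟨I, N⟩ (9 * c + 18) fun m =>
      (∀ a, a ≠ 8 → a ≠ 9 → a ≠ 10 → a ≠ 12 → a ≠ 13 → m.idx a = I a) ∧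
      m.idx 13 = 16 + 3 * (t + 1) ∧ m.idx 8 = I 8 + I (16 + 3 * t) ∧
      (∀ a, a ≠ 6 → a ≠ 7 → a ≠ 8 → a ≠ 10 → m.num a = N a) ∧
      m.num 6 = N 6 + I (16 + 3 * t) * cellMix c N A (N (17 + 2 * (s - w))) := by
  obtain ⟨h0, h1, h2, h3, h7⟩ := hI
  refine (Runs.seq (U := 3) (Runs.ite (T := 9 * c + 14) (fun hb => ?_) fun hb => ?_)).mono
    le_rfl fun _ h => h
  · simp [h7, h13] at hb
    have hws := hws hb
    refine (Runs.seq (U := c * 9 + 1 + 5) (Runs.block (T := 8) ?_ le_rfl)).mono (by omega)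
      fun _ h => h
    set m₁ := List.foldl Instr.apply ⟨I, N⟩ _ with hm₁
    have e12 : 16 + 3 * t + 1 = 17 + 3 * t := by omega
    have e12' : 17 + 3 * t + 1 = 18 + 3 * t := by omega
    -- Truncation does no harm: a positive digit `t` gives `w ≤ s`. This cell holds the value of the
    -- state with one variable of type `t` removed.
    have e9 : 17 + 2 * s - 2 * w = 17 + 2 * (s - w) := by omega
    have hf1 : ∀ a, a ≠ 9 → a ≠ 10 → a ≠ 12 → m₁.idx a = I a := by
      intro a h1 h2 h3
      simp [hm₁, h1, h2, h3]
    have hf2 : ∀ a, a ≠ 7 → a ≠ 8 → m₁.num a = N a := by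
      intro a h1 h2
      simp [hm₁, h1, h2]
    have hv9 : m₁.idx 9 = A := by
      simp (disch := omega) [hm₁, h13, h1, e12, e12', hA]
    have hv10 : m₁.idx 10 = A + 2 * c := by
      simp (disch := omega) [hm₁, h13, h1, h3, e12, e12', hA]
    have hv7 : m₁.num 7 = N (17 + 2 * (s - w)) := by
      simp (disch := omega) [hm₁, h13, h1, h4, e12, e12', hw, e9]
    have hv8 : m₁.num 8 = N (17 + 2 * (s - w)) := by
      simp (disch := omega) [hm₁, h13, h1, h4, e12, e12', hw, e9]
    clear_value m₁
    refine (Runs.seq (U := 5) ((Runs.repeated (T := 9) (fun j m =>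
      (∀ a, a ≠ 9 → a ≠ 10 → a ≠ 12 → m.idx a = I a) ∧ m.idx 9 = A + 2 * j ∧
      m.idx 10 = A + 2 * c + 2 * j ∧ (∀ a, a ≠ 7 → a ≠ 8 → a ≠ 10 → m.num a = N a) ∧
      m.num 7 = N (17 + 2 * (s - w)) ∧
      m.num 8 = N (17 + 2 * (s - w)) + ∑ j ∈ Finset.range j,
        N (A + 2 * c + 2 * j) * max (N (A + 2 * j) - N (17 + 2 * (s - w))) 0) ?_ ?_).mono le_rfl
        fun m hm => ?_)).mono le_rfl fun _ h => h
    · rintro j ⟨I', N'⟩ hj ⟨hi, hi9, hi10, hn, hn7, hn8⟩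
      simp only at hi hi9 hi10 hn hn7 hn8
      refine (runs_pairTerm I' N' (by rw [hi 2 (by omega) (by omega) (by omega), h2])
        (by omega) (by rw [hn 9 (by omega) (by omega) (by omega), hz])).mono le_rfl ?_
      rintro ⟨I'', N''⟩ ⟨g1, g2, g3, g4, g5⟩
      simp only at g1 g2 g3 g4 g5
      refine ⟨fun a h1 h2 h3 => (g1 a h1 h2).trans (hi a h1 h2 h3), by simp only; omega,
        by simp only; omega, fun a h1 h2 h3 => (g4 a h2 h3).trans (hn a h1 h2 h3),
        (g4 7 (by omega) (by omega)).trans hn7, ?_⟩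
      simp only
      rw [g5, hn8, hn7, hi9, hi10, Finset.sum_range_succ, hn (A + 2 * j) (by omega) (by omega)
        (by omega), hn (A + 2 * c + 2 * j) (by omega) (by omega) (by omega), add_assoc]
    · exact ⟨hf1, by simpa using hv9, by simpa using hv10, fun a h1 h2 _ => hf2 a h1 h2, hv7,
        by simpa using hv8⟩
    · obtain ⟨I', N'⟩ := m
      obtain ⟨hi, hi9, hi10, hn, hn7, hn8⟩ := hm
      simp only at hi hi9 hi10 hn hn7 hn8
      have e1 := hi 1 (by omega) (by omega) (by omega)
      have e2 := hi 2 (by omega) (by omega) (by omega)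
      have e13 := hi 13 (by omega) (by omega) (by omega)
      have ed := hi (16 + 3 * t) (by omega) (by omega) (by omega)
      have e8 := hi 8 (by omega) (by omega) (by omega)
      have e6 := hn 6 (by omega) (by omega) (by omega)
      refine Runs.block (Runs.block ?_ le_rfl) le_rfl
      simp (disch := omega) [e1, e2, e13, h1, h2, h13, ed, e8, e6]
      refine ⟨fun a b1 b2 b3 b4 b5 => ?_, by omega, fun a b1 b2 b3 b4 => ?_, ?_⟩
      · simp [b1, b5, hi a b2 b3 b4]
      · simp [b1, b4, hn a b2 b3 b4]
      · rw [hn8, cellMix]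
        exact Or.inl rfl
  · simp [h7, h13] at hb
    refine Runs.skip (Runs.block ?_ le_rfl) (by omega)
    simp (disch := omega) [h13, h1, h2, hb]
    exact ⟨fun a b1 b2 b3 b4 b5 => by simp [b5], by omega⟩

theorem cellMix_congr {c : ℕ} {N N' : ℕ → ℝ} {A : ℕ} (h : ∀ j < 2 * c, N' (A + 2 * j) = N (A + 2 * j)) :
    cellMix c N' A = cellMix c N A := by
  funext T
  rw [cellMix, cellMix]
  congr 1
  refine Finset.sum_congr rfl fun j hj => ?_
  have hj := Finset.mem_range.1 hj
  rw [h j (by omega), show A + 2 * c + 2 * j = A + 2 * (c + j) by ring, h _ (by omega)]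

open Instr Ref in
/-- The evaluation of the current state of the dynamic program. -/
def evalState (c : ℕ) : Prog :=
  .seq (block [constNum (dir 6) 0, constIdx (dir 8) 0, constIdx (dir 13) 16])
    (.seq (.loop (.ltIdx (dir 13) (dir 5)) (typeStep c))
      (block [castNum (dir 10) (dir 8), divNum (ind 4) (dir 6) (dir 10)]))

theorem runs_evalState {c n : ℕ} (I : ℕ → ℕ) (N : ℕ → ℝ) (hI : ConstRegs c n I) (hz : N 9 = 0)
    {k s : ℕ} {w A : ℕ → ℕ} (h5 : I 5 = 16 + 3 * k) (h4 : I 4 = 17 + 2 * s)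
    (hw : ∀ t < k, I (17 + 3 * t) = 2 * w t) (hA : ∀ t < k, I (18 + 3 * t) = A t)
    (hA16 : ∀ t < k, 16 ≤ A t) (hws : ∀ t < k, 0 < I (16 + 3 * t) → w t ≤ s) :
    Runs (evalState c) ⟨I, N⟩ (k * (9 * c + 19) + 8) fun m =>
      (∀ a, a ≠ 8 → a ≠ 9 → a ≠ 10 → a ≠ 12 → a ≠ 13 → m.idx a = I a) ∧
      (∀ a, a ≠ 6 → a ≠ 7 → a ≠ 8 → a ≠ 10 → a ≠ 17 + 2 * s → m.num a = N a) ∧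
      m.num (17 + 2 * s) = (∑ t ∈ Finset.range k, I (16 + 3 * t) *
        cellMix c N (A t) (N (17 + 2 * (s - w t)))) /
          (∑ t ∈ Finset.range k, I (16 + 3 * t) : ℕ) := by
  refine (Runs.seq (U := (k * (9 * c + 18 + 1) + 1) + 3) (Runs.block (T := 4) ?_ le_rfl)).mono
    (by ring_nf; omega) fun _ h => h
  refine (Runs.seq (U := 3) ((Runs.loop (T := 9 * c + 18) (fun j m => j ≤ k ∧
      (∀ a, a ≠ 8 → a ≠ 9 → a ≠ 10 → a ≠ 12 → a ≠ 13 → m.idx a = I a) ∧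
      m.idx 13 = 16 + 3 * (k - j) ∧
      m.idx 8 = ∑ t ∈ Finset.range (k - j), I (16 + 3 * t) ∧
      (∀ a, a ≠ 6 → a ≠ 7 → a ≠ 8 → a ≠ 10 → m.num a = N a) ∧
      m.num 6 = ∑ t ∈ Finset.range (k - j), I (16 + 3 * t) *
        cellMix c N (A t) (N (17 + 2 * (s - w t)))) (j := k)
    (Q := fun m => (∀ a, a ≠ 8 → a ≠ 9 → a ≠ 10 → a ≠ 12 → a ≠ 13 → m.idx a = I a) ∧
      m.idx 8 = ∑ t ∈ Finset.range k, I (16 + 3 * t) ∧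
      (∀ a, a ≠ 6 → a ≠ 7 → a ≠ 8 → a ≠ 10 → m.num a = N a) ∧
      m.num 6 = ∑ t ∈ Finset.range k, I (16 + 3 * t) *
        cellMix c N (A t) (N (17 + 2 * (s - w t)))) ?_ ?_).mono le_rfl
    fun m hm => ?_)).mono le_rfl fun _ h => h
  · rintro j ⟨I', N'⟩ ⟨hj, hi, h13, h8, hn, h6⟩
    simp only at hi h13 h8 hn h6
    have e5 := hi 5 (by omega) (by omega) (by omega) (by omega) (by omega)
    rcases Nat.eq_zero_or_pos j with rfl | hpos
    · left
      refine ⟨?_, hi, h8, hn, h6⟩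
      simp [h13, e5, h5]
    · right
      obtain ⟨j, rfl⟩ : ∃ j', j = j' + 1 := ⟨j - 1, by omega⟩
      refine ⟨?_, j, rfl, ?_⟩
      · simp [h13, e5, h5]
        omega
      set t := k - (j + 1) with ht
      have htk : t < k := by omega
      have hkj : k - j = t + 1 := by omega
      refine (runs_typeStep (t := t) (s := s) (w := w t) (A := A t) I' N'
        (hI.congr fun a ha => hi a (by omega) (by omega) (by omega) (by omega) (by omega))
        ((hn 9 (by omega) (by omega) (by omega) (by omega)).trans hz) h13
        ((hi 4 (by omega) (by omega) (by omega) (by omega) (by omega)).trans h4)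
        ((hi _ (by omega) (by omega) (by omega) (by omega) (by omega)).trans (hw t htk))
        ((hi _ (by omega) (by omega) (by omega) (by omega) (by omega)).trans (hA t htk))
        (hA16 t htk) ?_).mono le_rfl ?_
      · rw [hi (16 + 3 * t) (by omega) (by omega) (by omega) (by omega) (by omega)]
        exact hws t htk
      · rintro ⟨I'', N''⟩ ⟨g1, g2, g3, g4, g5⟩
        simp only at g1 g2 g3 g4 g5
        have := hA16 t htk
        rw [hi (16 + 3 * t) (by omega) (by omega) (by omega) (by omega) (by omega)] at g3 g5
        rw [hn (17 + 2 * (s - w t)) (by omega) (by omega) (by omega) (by omega),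
          cellMix_congr (N := N) fun j _ => hn _ (by omega) (by omega) (by omega) (by omega)] at g5
        refine ⟨by omega, fun a b1 b2 b3 b4 b5 => (g1 a b1 b2 b3 b4 b5).trans (hi a b1 b2 b3 b4 b5),
          by rw [hkj]; exact g2, ?_,
          fun a b1 b2 b3 b4 => (g4 a b1 b2 b3 b4).trans (hn a b1 b2 b3 b4), ?_⟩
        · simp only
          rw [g3, h8, hkj, Finset.sum_range_succ]
        · simp only
          rw [g5, h6, hkj, Finset.sum_range_succ]
  · simp only [List.foldl, Nat.sub_self, Finset.range_zero, Finset.sum_empty]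
    refine ⟨le_rfl, fun a b1 b2 b3 b4 b5 => ?_, ?_, ?_, fun a b1 b2 b3 b4 => ?_, ?_⟩
    · simp [b1, b5]
    · simp
    · simp
    · simp [b1]
    · simp
  · obtain ⟨I', N'⟩ := m
    obtain ⟨hi, h8, hn, h6⟩ := hm
    simp only at hi h8 hn h6
    have e4 := hi 4 (by omega) (by omega) (by omega) (by omega) (by omega)
    refine Runs.block ?_ le_rfl
    simp (disch := omega) only [List.foldl, Instr.apply, Mem.setIdx, Mem.setNum, Mem.getIdx,
      Mem.getNum, Ref.addr, e4, h4, Function.update_self, Function.update_of_ne, h6, h8]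
    refine ⟨hi, fun a b1 b2 b3 b4 b5 => ?_, trivial⟩
    rw [Function.update_of_ne b5, Function.update_of_ne b4, hn a b1 b2 b3 b4]

/-! ### The counter of the dynamic program -/

/-- The number with the digits `d t`, `t < k`, in base `B`. -/
def digitSum (B k : ℕ) (d : ℕ → ℕ) : ℕ := ∑ t ∈ Finset.range k, d t * B ^ t

theorem digitSum_lt {n k : ℕ} {d : ℕ → ℕ} (hd : ∀ t < k, d t ≤ n) :
    digitSum (n + 1) k d < (n + 1) ^ k := by
  induction k with
  | zero => simp [digitSum]
  | succ k ih =>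
    rw [digitSum, Finset.sum_range_succ, pow_succ]
    have h1 := ih fun t ht => hd t (by omega)
    have h2 := Nat.mul_le_mul_right ((n + 1) ^ k) (hd k (by omega))
    rw [digitSum] at h1
    nlinarith

theorem digitSum_inj {n k : ℕ} {d d' : ℕ → ℕ} (hd : ∀ t < k, d t ≤ n) (hd' : ∀ t < k, d' t ≤ n)
    (h : digitSum (n + 1) k d = digitSum (n + 1) k d') : ∀ t < k, d t = d' t := by
  induction k with
  | zero => intro t ht; omega
  | succ k ih =>
    rw [digitSum, digitSum, Finset.sum_range_succ, Finset.sum_range_succ] at h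
    have h1 := digitSum_lt (k := k) fun t ht => hd t (by omega)
    have h2 := digitSum_lt (k := k) fun t ht => hd' t (by omega)
    rw [digitSum] at h1 h2
    have hk : d k = d' k := by
      have := congrArg (· / (n + 1) ^ k) h
      simpa [Nat.add_mul_div_right, Nat.div_eq_of_lt h1, Nat.div_eq_of_lt h2] using this
    rw [hk] at h
    intro t ht
    rcases Nat.lt_succ_iff_lt_or_eq.1 ht with ht | rfl
    · exact ih (fun t ht => hd t (by omega)) (fun t ht => hd' t (by omega)) (by
        rw [digitSum, digitSum]; omega) t ht
    · exact hk

theorem digitSum_update {B k t : ℕ} (ht : t < k) (d : ℕ → ℕ) (x : ℕ) :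
    digitSum B k (Function.update d t x) + d t * B ^ t = digitSum B k d + x * B ^ t := by
  have ht' : t ∈ Finset.range k := Finset.mem_range.2 ht
  rw [digitSum, digitSum, ← Finset.add_sum_erase _ _ ht', ← Finset.add_sum_erase _ _ ht',
    Finset.sum_congr rfl (g := fun t' => d t' * B ^ t') fun t' h => by
      rw [Function.update_of_ne (Finset.ne_of_mem_erase h)]]
  simp
  ring

open Instr Ref in
/-- The step to the next state of the dynamic program. -/
def nextState : Prog :=
  .seq (block [constIdx (dir 13) 16])
    (.seq (.loop (.leIdx (dir 0) (ind 13))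
      (block [constIdx (ind 13) 0, addIdx (dir 13) (dir 13) (dir 1),
        addIdx (dir 13) (dir 13) (dir 2)]))
      (block [addIdx (ind 13) (ind 13) (dir 1), addIdx (dir 4) (dir 4) (dir 2)]))

/-- Addition of one in base `n + 1`. The additional digit `k` is zero and thus below `n`, so the
carry stops there at the latest. -/
theorem runs_nextState {c n : ℕ} (I : ℕ → ℕ) (N : ℕ → ℝ) (hI : ConstRegs c n I) (hn : 0 < n)
    {k s : ℕ} (hd : ∀ t < k, I (16 + 3 * t) ≤ n) (hdk : I (16 + 3 * k) = 0)
    (hs : digitSum (n + 1) (k + 1) (fun t => I (16 + 3 * t)) = s) :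
    Runs nextState ⟨I, N⟩ (k * 5 + 6) fun m => m.num = N ∧
      (∀ a, a ≠ 4 → a ≠ 13 → (∀ t ≤ k, a ≠ 16 + 3 * t) → m.idx a = I a) ∧ m.idx 4 = I 4 + 2 ∧
      (∀ t < k, m.idx (16 + 3 * t) ≤ n) ∧
      digitSum (n + 1) (k + 1) (fun t => m.idx (16 + 3 * t)) = s + 1 := by
  have hupd : ∀ (I : ℕ → ℕ) t x, (fun t' => Function.update I (16 + 3 * t) x (16 + 3 * t')) =
      Function.update (fun t' => I (16 + 3 * t')) t x := by
    intro I t x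
    funext t'
    by_cases h : t' = t
    · subst h; simp
    · rw [Function.update_of_ne h, Function.update_of_ne (by omega)]
  refine (Runs.seq (U := (k * (4 + 1) + 1) + 3) (Runs.block (T := 2) ?_ le_rfl)).mono
    (by omega) fun _ h => h
  -- The invariant keeps a carry of weight `(n + 1) ^ (k - j)` pending: the digits together with it
  -- represent `s + 1`.
  refine (Runs.seq (U := 3) (Runs.loop (T := 4) (fun j m => j ≤ k ∧ m.num = N ∧
      (∀ a, a ≠ 4 → a ≠ 13 → (∀ t ≤ k, a ≠ 16 + 3 * t) → m.idx a = I a) ∧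
      m.idx 13 = 16 + 3 * (k - j) ∧ m.idx 4 = I 4 ∧ m.idx (16 + 3 * k) = 0 ∧
      (∀ t < k, m.idx (16 + 3 * t) ≤ n) ∧
      digitSum (n + 1) (k + 1) (fun t => m.idx (16 + 3 * t)) + (n + 1) ^ (k - j) = s + 1)
      (j := k) ?_ ?_)).mono le_rfl fun _ h => h
  · rintro j ⟨I', N'⟩ ⟨hj, rfl, hi, h13, h4, hk0, hb, hsum⟩
    simp only at hi h13 h4 hk0 hb hsum
    have e0 := hi 0 (by omega) (by omega) (by omega)
    have e1 := hi 1 (by omega) (by omega) (by omega)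
    have e2 := hi 2 (by omega) (by omega) (by omega)
    rw [hI.h0] at e0
    rw [hI.h1] at e1
    rw [hI.h2] at e2
    set t := k - j with ht
    by_cases hle : n ≤ I' (16 + 3 * t)
    · right
      have htk : t ≠ k := fun h => by rw [h] at hle; omega
      obtain ⟨j, rfl⟩ : ∃ j', j = j' + 1 := ⟨j - 1, by omega⟩
      have hkj : k - j = t + 1 := by omega
      have hteq : I' (16 + 3 * t) = n := le_antisymm (hb t (by omega)) hle
      refine ⟨by simpa [e0, h13] using hle, j, rfl, Runs.block ?_ le_rfl⟩
      simp (disch := omega) only [List.foldl, Instr.apply, Mem.setIdx, Mem.setNum, Mem.getIdx,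
        Mem.getNum, Ref.addr, h13, e1, e2, Function.update_self, Function.update_of_ne, hk0, h4,
        hkj, hupd]
      refine ⟨by omega, trivial, fun a b1 b2 b3 => ?_, by omega, trivial, trivial,
        fun t' ht' => ?_, ?_⟩
      · rw [Function.update_of_ne b2, Function.update_of_ne b2,
          Function.update_of_ne (b3 t (by omega)), hi a b1 b2 b3]
      · by_cases htt : t' = t
        · subst htt
          simp
        · rw [Function.update_of_ne (by omega)]
          exact hb t' ht'
      · have := digitSum_update (B := n + 1) (k := k + 1) (t := t) (by omega)
          (fun t' => I' (16 + 3 * t')) 0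
        simp only [hteq] at this
        rw [pow_succ]
        nlinarith
    · left
      refine ⟨by simpa [e0, h13] using hle, Runs.block ?_ le_rfl⟩
      simp (disch := omega) only [List.foldl, Instr.apply, Mem.setIdx, Mem.setNum, Mem.getIdx,
        Mem.getNum, Ref.addr, h13, e1, e2, Function.update_self, Function.update_of_ne, h4, hupd]
      refine ⟨trivial, fun a b1 b2 b3 => ?_, trivial, fun t' ht' => ?_, ?_⟩
      · rw [Function.update_of_ne b1, Function.update_of_ne (b3 t (by omega)), hi a b1 b2 b3]
      · by_cases htt : t' = t
        · subst htt
          simp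
          omega
        · rw [Function.update_of_ne (by omega)]
          exact hb t' ht'
      · have := digitSum_update (B := n + 1) (k := k + 1) (t := t) (by omega)
          (fun t' => I' (16 + 3 * t')) (I' (16 + 3 * t) + 1)
        simp only [add_mul] at this
        omega
  · simp only [List.foldl, Nat.sub_self]
    have hu : ∀ a, a ≠ 13 → Function.update I 13 16 a = I a := fun a h =>
      Function.update_of_ne h _ _
    simp (disch := omega) only [Instr.apply, Mem.setIdx, Ref.addr, hu]
    refine ⟨le_rfl, trivial, fun a b1 b2 b3 => hu a b2, by simp, trivial, hdk, hd, ?_⟩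
    rw [hs, pow_zero]

end ProphetSecretary

/-! ### Filling the table of the dynamic program -/

namespace ProphetSecretary

attribute [local simp] Instr.apply Mem.setIdx Mem.setNum Mem.getIdx Mem.getNum Ref.addr Test.Holds

theorem countOptAux_congr {k : ℕ} {F : ℕ → ℝ → ℝ} {m : ℕ} {d d' : ℕ → ℕ}
    (h : ∀ t < k, d t = d' t) : countOptAux k F m d = countOptAux k F m d' := by
  induction m generalizing d d' with
  | zero => rfl
  | succ m ih =>
    rw [countOptAux, countOptAux]
    congr 1
    refine Finset.sum_congr rfl fun t ht => ?_
    rw [h t (Finset.mem_range.1 ht)]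
    congr 2
    refine ih fun t' ht' => ?_
    by_cases htt : t' = t
    · subst htt; simp
    · rw [Function.update_of_ne htt, Function.update_of_ne htt, h t' ht']

theorem countOpt_congr {k : ℕ} {F : ℕ → ℝ → ℝ} {d d' : ℕ → ℕ}
    (h : ∀ t < k, d t = d' t) : countOpt k F d = countOpt k F d' := by
  rw [countOpt, countOpt, Finset.sum_congr rfl fun t ht => h t (Finset.mem_range.1 ht),
    countOptAux_congr h]

/-- Removing a variable of type `t` lowers the number of the state by `(n + 1) ^ t`, so all
predecessors have smaller numbers and are already in the table. The digits `e` in memory agree with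
any `d` of the same number because representations in base `n + 1` are unique. -/
theorem countOpt_of_table {n k s : ℕ} {F : ℕ → ℝ → ℝ} {V : ℕ → ℝ} {e d : ℕ → ℕ}
    (he : ∀ t < k, e t ≤ n) (hs : digitSum (n + 1) k e = s)
    (hV : ∀ d : ℕ → ℕ, (∀ t < k, d t ≤ n) → digitSum (n + 1) k d < s →
      V (digitSum (n + 1) k d) = countOpt k F d)
    (hd : ∀ t < k, d t ≤ n) (hds : digitSum (n + 1) k d = s) :
    (∑ t ∈ Finset.range k, e t * F t (V (s - (n + 1) ^ t))) / (∑ t ∈ Finset.range k, e t : ℕ) =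
      countOpt k F d := by
  rw [countOpt_congr (digitSum_inj hd he (hds.trans hs.symm)), countOpt_eq]
  congr 1
  refine Finset.sum_congr rfl fun t ht => ?_
  have ht := Finset.mem_range.1 ht
  rcases Nat.eq_zero_or_pos (e t) with hz0 | hp
  · rw [hz0]; simp
  have hsu := sum_update_pred ht hp fun t => (n + 1) ^ t
  have hpw : 0 < (n + 1) ^ t := by positivity
  rw [digitSum] at hs
  have h1 : digitSum (n + 1) k (Function.update e t (e t - 1)) = s - (n + 1) ^ t := by
    rw [digitSum]
    omega
  rw [← h1, hV]
  · intro t' ht'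
    by_cases htt : t' = t
    · subst htt
      have := he t' ht'
      simp
      omega
    · rw [Function.update_of_ne htt]
      exact he t' ht'
  · omega

open Instr Ref in
/-- The dynamic program. -/
def dynProg (c : ℕ) : Prog :=
  .seq (block [constIdx (dir 4) 17, subIdx (dir 5) (dir 11) (dir 1)])
    (.seq (.loop (.ltIdx (ind 5) (dir 1)) (.seq (evalState c) nextState))
      (block [copyNum (dir 0) (ind 15)]))

theorem runs_dynProg {c n : ℕ} (I : ℕ → ℕ) (N : ℕ → ℝ) (hI : ConstRegs c n I) (hn : 0 < n)
    (hz : N 9 = 0) {k : ℕ} {α d : ℕ → ℕ} (h11 : I 11 = 17 + 3 * k)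
    (hdig : ∀ t ≤ k, I (16 + 3 * t) = 0) (hw : ∀ t < k, I (17 + 3 * t) = 2 * (n + 1) ^ t)
    (hA : ∀ t < k, I (18 + 3 * t) = 16 + 2 * α t) (hd : ∀ t < k, d t ≤ n)
    (h15 : I 15 = 17 + 2 * digitSum (n + 1) k d) :
    Runs (dynProg c) ⟨I, N⟩ ((n + 1) ^ k * ((k + 1) * (9 * c + 40)) + 6) fun m =>
      m.num 0 = countOpt k (fun t => cellMix c N (16 + 2 * α t)) d := by
  set F : ℕ → ℝ → ℝ := fun t => cellMix c N (16 + 2 * α t) with hF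
  refine (Runs.seq (U := ((n + 1) ^ k * (((k * (9 * c + 19) + 8) + (k * 5 + 6)) + 1) + 1) + 2)
    (Runs.block (T := 3) ?_ le_rfl)).mono ?_ fun _ h => h
  swap
  · have : k * (9 * c + 19) + 8 + (k * 5 + 6) + 1 ≤ (k + 1) * (9 * c + 40) := by nlinarith
    have := Nat.mul_le_mul_left ((n + 1) ^ k) this
    omega
  -- Here `s` is the current state, and all states with smaller numbers have their values in the
  -- table. The extra digit `k` turns positive exactly when `s` reaches `(n + 1) ^ k`, which ends
  -- the loop.
  refine (Runs.seq (U := 2) ((Runs.loop (T := (k * (9 * c + 19) + 8) + (k * 5 + 6)) (fun j m =>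
      ∃ s, j = (n + 1) ^ k - s ∧ s ≤ (n + 1) ^ k ∧
      (∀ a, (a < 4 ∨ a = 7 ∨ a = 15 ∨ ∃ t < k, a = 17 + 3 * t ∨ a = 18 + 3 * t) →
        m.idx a = I a) ∧
      m.idx 5 = 16 + 3 * k ∧ m.idx 4 = 17 + 2 * s ∧ (∀ t < k, m.idx (16 + 3 * t) ≤ n) ∧
      digitSum (n + 1) (k + 1) (fun t => m.idx (16 + 3 * t)) = s ∧
      m.num 9 = 0 ∧ (∀ a, m.num (16 + 2 * a) = N (16 + 2 * a)) ∧
      ∀ d : ℕ → ℕ, (∀ t < k, d t ≤ n) → digitSum (n + 1) k d < s →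
        m.num (17 + 2 * digitSum (n + 1) k d) = countOpt k F d) (j := (n + 1) ^ k)
      (Q := fun m => m.idx 15 = I 15 ∧ ∀ d : ℕ → ℕ, (∀ t < k, d t ≤ n) →
        m.num (17 + 2 * digitSum (n + 1) k d) = countOpt k F d) ?_ ?_).mono le_rfl
      fun m hm => ?_)).mono le_rfl fun _ h => h
  · rintro j ⟨I', N'⟩ ⟨s, hj, hs, hi, h5, h4, hb, hsum, hz', hdat, htab⟩
    simp only at hi h5 h4 hb hsum hz' hdat htab
    have hI' : ConstRegs c n I' := hI.congr fun a ha => hi a (by omega)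
    have hsplit : digitSum (n + 1) k (fun t => I' (16 + 3 * t)) +
        I' (16 + 3 * k) * (n + 1) ^ k = s := by
      rw [← hsum, digitSum, digitSum, Finset.sum_range_succ]
    have hlow := digitSum_lt (k := k) (d := fun t => I' (16 + 3 * t)) hb
    rcases Nat.eq_zero_or_pos (I' (16 + 3 * k)) with h0 | hpos
    · right
      rw [h0, zero_mul, add_zero] at hsplit
      refine ⟨by simp [h5, h0, hI'.h1], j - 1, by omega, ?_⟩
      refine Runs.seq ((runs_evalState (k := k) (s := s) (w := fun t => (n + 1) ^ t)
        (A := fun t => 16 + 2 * α t) I' N' hI' hz' h5 h4 ?_ ?_ (fun t _ => by omega) ?_).mono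
        le_rfl ?_)
      · intro t ht
        rw [hi _ (by right; right; right; exact ⟨t, ht, Or.inl rfl⟩), hw t ht]
      · intro t ht
        rw [hi _ (by right; right; right; exact ⟨t, ht, Or.inr rfl⟩), hA t ht]
      · intro t ht hpos
        rw [← hsplit, digitSum]
        refine le_trans (Nat.le_mul_of_pos_left _ hpos)
          (Finset.single_le_sum (f := fun t => I' (16 + 3 * t) * (n + 1) ^ t)
            (fun _ _ => Nat.zero_le _) (Finset.mem_range.2 ht))
      · rintro ⟨I'', N''⟩ ⟨g1, g2, g3⟩
        simp only at g1 g2 g3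
        have g1' : ∀ t, I'' (16 + 3 * t) = I' (16 + 3 * t) := fun t =>
          g1 _ (by omega) (by omega) (by omega) (by omega) (by omega)
        refine (runs_nextState (k := k) (s := s) I'' N'' (hI'.congr fun a ha =>
          g1 a (by omega) (by omega) (by omega) (by omega) (by omega)) hn
          (fun t ht => by rw [g1' t]; exact hb t ht) (by rw [g1', h0])
          (by simp only [g1']; exact hsum)).mono le_rfl ?_
        rintro ⟨I3, N3⟩ ⟨rfl, f1, f2, f3, f4⟩
        simp only at f1 f2 f3 f4 g2 g3
        refine ⟨s + 1, by omega, by omega, fun a ha => ?_, ?_, ?_, f3, f4, ?_, fun a => ?_,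
          fun d' hd' hlt => ?_⟩
        · change I3 a = I a
          rw [← hi a ha, ← g1 a, f1 a]
          all_goals rcases ha with ha | ha | ha | ⟨t, _, ha | ha⟩ <;> intros <;> omega
        · exact (f1 5 (by omega) (by omega) (by intros; omega)).trans
            ((g1 5 (by omega) (by omega) (by omega) (by omega) (by omega)).trans h5)
        · simp only
          rw [f2, g1 4 (by omega) (by omega) (by omega) (by omega) (by omega), h4]
          ring
        · exact (g2 9 (by omega) (by omega) (by omega) (by omega) (by omega)).trans hz'
        · exact (g2 _ (by omega) (by omega) (by omega) (by omega) (by omega)).trans (hdat a)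
        · simp only
          rcases Nat.lt_succ_iff_lt_or_eq.1 hlt with hlt | heq
          · rw [g2 _ (by omega) (by omega) (by omega) (by omega) (by omega), htab d' hd' hlt]
          · rw [heq, g3, ← countOpt_of_table (V := fun x => N' (17 + 2 * x)) hb hsplit htab hd' heq]
            congr 1
            refine Finset.sum_congr rfl fun t _ => ?_
            rw [hF, cellMix_congr (N := N) fun j _ => ?_]
            rw [show 16 + 2 * α t + 2 * j = 16 + 2 * (α t + j) by ring, hdat]
    · left
      have hge : (n + 1) ^ k ≤ s := by nlinarith
      refine ⟨?_, hi 15 (by omega), fun d' hd' =>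
        htab d' hd' ((digitSum_lt hd').trans_le hge)⟩
      simp [h5, hI'.h1]
      omega
  · refine ⟨0, by omega, by omega, ?_⟩
    have hu : ∀ a, a ≠ 4 → a ≠ 5 → Function.update (Function.update I 4 17) 5 (16 + 3 * k) a = I a :=
      fun a h1 h2 => by rw [Function.update_of_ne h2, Function.update_of_ne h1]
    have hz1 : digitSum (n + 1) (k + 1) (fun t => I (16 + 3 * t)) = 0 := by
      refine Finset.sum_eq_zero fun t ht => ?_
      change I (16 + 3 * t) * _ = 0
      rw [hdig t (by have := Finset.mem_range.1 ht; omega), zero_mul]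
    have e5 : 17 + 3 * k - 1 = 16 + 3 * k := by omega
    simp (disch := omega) only [List.foldl, Instr.apply, Mem.setIdx, Mem.getIdx, Ref.addr,
      Function.update_of_ne, h11, hI.h1, e5, hu, hz1]
    refine ⟨fun a ha => ?_, by simp, by simp, fun t ht => ?_, trivial, hz, fun _ => trivial,
      fun d' _ h => by omega⟩
    · refine hu a ?_ ?_ <;> rcases ha with ha | ha | ha | ⟨t, _, ha | ha⟩ <;> omega
    · rw [hdig t ht.le]; omega
  · obtain ⟨I', N'⟩ := m
    obtain ⟨h1, h2⟩ := hm
    refine Runs.block ?_ le_rfl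
    simp only at h1 h2
    simp [h1, h15, h2 d hd]

end ProphetSecretary

namespace ProphetSecretary

/-! ### Finding the types of variables on the machine -/

attribute [local simp] Instr.apply Mem.setIdx Mem.setNum Mem.getIdx Mem.getNum Ref.addr Test.Holds

open Instr Ref in
/-- The comparison of two cells. -/
def compareCell : Prog :=
  .seq (.ite (.ltNum (ind 8) (ind 5)) (block [constIdx (dir 9) 0]) .skip)
    (.seq (.ite (.ltNum (ind 5) (ind 8)) (block [constIdx (dir 9) 0]) .skip)
      (block [addIdx (dir 8) (dir 8) (dir 2), addIdx (dir 5) (dir 5) (dir 2)]))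

open Classical in
theorem runs_compareCell (I : ℕ → ℕ) (N : ℕ → ℝ) (h2 : I 2 = 2) :
    Runs compareCell ⟨I, N⟩ 9 fun m => m.num = N ∧
      (∀ a, a ≠ 5 → a ≠ 8 → a ≠ 9 → m.idx a = I a) ∧ m.idx 5 = I 5 + 2 ∧ m.idx 8 = I 8 + 2 ∧
      m.idx 9 = if N (I 8) = N (I 5) then I 9 else 0 := by
  -- Two reals are equal if neither is less than the other; either strict inequality clears the flag
  -- in index cell `9`.
  refine (Runs.seq (U := 6) (Runs.ite (T := 2) (fun hb => Runs.block ?_ le_rfl)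
    fun hb => Runs.skip ?_ (by omega))).mono le_rfl fun _ h => h
  all_goals
    refine (Runs.seq (U := 3) (Runs.ite (T := 2) (fun hb' => Runs.block ?_ le_rfl)
      fun hb' => Runs.skip ?_ (by omega))).mono le_rfl fun _ h => h
  all_goals
    refine Runs.block ?_ le_rfl
    simp [h2] at hb hb' ⊢
    refine ⟨fun a b1 b2 b3 => by simp [b1, b2, b3], ?_⟩
  · exact fun h => absurd h hb.ne
  · exact fun h => absurd h hb.ne
  · exact fun h => absurd h hb'.ne'
  · exact fun h => absurd (le_antisymm hb' hb) h

/-- The cells of two variables have the same contents. -/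
def EqCells (c : ℕ) (N : ℕ → ℝ) (A A' : ℕ) : Prop := ∀ j < 2 * c, N (A + 2 * j) = N (A' + 2 * j)

open Instr Ref in
/-- The comparison of the current variable with the representative of a type. -/
def compareType (c : ℕ) : Prog :=
  .seq (block [addIdx (dir 12) (dir 13) (dir 1), copyIdx (dir 5) (ind 12), copyIdx (dir 8) (dir 4),
      constIdx (dir 9) 1])
    (.seq (repeated compareCell (2 * c))
      (.seq (.ite (.ltIdx (dir 7) (dir 9)) (block [copyIdx (dir 14) (dir 13)]) .skip)
        (block [addIdx (dir 13) (dir 13) (dir 1), addIdx (dir 13) (dir 13) (dir 2)])))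

open Classical in
theorem runs_compareType {c n : ℕ} (I : ℕ → ℕ) (N : ℕ → ℝ) (hI : ConstRegs c n I) {t A A' : ℕ}
    (h13 : I 13 = 17 + 3 * t) (hA' : I (18 + 3 * t) = A') (h4 : I 4 = A) :
    Runs (compareType c) ⟨I, N⟩ (18 * c + 12) fun m => m.num = N ∧
      (∀ a, a ≠ 5 → a ≠ 8 → a ≠ 9 → a ≠ 12 → a ≠ 13 → a ≠ 14 → m.idx a = I a) ∧
      m.idx 13 = 17 + 3 * (t + 1) ∧
      m.idx 14 = if EqCells c N A A' then 17 + 3 * t else I 14 := by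
  obtain ⟨h0, h1, h2, h3, h7⟩ := hI
  refine (Runs.seq (U := (2 * c * 9 + 1) + (3 + 3)) (Runs.block (T := 5) ?_ le_rfl)).mono
    (by ring_nf; omega) fun _ h => h
  refine (Runs.seq (U := 3 + 3) ((Runs.repeated (T := 9) (fun j m => m.num = N ∧
    (∀ a, a ≠ 5 → a ≠ 8 → a ≠ 9 → a ≠ 12 → m.idx a = I a) ∧
    m.idx 5 = A' + 2 * j ∧ m.idx 8 = A + 2 * j ∧
    m.idx 9 = if ∀ i < j, N (A + 2 * i) = N (A' + 2 * i) then 1 else 0) ?_ ?_).mono le_rfl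
    fun m hm => ?_)).mono le_rfl fun _ h => h
  · rintro j ⟨I', N'⟩ hj ⟨rfl, hi, h5, h8, h9⟩
    simp only at hi h5 h8 h9
    refine (runs_compareCell I' N' (by
      rw [hi 2 (by omega) (by omega) (by omega) (by omega), h2])).mono le_rfl ?_
    rintro ⟨I'', N''⟩ ⟨rfl, g1, g5, g8, g9⟩
    simp only at g1 g5 g8 g9
    refine ⟨rfl, fun a b1 b2 b3 b4 => (g1 a b1 b2 b3).trans (hi a b1 b2 b3 b4), ?_, ?_, ?_⟩
    · simp only; omega
    · simp only; omega
    · simp only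
      rw [g9, h5, h8, h9, ← ite_and]
      refine if_congr ?_ rfl rfl
      rw [Nat.forall_lt_succ_right, and_comm]
  · have e12 : 17 + 3 * t + 1 = 18 + 3 * t := by omega
    refine ⟨by simp, fun a b1 b2 b3 b4 => by simp [b1, b2, b3, b4], ?_, ?_, ?_⟩
    · simp (disch := omega) [h13, h1, e12, hA']
    · simp [h4]
    · simp
  · obtain ⟨I', N'⟩ := m
    obtain ⟨rfl, hi, h5, h8, h9⟩ := hm
    simp only at hi h5 h8 h9
    have e1 := hi 1 (by omega) (by omega) (by omega) (by omega)
    have e2 := hi 2 (by omega) (by omega) (by omega) (by omega)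
    have e7 := hi 7 (by omega) (by omega) (by omega) (by omega)
    have e13 := hi 13 (by omega) (by omega) (by omega) (by omega)
    have e14 := hi 14 (by omega) (by omega) (by omega) (by omega)
    rw [h1] at e1
    rw [h2] at e2
    rw [h7] at e7
    rw [h13] at e13
    refine (Runs.seq (U := 3) (Runs.ite (T := 2) (fun hb => Runs.block ?_ le_rfl)
      fun hb => Runs.skip ?_ (by omega))).mono le_rfl fun _ h => h
    all_goals
      refine Runs.block ?_ le_rfl
      simp only [Test.Holds, Mem.getIdx, Ref.addr, e7, h9] at hb
      simp [e1, e2, e13, e14]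
    · have hE : EqCells c N' A A' := by
        by_contra hcon
        rw [EqCells] at hcon
        rw [if_neg hcon] at hb
        omega
      refine ⟨fun a b1 b2 b3 b4 b5 b6 => by simp [b5, b6, hi a b1 b2 b3 b4], by omega, fun h => absurd hE h⟩
    · have hE : ¬ EqCells c N' A A' := by
        intro hcon
        rw [EqCells] at hcon
        rw [if_pos hcon] at hb
        omega
      refine ⟨fun a b1 b2 b3 b4 b5 b6 => by simp [b5, hi a b1 b2 b3 b4], by omega, fun h => absurd h hE⟩

open Instr Ref in
/-- The search for the type of the current variable. -/
def findType (c : ℕ) : Prog :=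
  .seq (block [constIdx (dir 13) 17, copyIdx (dir 14) (dir 11)])
    (.loop (.ltIdx (dir 13) (dir 11)) (compareType c))

theorem runs_findType {c n : ℕ} (I : ℕ → ℕ) (N : ℕ → ℝ) (hI : ConstRegs c n I) {k A : ℕ}
    {A' : ℕ → ℕ} (h11 : I 11 = 17 + 3 * k) (hA' : ∀ t < k, I (18 + 3 * t) = A' t) (h4 : I 4 = A) :
    Runs (findType c) ⟨I, N⟩ (k * (18 * c + 13) + 4) fun m => m.num = N ∧
      (∀ a, a ≠ 5 → a ≠ 8 → a ≠ 9 → a ≠ 12 → a ≠ 13 → a ≠ 14 → m.idx a = I a) ∧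
      ∃ t, m.idx 14 = 17 + 3 * t ∧ ((t < k ∧ EqCells c N A (A' t)) ∨
        (t = k ∧ ∀ t < k, ¬ EqCells c N A (A' t))) := by
  refine (Runs.seq (U := k * (18 * c + 12 + 1) + 1) (Runs.block (T := 3) ?_ le_rfl)).mono
    (by ring_nf; omega) fun _ h => h
  -- The result starts as `17 + 3 * k`, the place of the weight of a type yet to be created, and
  -- keeps this value if the search fails.
  refine Runs.loop (fun j m => j ≤ k ∧ m.num = N ∧
    (∀ a, a ≠ 5 → a ≠ 8 → a ≠ 9 → a ≠ 12 → a ≠ 13 → a ≠ 14 → m.idx a = I a) ∧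
    m.idx 13 = 17 + 3 * (k - j) ∧
    ∃ t, m.idx 14 = 17 + 3 * t ∧ ((t < k ∧ EqCells c N A (A' t)) ∨
      (t = k ∧ ∀ t < k - j, ¬ EqCells c N A (A' t)))) ?_ ?_
  · rintro j ⟨I', N'⟩ ⟨hj, rfl, hi, h13, p, h14, hp⟩
    simp only at hi h13 h14
    have hi' : ∀ a, a < 5 ∨ a = 7 ∨ a = 11 ∨ 15 ≤ a → I' a = I a := fun a ha =>
      hi a (by omega) (by omega) (by omega) (by omega) (by omega) (by omega)
    have e11 := hi' 11 (by omega)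
    rcases Nat.eq_zero_or_pos j with rfl | hpos
    · left
      refine ⟨by simp [h13, e11, h11], rfl, hi, p, h14, hp⟩
    · right
      obtain ⟨j, rfl⟩ : ∃ j', j = j' + 1 := ⟨j - 1, by omega⟩
      refine ⟨by simp [h13, e11, h11]; omega, j, rfl, ?_⟩
      set t := k - (j + 1) with ht
      have htk : t < k := by omega
      have hkj : k - j = t + 1 := by omega
      refine (runs_compareType (t := t) (A := A) (A' := A' t) I' N'
        (hI.congr fun a ha => hi' a (by omega)) h13 ((hi' _ (by omega)).trans (hA' t htk))
        ((hi' 4 (by omega)).trans h4)).mono le_rfl ?_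
      rintro ⟨I'', N''⟩ ⟨rfl, g1, g13, g14⟩
      simp only at g1 g13 g14
      refine ⟨by omega, rfl, fun a b1 b2 b3 b4 b5 b6 => (g1 a b1 b2 b3 b4 b5 b6).trans
        (hi a b1 b2 b3 b4 b5 b6), by simp only; omega, ?_⟩
      by_cases hE : EqCells c N'' A (A' t)
      · rw [if_pos hE] at g14
        exact ⟨t, g14, Or.inl ⟨htk, hE⟩⟩
      · rw [if_neg hE, h14] at g14
        refine ⟨p, g14, hp.imp_right fun ⟨h1, h2⟩ => ⟨h1, fun t' ht' => ?_⟩⟩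
        rcases Nat.lt_succ_iff_lt_or_eq.1 (hkj ▸ ht') with h | rfl
        · exact h2 t' h
        · exact hE
  · refine ⟨le_rfl, by simp, fun a b1 b2 b3 b4 b5 b6 => by simp [b5, b6], by simp, k,
      by simp [h11], Or.inr ⟨rfl, fun t ht => by omega⟩⟩

open Instr Ref in
/-- A new type with the current variable as representative. -/
def addType : Prog :=
  .seq (block [copyIdx (ind 11) (dir 10), addIdx (dir 12) (dir 11) (dir 1), copyIdx (ind 12) (dir 4),
      subIdx (dir 12) (dir 11) (dir 1), constIdx (ind 12) 0, copyIdx (dir 12) (dir 0),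
      copyIdx (dir 5) (dir 10)])
    (.seq (.loop (.ltIdx (dir 7) (dir 12))
        (block [addIdx (dir 10) (dir 10) (dir 5), subIdx (dir 12) (dir 12) (dir 1)]))
      (block [addIdx (dir 11) (dir 11) (dir 1), addIdx (dir 11) (dir 11) (dir 2)]))

theorem runs_addType {c n : ℕ} (I : ℕ → ℕ) (N : ℕ → ℝ) (hI : ConstRegs c n I) {k : ℕ}
    (h11 : I 11 = 17 + 3 * k) (h10 : I 10 = 2 * (n + 1) ^ k) :
    Runs addType ⟨I, N⟩ (n * 4 + 12) fun m => m.num = N ∧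
      (∀ a, a ≠ 5 → a ≠ 10 → a ≠ 11 → a ≠ 12 → a ≠ 16 + 3 * k → a ≠ 17 + 3 * k →
        a ≠ 18 + 3 * k → m.idx a = I a) ∧ m.idx 10 = 2 * (n + 1) ^ (k + 1) ∧
      m.idx 11 = 17 + 3 * (k + 1) ∧ m.idx (16 + 3 * k) = 0 ∧
      m.idx (17 + 3 * k) = 2 * (n + 1) ^ k ∧ m.idx (18 + 3 * k) = I 4 := by
  obtain ⟨h0, h1, h2, h3, h7⟩ := hI
  refine (Runs.seq (U := (n * (3 + 1) + 1) + 3) (Runs.block (T := 8) ?_ le_rfl)).mono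
    (by omega) fun _ h => h
  -- Indices cannot be multiplied, so the next weight is formed by adding the old one `n` times.
  -- Weights are stored doubled because the table has stride two.
  refine (Runs.seq (U := 3) (Runs.loop (T := 3) (fun j m => j ≤ n ∧ m.num = N ∧
      (∀ a, a ≠ 5 → a ≠ 10 → a ≠ 12 → a ≠ 16 + 3 * k → a ≠ 17 + 3 * k →
        a ≠ 18 + 3 * k → m.idx a = I a) ∧ m.idx 5 = 2 * (n + 1) ^ k ∧ m.idx 12 = j ∧
      m.idx 10 + j * (2 * (n + 1) ^ k) = 2 * (n + 1) ^ (k + 1) ∧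
      m.idx (16 + 3 * k) = 0 ∧
      m.idx (17 + 3 * k) = 2 * (n + 1) ^ k ∧ m.idx (18 + 3 * k) = I 4) (j := n)
      ?_ ?_)).mono le_rfl fun _ h => h
  · rintro j ⟨I', N'⟩ ⟨hj, rfl, hi, g5, g12, g10, gd, gw, gr⟩
    simp only at hi g5 g12 g10 gd gw gr
    have e1 := hi 1 (by omega) (by omega) (by omega) (by omega) (by omega) (by omega)
    have e2 := hi 2 (by omega) (by omega) (by omega) (by omega) (by omega) (by omega)
    have e7 := hi 7 (by omega) (by omega) (by omega) (by omega) (by omega) (by omega)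
    have e11 := hi 11 (by omega) (by omega) (by omega) (by omega) (by omega) (by omega)
    rw [h1] at e1
    rw [h2] at e2
    rw [h7] at e7
    rw [h11] at e11
    rcases Nat.eq_zero_or_pos j with rfl | hpos
    · left
      refine ⟨by simp [e7, g12], Runs.block ?_ le_rfl⟩
      simp (disch := omega) [e1, e2, e11, gd, gw, gr]
      refine ⟨fun a b1 b2 b3 b4 b5 b6 b7 => by simp [b3, hi a b1 b2 b4 b5 b6 b7], ?_, by omega⟩
      simpa using g10
    · right
      obtain ⟨j, rfl⟩ : ∃ j', j = j' + 1 := ⟨j - 1, by omega⟩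
      refine ⟨by simp [e7, g12], j, rfl, Runs.block ?_ le_rfl⟩
      simp (disch := omega) [e1, g12, g5, gd, gw, gr]
      refine ⟨by omega, fun a b1 b2 b3 b4 b5 b6 => by simp [b2, b3, hi a b1 b2 b3 b4 b5 b6], ?_⟩
      rw [← g10]
      ring
  · have e1 : 17 + 3 * k + 1 = 18 + 3 * k := by omega
    have e2 : 17 + 3 * k - 1 = 16 + 3 * k := by omega
    simp (disch := omega) [h11, h10, h1, h0, e1, e2]
    refine ⟨fun a b1 b2 b3 b4 b5 b6 => by simp [b1, b3, b4, b5, b6], ?_⟩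
    ring

open Instr Ref in
/-- The classification of the variables into types. -/
def classify (c : ℕ) : Prog :=
  .seq (block [constIdx (dir 4) 18, copyIdx (dir 6) (dir 0), constIdx (dir 10) 2,
      constIdx (dir 11) 17, constIdx (dir 15) 17])
    (.seq (.loop (.ltIdx (dir 7) (dir 6))
        (.seq (findType c) (.seq (.ite (.ltIdx (dir 14) (dir 11)) .skip addType)
          (block [addIdx (dir 15) (dir 15) (ind 14), addIdx (dir 4) (dir 4) (dir 3),
            addIdx (dir 4) (dir 4) (dir 3), subIdx (dir 6) (dir 6) (dir 1)]))))
      (block [subIdx (dir 12) (dir 11) (dir 1), constIdx (ind 12) 0]))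

/-- The first `i` variables have been classified into `k` types: type `t` has the variable `ρ t` as
its representative, and variable `i'` is of type `τ i'`. -/
structure Classified (c n : ℕ) (N : ℕ → ℝ) (i k : ℕ) (ρ τ : ℕ → ℕ) (I : ℕ → ℕ) : Prop where
  h11 : I 11 = 17 + 3 * k
  h15 : I 15 = 17 + 2 * ∑ i' ∈ Finset.range i, (n + 1) ^ τ i'
  dig : ∀ t < k, I (16 + 3 * t) = 0
  weight : ∀ t < k, I (17 + 3 * t) = 2 * (n + 1) ^ t
  repr : ∀ t < k, I (18 + 3 * t) = 18 + 4 * c * ρ t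
  repr_lt : ∀ t < k, ρ t < i
  type_lt : ∀ i' < i, τ i' < k
  eqCells : ∀ i' < i, EqCells c N (18 + 4 * c * i') (18 + 4 * c * ρ (τ i'))
  distinct : ∀ t < k, ∀ t' < t, ¬ EqCells c N (18 + 4 * c * ρ t) (18 + 4 * c * ρ t')

/-- Different types have different representatives. This bounds the length of each search by `n`. -/
theorem Classified.le {c n : ℕ} {N : ℕ → ℝ} {i k : ℕ} {ρ τ : ℕ → ℕ} {I : ℕ → ℕ}
    (h : Classified c n N i k ρ τ I) : k ≤ i := by
  have hinj : Set.InjOn ρ (Finset.range k : Set ℕ) := by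
    intro t ht t' ht' he
    simp only [Finset.coe_range, Set.mem_Iio] at ht ht'
    rcases lt_trichotomy t t' with hlt | heq | hlt
    · exact absurd (by rw [he]; exact fun _ _ => rfl) (h.distinct t' ht' t hlt)
    · exact heq
    · exact absurd (by rw [he]; exact fun _ _ => rfl) (h.distinct t ht t' hlt)
  simpa using Finset.card_le_card_of_injOn (s := Finset.range k) (t := Finset.range i) ρ
    (fun t ht => by simpa using h.repr_lt t (by simpa using ht)) hinj

theorem runs_classify_step {c n : ℕ} (I : ℕ → ℕ) (N : ℕ → ℝ) (hI : ConstRegs c n I)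
    {i k : ℕ} {ρ τ : ℕ → ℕ} (h : Classified c n N i k ρ τ I) (hi : i < n)
    (h4 : I 4 = 18 + 4 * c * i) (h10 : I 10 = 2 * (n + 1) ^ k) :
    Runs (.seq (findType c) (.seq (.ite (.ltIdx (.dir 14) (.dir 11)) .skip addType)
          (block [.addIdx (.dir 15) (.dir 15) (.ind 14), .addIdx (.dir 4) (.dir 4) (.dir 3),
            .addIdx (.dir 4) (.dir 4) (.dir 3), .subIdx (.dir 6) (.dir 6) (.dir 1)])))
      ⟨I, N⟩ (n * (18 * c + 17) + 22) fun m => m.num = N ∧ ConstRegs c n m.idx ∧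
        m.idx 4 = 18 + 4 * c * (i + 1) ∧ m.idx 6 = I 6 - 1 ∧
        ∃ k ρ τ, m.idx 10 = 2 * (n + 1) ^ k ∧ Classified c n N (i + 1) k ρ τ m.idx := by
  have hkn : k ≤ n := h.le.trans hi.le
  have hT : k * (18 * c + 13) ≤ n * (18 * c + 13) := Nat.mul_le_mul_right _ hkn
  refine (Runs.seq (U := (n * 4 + 13) + 5) ((runs_findType I N hI h.h11 h.repr h4).mono le_rfl
    fun m hm => ?_)).mono (by
      have : n * (18 * c + 17) = n * (18 * c + 13) + n * 4 := by ring
      omega) fun _ h => h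
  obtain ⟨I', N'⟩ := m
  obtain ⟨rfl, g, p, g14, hp⟩ := hm
  simp only at g g14
  have g' : ∀ a, a < 5 ∨ a = 6 ∨ a = 7 ∨ a = 10 ∨ a = 11 ∨ 15 ≤ a → I' a = I a := fun a ha =>
      g a (by omega) (by omega) (by omega) (by omega) (by omega) (by omega)
  have hI' : ConstRegs c n I' := hI.congr fun a ha => g' a (by omega)
  -- In both branches index cell `14` ends up pointing to the weight of the variable's type, since a
  -- new type is placed where a failed search points. Adding that weight to cell `15` builds up the
  -- address of the full instance in the table.
  refine (Runs.seq (U := 5) (Runs.ite (T := n * 4 + 12) (fun hb => Runs.skip ?_ (by omega))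
    fun hb => ?_)).mono le_rfl fun _ h => h
  · simp [g14, g' 11, h.h11] at hb
    obtain ⟨hpk, hE⟩ : p < k ∧ EqCells c N' (18 + 4 * c * i) (18 + 4 * c * ρ p) := by
      rcases hp with hp | hp
      · exact hp
      · omega
    refine Runs.block ?_ le_rfl
    have hu : ∀ a, a ≠ 4 → a ≠ 6 → a ≠ 15 → ∀ x y z w : ℕ, Function.update (Function.update
        (Function.update (Function.update I' 15 x) 4 y) 4 z) 6 w a = I' a := by
      intro a b1 b2 b3 x y z w
      simp [b1, b2, b3]
    simp (disch := omega) only [List.foldl, Instr.apply, Mem.setIdx, Mem.getIdx, Ref.addr,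
      Function.update_self, Function.update_of_ne, g14, g' 15, g' 4, g' 6, h.h15, h4, hI'.h3,
      hI'.h1, g' (17 + 3 * p), h.weight p hpk]
    refine ⟨trivial, hI'.congr fun a ha => hu a (by omega) (by omega) (by omega) _ _ _ _,
      by ring, trivial, k, ρ, Function.update τ i p, ?_, ?_⟩
    · rw [g' 10 (by omega), h10]
    have hτ : ∀ i' < i, Function.update τ i p i' = τ i' := fun i' hi' =>
      Function.update_of_ne (by omega) _ _
    have hs : ∑ i' ∈ Finset.range i, (n + 1) ^ Function.update τ i p i' =
        ∑ i' ∈ Finset.range i, (n + 1) ^ τ i' :=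
      Finset.sum_congr rfl fun i' hi' => by rw [hτ i' (Finset.mem_range.1 hi')]
    constructor
    · rw [hu 11 (by omega) (by omega) (by omega), g' 11 (by omega), h.h11]
    · rw [Function.update_of_ne (by omega), Function.update_of_ne (by omega),
        Function.update_of_ne (by omega), Function.update_self, Finset.sum_range_succ,
        Function.update_self, hs]
      ring
    · intro t ht
      rw [hu _ (by omega) (by omega) (by omega), g' _ (by omega), h.dig t ht]
    · intro t ht
      rw [hu _ (by omega) (by omega) (by omega), g' _ (by omega), h.weight t ht]
    · intro t ht
      rw [hu _ (by omega) (by omega) (by omega), g' _ (by omega), h.repr t ht]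
    · exact fun t ht => (h.repr_lt t ht).trans (Nat.lt_succ_self i)
    · intro i' hi'
      rcases Nat.lt_succ_iff_lt_or_eq.1 hi' with hlt | rfl
      · rw [hτ i' hlt]; exact h.type_lt i' hlt
      · rwa [Function.update_self]
    · intro i' hi'
      rcases Nat.lt_succ_iff_lt_or_eq.1 hi' with hlt | rfl
      · rw [hτ i' hlt]; exact h.eqCells i' hlt
      · rwa [Function.update_self]
    · exact h.distinct
  · simp [g14, g' 11, h.h11] at hb
    obtain ⟨rfl, hE⟩ : p = k ∧ ∀ t < k, ¬ EqCells c N' (18 + 4 * c * i) (18 + 4 * c * ρ t) := by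
      rcases hp with hp | hp
      · omega
      · exact hp
    refine (runs_addType I' N' hI' (k := p) (by rw [g' 11 (by omega), h.h11])
      (by rw [g' 10 (by omega), h10])).mono le_rfl ?_
    rintro ⟨I'', N''⟩ ⟨rfl, f, f10, f11, fd, fw, fr⟩
    simp only at f f10 f11 fd fw fr
    have f' : ∀ a, (a < 5 ∨ a = 6 ∨ a = 7 ∨ a = 14 ∨ a = 15 ∨ ∃ t < p, a = 16 + 3 * t ∨
        a = 17 + 3 * t ∨ a = 18 + 3 * t) → I'' a = I' a := by
      rintro a (ha | ha | ha | ha | ha | ⟨t, ht, ha | ha | ha⟩) <;>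
      exact f a (by omega) (by omega) (by omega) (by omega) (by omega) (by omega) (by omega)
    have hI'' : ConstRegs c n I'' := hI'.congr fun a ha => f' a (by omega)
    have f15 : I'' 15 = _ := (f' 15 (by omega)).trans ((g' 15 (by omega)).trans h.h15)
    have f4 : I'' 4 = _ := (f' 4 (by omega)).trans ((g' 4 (by omega)).trans h4)
    have f6 : I'' 6 = _ := (f' 6 (by omega)).trans (g' 6 (by omega))
    have f14 : I'' 14 = _ := (f' 14 (by omega)).trans g14
    refine Runs.block ?_ le_rfl
    have hu : ∀ a, a ≠ 4 → a ≠ 6 → a ≠ 15 → ∀ x y z w : ℕ, Function.update (Function.update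
        (Function.update (Function.update I'' 15 x) 4 y) 4 z) 6 w a = I'' a := by
      intro a b1 b2 b3 x y z w
      simp [b1, b2, b3]
    simp (disch := omega) only [List.foldl, Instr.apply, Mem.setIdx, Mem.getIdx, Ref.addr,
      Function.update_self, Function.update_of_ne, f14, f15, f4, f6, hI''.h3, hI''.h1, fw]
    refine ⟨trivial, hI''.congr fun a ha => hu a (by omega) (by omega) (by omega) _ _ _ _,
      by ring, trivial, p + 1, Function.update ρ p i, Function.update τ i p, ?_, ?_⟩
    · exact f10
    have hτ : ∀ i' < i, Function.update τ i p i' = τ i' := fun i' hi' =>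
      Function.update_of_ne (by omega) _ _
    have hs : ∑ i' ∈ Finset.range i, (n + 1) ^ Function.update τ i p i' =
        ∑ i' ∈ Finset.range i, (n + 1) ^ τ i' :=
      Finset.sum_congr rfl fun i' hi' => by rw [hτ i' (Finset.mem_range.1 hi')]
    have hρ : ∀ t < p, Function.update ρ p i t = ρ t := fun i' hi' =>
      Function.update_of_ne (by omega) _ _
    constructor
    · rw [hu 11 (by omega) (by omega) (by omega), f11]
    · rw [Function.update_of_ne (by omega), Function.update_of_ne (by omega),
        Function.update_of_ne (by omega), Function.update_self, Finset.sum_range_succ,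
        Function.update_self, hs]
      ring
    · intro t ht
      rw [hu _ (by omega) (by omega) (by omega)]
      rcases Nat.lt_succ_iff_lt_or_eq.1 ht with hlt | rfl
      · rw [f' _ (by right; right; right; right; right; exact ⟨t, hlt, by tauto⟩),
          g' _ (by omega), h.dig t hlt]
      · exact fd
    · intro t ht
      rw [hu _ (by omega) (by omega) (by omega)]
      rcases Nat.lt_succ_iff_lt_or_eq.1 ht with hlt | rfl
      · rw [f' _ (by right; right; right; right; right; exact ⟨t, hlt, by tauto⟩),
          g' _ (by omega), h.weight t hlt]
      · exact fw
    · intro t ht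
      rw [hu _ (by omega) (by omega) (by omega)]
      rcases Nat.lt_succ_iff_lt_or_eq.1 ht with hlt | rfl
      · rw [f' _ (by right; right; right; right; right; exact ⟨t, hlt, by tauto⟩),
          g' _ (by omega), h.repr t hlt, hρ t hlt]
      · rw [fr, Function.update_self, g' 4 (by omega), h4]
    · intro t ht
      rcases Nat.lt_succ_iff_lt_or_eq.1 ht with hlt | rfl
      · rw [hρ t hlt]; exact (h.repr_lt t hlt).trans (Nat.lt_succ_self i)
      · rw [Function.update_self]; exact Nat.lt_succ_self i
    · intro i' hi'
      rcases Nat.lt_succ_iff_lt_or_eq.1 hi' with hlt | rfl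
      · rw [hτ i' hlt]; exact (h.type_lt i' hlt).trans (Nat.lt_succ_self p)
      · rw [Function.update_self]; exact Nat.lt_succ_self p
    · intro i' hi'
      rcases Nat.lt_succ_iff_lt_or_eq.1 hi' with hlt | rfl
      · rw [hτ i' hlt, hρ _ (h.type_lt i' hlt)]; exact h.eqCells i' hlt
      · rw [Function.update_self, Function.update_self]; exact fun _ _ => rfl
    · intro t ht t' ht'
      rcases Nat.lt_succ_iff_lt_or_eq.1 ht with hlt | rfl
      · rw [hρ t hlt, hρ t' (by omega)]; exact h.distinct t hlt t' ht'
      · rw [Function.update_self, hρ t' ht']; exact hE t' ht'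

theorem runs_classify {c n : ℕ} (I : ℕ → ℕ) (N : ℕ → ℝ) (hI : ConstRegs c n I) :
    Runs (classify c) ⟨I, N⟩ (n * (n * (18 * c + 17) + 23) + 10) fun m => m.num = N ∧
      ConstRegs c n m.idx ∧ ∃ k ρ τ, m.idx (16 + 3 * k) = 0 ∧
        Classified c n N n k ρ τ m.idx := by
  refine (Runs.seq (U := (n * ((n * (18 * c + 17) + 22) + 1) + 1) + 3)
    (Runs.block (T := 6) ?_ le_rfl)).mono (by ring_nf; omega) fun _ h => h
  refine (Runs.seq (U := 3) (Runs.loop (T := n * (18 * c + 17) + 22) (fun j m => j ≤ n ∧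
    m.num = N ∧ ConstRegs c n m.idx ∧ m.idx 4 = 18 + 4 * c * (n - j) ∧ m.idx 6 = j ∧
    ∃ k ρ τ, m.idx 10 = 2 * (n + 1) ^ k ∧ Classified c n N (n - j) k ρ τ m.idx) (j := n)
    ?_ ?_)).mono le_rfl fun _ h => h
  · rintro j ⟨I', N'⟩ ⟨hj, rfl, hI', g4, g6, k, ρ, τ, g10, hC⟩
    simp only at hI' g4 g6 g10 hC
    rcases Nat.eq_zero_or_pos j with rfl | hpos
    · left
      refine ⟨by simp [hI'.h7, g6], Runs.block ?_ le_rfl⟩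
      have e : 17 + 3 * k - 1 = 16 + 3 * k := by omega
      have hu : ∀ a, a ≠ 12 → a ≠ 16 + 3 * k → ∀ x y : ℕ, Function.update
          (Function.update I' 12 x) (16 + 3 * k) y a = I' a := by
        intro a b1 b2 x y
        simp [b1, b2]
      simp only [List.foldl, Instr.apply, Mem.setIdx, Mem.getIdx, Ref.addr,
        Function.update_self, hC.h11, hI'.h1, e]
      refine ⟨trivial, hI'.congr fun a ha => hu a (by omega) (by omega) _ _, k, ρ, τ,
        Function.update_self _ _ _, ?_⟩
      constructor
      · rw [hu _ (by omega) (by omega), hC.h11]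
      · rw [hu _ (by omega) (by omega), hC.h15, Nat.sub_zero]
      · intro t ht
        rw [hu _ (by omega) (by omega), hC.dig t ht]
      · intro t ht
        rw [hu _ (by omega) (by omega), hC.weight t ht]
      · intro t ht
        rw [hu _ (by omega) (by omega), hC.repr t ht]
      · exact hC.repr_lt
      · exact hC.type_lt
      · exact hC.eqCells
      · exact hC.distinct
    · right
      obtain ⟨j, rfl⟩ : ∃ j', j = j' + 1 := ⟨j - 1, by omega⟩
      refine ⟨by simp [hI'.h7, g6], j, rfl, ?_⟩
      have hnj : n - j = n - (j + 1) + 1 := by omega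
      refine (runs_classify_step I' N' hI' hC (by omega) g4 g10).mono le_rfl ?_
      rintro ⟨I'', N''⟩ ⟨rfl, f1, f2, f3, f4⟩
      refine ⟨by omega, rfl, f1, by rw [hnj]; exact f2, by rw [f3, g6]; rfl, ?_⟩
      rw [hnj]
      exact f4
  · have hu : ∀ a, (a < 4 ∨ a = 7) → ∀ x y z w v : ℕ, Function.update (Function.update
        (Function.update (Function.update (Function.update I 4 x) 6 y) 10 z) 11 w) 15 v a = I a := by
      intro a ha x y z w v
      simp (disch := omega) [Function.update_of_ne]
    simp (disch := omega) only [List.foldl, Instr.apply, Mem.setIdx, Mem.getIdx, Ref.addr,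
      Function.update_self, Function.update_of_ne, hI.h0]
    refine ⟨le_rfl, trivial, hI.congr fun a ha => hu a (by omega) _ _ _ _ _, by simp, trivial, 0,
      id, id, by simp, ?_⟩
    constructor
    · simp
    · simp
    all_goals intro t ht; omega

end ProphetSecretary

namespace ProphetSecretary

/-! ### Preparing and rounding the input on the machine -/

attribute [local simp] Instr.apply Mem.setIdx Mem.setNum Mem.getIdx Mem.getNum Ref.addr Test.Holds

open Instr Ref in
/-- The input is moved so that cell `a` becomes cell `16 + 2 * a`. -/
def prepare (c : ℕ) : Prog :=
  .seq (block [constIdx (dir 1) 1, constIdx (dir 2) 2, constIdx (dir 3) (2 * c),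
      constIdx (dir 7) 0, constIdx (dir 4) 1])
    (.seq (repeated (block [addIdx (dir 4) (dir 4) (dir 0)]) (2 * c))
      (.seq (block [constIdx (dir 5) 16, addIdx (dir 5) (dir 5) (dir 4),
          addIdx (dir 5) (dir 5) (dir 4)])
        (.seq (.loop (.ltIdx (dir 7) (dir 4))
          (block [subIdx (dir 4) (dir 4) (dir 1), subIdx (dir 5) (dir 5) (dir 2),
            copyNum (ind 5) (ind 4)]))
          (block [constNum (dir 9) 0, constNum (dir 1) 0]))))

theorem runs_prepare {c n : ℕ} (I : ℕ → ℕ) (N : ℕ → ℝ) (h0 : I 0 = n) :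
    Runs (prepare c) ⟨I, N⟩ (10 * c * n + 4 * c + 30) fun m => ConstRegs c n m.idx ∧
      m.num 9 = 0 ∧ m.num 1 = 0 ∧ ∀ a ≤ 2 * c * n, m.num (16 + 2 * a) = N a := by
  refine (Runs.seq (U := (2 * c * 2 + 1) + (4 + (((2 * c * n + 1) * (4 + 1) + 1) + 3)))
    (Runs.block (T := 6) ?_ le_rfl)).mono (by ring_nf; omega) fun _ h => h
  refine (Runs.seq (U := 4 + (((2 * c * n + 1) * (4 + 1) + 1) + 3)) ((Runs.repeated (T := 2)
    (fun j m => ConstRegs c n m.idx ∧ m.idx 4 = 1 + j * n ∧ m.num = N) ?_ ?_).mono le_rfl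
    fun m hm => ?_)).mono le_rfl fun _ h => h
  · rintro j ⟨I', N'⟩ _ ⟨hI, h4, rfl⟩
    refine Runs.block ⟨hI.congr fun a ha => ?_, ?_, rfl⟩ le_rfl
    · simp (disch := omega) [Function.update_of_ne]
    · have e0 : I' 0 = n := hI.h0
      simp only at h4
      simp [h4, e0]
      ring
  · refine ⟨⟨?_, ?_, ?_, ?_, ?_⟩, ?_, ?_⟩ <;> simp [h0]
  · obtain ⟨I', N'⟩ := m
    obtain ⟨hI, h4, rfl⟩ := hm
    simp only at h4 hI
    refine (Runs.seq (U := ((2 * c * n + 1) * (4 + 1) + 1) + 3)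
      (Runs.block (T := 4) ?_ le_rfl)).mono le_rfl fun _ h => h
    -- The cells are moved from the top down. The target `16 + 2 * j` lies above all cells still to
    -- be moved, so no source is overwritten.
    refine (Runs.seq (U := 3) (Runs.loop (T := 4) (fun j m => ConstRegs c n m.idx ∧ m.idx 4 = j ∧
      m.idx 5 = 16 + 2 * j ∧ (∀ a < j, m.num a = N' a) ∧
      ∀ a ≤ 2 * c * n, j ≤ a → m.num (16 + 2 * a) = N' a) (j := 2 * c * n + 1) ?_ ?_)).mono le_rfl
      fun _ h => h
    · rintro j ⟨I'', N''⟩ ⟨hI'', g4, g5, g1, g2⟩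
      simp only at hI'' g4 g5 g1 g2
      rcases Nat.eq_zero_or_pos j with rfl | hpos
      · left
        refine ⟨by simp [hI''.h7, g4], Runs.block ?_ le_rfl⟩
        simp (disch := omega) [Function.update_of_ne]
        exact ⟨hI'', fun a ha => g2 a ha (Nat.zero_le _)⟩
      · right
        obtain ⟨j, rfl⟩ : ∃ j', j = j' + 1 := ⟨j - 1, by omega⟩
        refine ⟨by simp [hI''.h7, g4], j, rfl, Runs.block ?_ le_rfl⟩
        have e : 16 + 2 * (j + 1) - 2 = 16 + 2 * j := by omega
        simp (disch := omega) [g4, g5, hI''.h1, hI''.h2, e]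
        refine ⟨hI''.congr fun a ha => by simp (disch := omega) [Function.update_of_ne],
          fun a ha => ?_, fun a ha hja => ?_⟩
        · rw [Function.update_of_ne (by omega)]
          exact g1 a (by omega)
        · by_cases haj : a = j
          · subst haj
            rw [Function.update_self]
            exact g1 a (by omega)
          · rw [Function.update_of_ne (by omega)]
            exact g2 a ha (by omega)
    · refine ⟨hI.congr fun a ha => ?_, ?_, ?_, fun a _ => rfl, fun a ha hja => by omega⟩
      · simp (disch := omega) [Function.update_of_ne]
      · simp [h4]; ring
      · simp [h4]; ring

open Instr Ref in
/-- Run `body` for all pairs of a value and a probability, with their addresses in the index cells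
`4` and `5`. -/
def forPairs (c : ℕ) (body : Prog) : Prog :=
  .seq (block [constIdx (dir 4) 18, addIdx (dir 5) (dir 4) (dir 3), copyIdx (dir 6) (dir 0)])
    (.loop (.ltIdx (dir 7) (dir 6))
      (.seq (repeated (.seq body (block [addIdx (dir 4) (dir 4) (dir 2),
          addIdx (dir 5) (dir 5) (dir 2)])) c)
        (block [addIdx (dir 4) (dir 4) (dir 3), addIdx (dir 5) (dir 5) (dir 3),
          subIdx (dir 6) (dir 6) (dir 1)])))

/-- A proof rule for the double loop: `J i j` describes the number cells once all pairs before pair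
`j` of variable `i` have been treated. -/
theorem runs_forPairs {c n T : ℕ} {body : Prog} (I : ℕ → ℕ) (N : ℕ → ℝ) (hI : ConstRegs c n I)
    (J : ℕ → ℕ → (ℕ → ℝ) → Prop)
    (hbody : ∀ i < n, ∀ j < c, ∀ (I : ℕ → ℕ) (N : ℕ → ℝ), I 4 = 18 + 4 * c * i + 2 * j →
      I 5 = 18 + 4 * c * i + 2 * c + 2 * j → J i j N →
      Runs body ⟨I, N⟩ T fun m => m.idx = I ∧ J i (j + 1) m.num)
    (hnext : ∀ i N, J i c N → J (i + 1) 0 N) (hJ : J 0 0 N) :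
    Runs (forPairs c body) ⟨I, N⟩ (n * (c * (T + 3) + 6) + 5) fun m =>
      ConstRegs c n m.idx ∧ J n 0 m.num := by
  refine (Runs.seq (U := n * ((c * (T + 3) + 1 + 4) + 1) + 1)
    (Runs.block (T := 4) ?_ le_rfl)).mono (by ring_nf; omega) fun _ h => h
  refine Runs.loop (fun i m => i ≤ n ∧ ConstRegs c n m.idx ∧ J (n - i) 0 m.num ∧
    m.idx 4 = 18 + 4 * c * (n - i) ∧ m.idx 5 = 18 + 4 * c * (n - i) + 2 * c ∧ m.idx 6 = i) ?_ ?_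
  · rintro i ⟨I', N'⟩ ⟨hi, hI', hJ', h4, h5, h6⟩
    simp only at hI' hJ' h4 h5 h6
    rcases Nat.eq_zero_or_pos i with rfl | hpos
    · left
      exact ⟨by simp [hI'.h7, h6], hI', by simpa using hJ'⟩
    right
    obtain ⟨i, rfl⟩ : ∃ i', i = i' + 1 := ⟨i - 1, by omega⟩
    refine ⟨by simp [hI'.h7, h6], i, rfl, ?_⟩
    set x := n - (i + 1) with hx
    have hxi : n - i = x + 1 := by omega
    refine (Runs.seq (U := 4) ((Runs.repeated (T := T + 3) (fun j m => ConstRegs c n m.idx ∧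
      J x j m.num ∧ m.idx 4 = 18 + 4 * c * x + 2 * j ∧ m.idx 5 = 18 + 4 * c * x + 2 * c + 2 * j ∧
      m.idx 6 = i + 1) ?_ ⟨hI', hJ', h4, h5, h6⟩).mono le_rfl fun m hm => ?_)).mono le_rfl
      fun _ h => h
    · rintro j ⟨I'', N''⟩ hj ⟨hI'', hJ'', g4, g5, g6⟩
      refine Runs.seq ((hbody x (by omega) j hj I'' N'' g4 g5 hJ'').mono le_rfl ?_)
      rintro ⟨I3, N3⟩ ⟨rfl, hJ3⟩
      simp only at g4 g5 g6 hJ3 hI''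
      refine Runs.block ⟨hI''.congr fun a ha => ?_, hJ3, ?_, ?_, ?_⟩ le_rfl
      · simp (disch := omega) [Function.update_of_ne]
      · simp [g4, hI''.h2]; ring
      · simp [g5, hI''.h2]; ring
      · simp [g6]
    · obtain ⟨I'', N''⟩ := m
      obtain ⟨hI'', hJ'', g4, g5, g6⟩ := hm
      simp only at g4 g5 g6 hJ'' hI''
      refine Runs.block ⟨by omega, hI''.congr fun a ha => ?_, ?_, ?_, ?_, ?_⟩ le_rfl
      · simp (disch := omega) [Function.update_of_ne]
      · rw [hxi]
        exact hnext x _ hJ''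
      · simp [g4, hI''.h3, hxi]; ring
      · simp [g5, hI''.h3, hxi]; ring
      · simp [g6, hI''.h1]
  · refine ⟨le_rfl, hI.congr fun a ha => ?_, by simpa using hJ, ?_, ?_, ?_⟩
    · simp (disch := omega) [Function.update_of_ne]
    · simp
    · simp [hI.h3]
    · simp [hI.h0]

open Instr Ref in
/-- Update of the maximum of the products of a value and its probability. -/
def maxBody : Prog :=
  .seq (block [mulNum (dir 6) (ind 4) (ind 5)])
    (.ite (.ltNum (dir 1) (dir 6)) (block [copyNum (dir 1) (dir 6)]) .skip)

theorem runs_maxPass {c n : ℕ} (I : ℕ → ℕ) (N : ℕ → ℝ) (hI : ConstRegs c n I) (h1 : N 1 = 0) :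
    Runs (forPairs c maxBody) ⟨I, N⟩ (n * (c * 8 + 6) + 5) fun m =>
      ConstRegs c n m.idx ∧ (∀ a, 7 ≤ a → m.num a = N a) ∧ 0 ≤ m.num 1 ∧
      (∀ i < n, ∀ j < c,
        N (18 + 4 * c * i + 2 * j) * N (18 + 4 * c * i + 2 * c + 2 * j) ≤ m.num 1) ∧
      (m.num 1 = 0 ∨ ∃ i < n, ∃ j < c,
        m.num 1 = N (18 + 4 * c * i + 2 * j) * N (18 + 4 * c * i + 2 * c + 2 * j)) := by
  refine (runs_forPairs (T := 5) I N hI (fun i j N' =>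
    (∀ a, 7 ≤ a → N' a = N a) ∧ 0 ≤ N' 1 ∧
      (∀ i' < n, ∀ j' < c, (i' < i ∨ (i' = i ∧ j' < j)) →
        N (18 + 4 * c * i' + 2 * j') * N (18 + 4 * c * i' + 2 * c + 2 * j') ≤ N' 1) ∧
      (N' 1 = 0 ∨ ∃ i < n, ∃ j < c,
        N' 1 = N (18 + 4 * c * i + 2 * j) * N (18 + 4 * c * i + 2 * c + 2 * j))) ?_ ?_ ?_).mono
    le_rfl ?_
  · rintro i hi j hj I' N' h4 h5 ⟨g1, g2, g3, g4⟩
    refine (Runs.seq (U := 3) (Runs.block (T := 2) ?_ le_rfl)).mono le_rfl fun _ h => h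
    have e1 := g1 (18 + 4 * c * i + 2 * j) (by omega)
    have e2 := g1 (18 + 4 * c * i + 2 * c + 2 * j) (by omega)
    have hcase : ∀ i' j', (i' < i ∨ (i' = i ∧ j' < j + 1)) →
        (i' < i ∨ (i' = i ∧ j' < j)) ∨ (i' = i ∧ j' = j) := by
      intro i' j' h
      omega
    refine Runs.ite (T := 2) (fun hb => Runs.block ?_ le_rfl) fun hb => Runs.skip ?_ (by omega)
    · simp [h4, h5, e1, e2] at hb ⊢
      refine ⟨fun a ha => ?_, by linarith, fun i' hi' j' hj' h => ?_, Or.inr ⟨i, hi, j, hj, rfl⟩⟩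
      · rw [Function.update_of_ne (by omega), Function.update_of_ne (by omega), g1 a ha]
      · rcases hcase i' j' (by omega) with h | ⟨rfl, rfl⟩
        · exact (g3 i' hi' j' hj' h).trans hb.le
        · exact le_rfl
    · simp [h4, h5, e1, e2] at hb ⊢
      refine ⟨fun a ha => ?_, g2, fun i' hi' j' hj' h => ?_, g4⟩
      · rw [Function.update_of_ne (by omega), g1 a ha]
      · rcases hcase i' j' (by omega) with h | ⟨rfl, rfl⟩
        · exact g3 i' hi' j' hj' h
        · exact hb
  · rintro i N' ⟨g1, g2, g3, g4⟩
    exact ⟨g1, g2, fun i' hi' j' hj' h => g3 i' hi' j' hj' (by omega), g4⟩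
  · exact ⟨fun _ _ => rfl, h1.ge, fun i' hi' j' hj' h => by omega, Or.inl h1⟩
  · rintro m ⟨g0, g1, g2, g3, g4⟩
    exact ⟨g0, g1, g2, fun i hi j hj => g3 i hi j hj (Or.inl hi), g4⟩

open Instr Ref in
/-- Rounding down to a geometric grid. -/
def roundLoop (x : Ref) : Prog := .loop (.ltNum x (dir 6)) (block [divNum (dir 6) (dir 6) (dir 2)])

theorem runs_roundLoop (I : ℕ → ℕ) (N : ℕ → ℝ) {k K : ℕ} {x r top : ℝ} (hk : 16 ≤ I k)
    (hx : N (I k) = x) (h2 : N 2 = r) (h6 : N 6 = top) (hr : 1 < r) (hxt : x ≤ top)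
    (h0 : 0 ≤ top) (hK : top ≤ x * r ^ K) :
    Runs (roundLoop (.ind k)) ⟨I, N⟩ (K * 3 + 1) fun m => m.idx = I ∧
      (∀ a, a ≠ 6 → m.num a = N a) ∧ (∃ i : ℕ, m.num 6 = top / r ^ i) ∧ m.num 6 ≤ x ∧
      x ≤ m.num 6 * r := by
  have hr0 : 0 < r := by linarith
  -- After `i` divisions the candidate is `top / r ^ i`, still at least `x / r`. By `hK` the level
  -- `K` is already at most `x`, so `K` rounds suffice.
  refine Runs.loop (T := 2) (fun j m => ∃ i, i + j = K ∧ m.idx = I ∧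
    (∀ a, a ≠ 6 → m.num a = N a) ∧ m.num 6 = top / r ^ i ∧ x ≤ m.num 6 * r) ?_ ?_
  · rintro j ⟨I', N'⟩ ⟨i, hij, rfl, g, g6, gx⟩
    simp only at g g6 gx
    have ex := g (I' k) (by have hk : 16 ≤ I' k := hk; omega)
    have e2 := g 2 (by omega)
    rw [hx] at ex
    rw [h2] at e2
    by_cases hle : N' 6 ≤ x
    · left
      exact ⟨by simpa [ex] using hle, rfl, g, ⟨i, g6⟩, hle, gx⟩
    · right
      refine ⟨by simpa [ex] using hle, j - 1, ?_, Runs.block ⟨i + 1, ?_, rfl, fun a ha => ?_, ?_, ?_⟩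
        le_rfl⟩
      · rcases Nat.eq_zero_or_pos j with rfl | h
        · exfalso
          apply hle
          rw [g6, div_le_iff₀ (by positivity)]
          rwa [← hij] at hK
        · omega
      · rcases Nat.eq_zero_or_pos j with rfl | h
        · exfalso
          apply hle
          rw [g6, div_le_iff₀ (by positivity)]
          rwa [← hij] at hK
        · omega
      · simp [ha, g a ha]
      · simp [e2, g6, pow_succ, div_div]
      · simp [e2]
        rw [div_mul_cancel₀ _ hr0.ne']
        linarith
  · refine ⟨0, by omega, rfl, fun _ _ => rfl, by simp [h6], ?_⟩
    simp only [h6]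
    nlinarith

open Instr Ref in
/-- Rounding of a pair of a value and its probability. -/
def roundBody : Prog :=
  .ite (.ltNum (ind 4) (dir 3)) (block [constNum (ind 4) 0, constNum (ind 5) 0])
    (.seq (.ite (.ltNum (dir 4) (ind 4))
        (block [mulNum (ind 5) (ind 5) (ind 4), divNum (ind 5) (ind 5) (dir 4),
          copyNum (ind 4) (dir 4)]) .skip)
      (.seq (block [copyNum (dir 6) (dir 4)])
        (.seq (roundLoop (ind 4))
          (.seq (block [copyNum (ind 4) (dir 6)])
            (.ite (.ltNum (ind 5) (dir 5)) (block [constNum (ind 5) 0])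
              (.seq (block [constNum (dir 6) 1])
                (.seq (roundLoop (ind 5)) (block [divNum (ind 5) (dir 6) (dir 2)]))))))))

theorem runs_roundBody (I : ℕ → ℕ) (N : ℕ → ℝ) {a b K : ℕ} {v p r lo hi q : ℝ} (h4 : I 4 = a)
    (h5 : I 5 = b) (ha : 16 ≤ a) (hb : 16 ≤ b) (hab : a ≠ b) (hv : N a = v) (hp : N b = p)
    (h2 : N 2 = r) (h3 : N 3 = lo) (h4' : N 4 = hi) (h5' : N 5 = q) (hr : 1 < r) (hlo : 0 < lo)
    (hlohi : lo ≤ hi) (hp1 : p ≤ 1) (hpv : p * v ≤ hi)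
    (hK : hi ≤ lo * r ^ K) (hKq : 1 ≤ q * r ^ K) :
    Runs roundBody ⟨I, N⟩ (6 * K + 20) fun m => m.idx = I ∧
      (∀ x, x ≠ 6 → x ≠ a → x ≠ b → m.num x = N x) ∧
      RoundedPair r lo hi q v p (m.num a) (m.num b) := by
  have hr0 : 0 < r := by linarith
  have hhi : 0 < hi := by linarith
  refine (Runs.ite (T := 6 * K + 19) (fun hb' => ?_) fun hb' => ?_)
  · simp [h4, hv, h3] at hb'
    refine Runs.block ?_ (by simp)
    simp (disch := omega) [h4, h5]
    refine ⟨fun x b1 b2 b3 => by simp [b2, b3], Or.inl ⟨hb', ?_, ?_⟩⟩ <;>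
      simp (disch := omega) [Function.update_of_ne]
  simp [h4, hv, h3] at hb'
  have hrest : ∀ N' : ℕ → ℝ, (∀ x, x ≠ a → x ≠ b → N' x = N x) → N' a = min v hi →
      N' b = p * (max v hi / hi) → Runs (.seq (block [.copyNum (.dir 6) (.dir 4)])
        (.seq (roundLoop (.ind 4))
          (.seq (block [.copyNum (.ind 4) (.dir 6)])
            (.ite (.ltNum (.ind 5) (.dir 5)) (block [.constNum (.ind 5) 0])
              (.seq (block [.constNum (.dir 6) 1])
                (.seq (roundLoop (.ind 5)) (block [.divNum (.ind 5) (.dir 6) (.dir 2)])))))))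
      ⟨I, N'⟩ (6 * K + 13) fun m => m.idx = I ∧
      (∀ x, x ≠ 6 → x ≠ a → x ≠ b → m.num x = N x) ∧
      RoundedPair r lo hi q v p (m.num a) (m.num b) := by
    -- The common continuation of both outcomes of the capping test: in either case the cells hold
    -- `min v hi` and `p * (max v hi / hi)`.
    intro N' g ga gb
    have e2 : N' 2 = r := by rw [g 2 (by omega) (by omega), h2]
    have e4 : N' 4 = hi := by rw [g 4 (by omega) (by omega), h4']
    have e5 : N' 5 = q := by rw [g 5 (by omega) (by omega), h5']
    refine (Runs.seq (U := (K * 3 + 1) + (2 + (3 * K + 7))) (Runs.block (T := 2) ?_ le_rfl)).mono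
      (by omega) fun _ h => h
    simp only [List.foldl, Instr.apply, Mem.setNum, Mem.getNum, Ref.addr, e4]
    refine (Runs.seq (U := 2 + (3 * K + 7)) ((runs_roundLoop (k := 4) (K := K) (x := min v hi)
      (r := r) (top := hi) I _ (by omega) ?_ ?_ ?_ hr (min_le_right _ _) hhi.le ?_).mono le_rfl
      ?_)).mono le_rfl fun _ h => h
    · rw [h4, Function.update_of_ne (by omega), ga]
    · rw [Function.update_of_ne (by omega), e2]
    · simp
    · refine hK.trans ?_
      have := le_min hb' hlohi
      gcongr
    · rintro ⟨I', N1⟩ ⟨hI', f1, ⟨i, f2⟩, f3, f4⟩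
      obtain rfl : I' = I := hI'
      simp only at f1 f2 f3 f4
      refine (Runs.seq (U := 3 * K + 7) (Runs.block (T := 2) ?_ le_rfl)).mono le_rfl fun _ h => h
      simp only [List.foldl, Instr.apply, Mem.setNum, Mem.getNum, Ref.addr, h4]
      set N2 := Function.update N1 a (N1 6) with hN2
      have k1 : ∀ x, x ≠ 6 → x ≠ a → N2 x = N' x := fun x b1 b2 => by
        rw [hN2, Function.update_of_ne b2, f1 x b1, Function.update_of_ne b1]
      have ka : N2 a = N1 6 := by rw [hN2, Function.update_self]
      have kb : N2 b = p * (max v hi / hi) := by rw [k1 b (by omega) (by omega), gb]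
      clear_value N2
      have k2 : N2 2 = r := by rw [k1 2 (by omega) (by omega), e2]
      have k5 : N2 5 = q := by rw [k1 5 (by omega) (by omega), e5]
      refine (Runs.ite (T := 3 * K + 6) (fun hc => ?_) fun hc => ?_)
      · simp [h5, kb, k5] at hc
        refine Runs.block ?_ (by simp)
        simp (disch := omega) [h5]
        refine ⟨fun x b1 b2 b3 => ?_, Or.inr ⟨hb', ⟨i, ?_⟩, ?_, ?_, Or.inl ⟨by simp, hc⟩⟩⟩
        · rw [Function.update_of_ne b3, k1 x b1 b2, g x b2 b3]
        all_goals simp (disch := omega) only [Function.update_of_ne, ka]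
        · exact f2
        · exact f3
        · exact f4
      · simp [h5, kb, k5] at hc
        refine (Runs.seq (U := (K * 3 + 1) + 2) (Runs.block (T := 2) ?_ le_rfl)).mono
          (by omega) fun _ h => h
        simp only [List.foldl, Instr.apply, Mem.setNum, Ref.addr]
        refine (Runs.seq (U := 2) ((runs_roundLoop (k := 5) (K := K) (x := p * (max v hi / hi))
          (r := r) (top := 1) I' _ (by omega) ?_ ?_ ?_ hr ?_ zero_le_one ?_).mono le_rfl
          ?_)).mono le_rfl fun _ h => h
        · rw [h5, Function.update_of_ne (by omega), kb]
        · rw [Function.update_of_ne (by omega), k2]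
        · simp
        -- The probability grid starts at one. A capped probability also lies below it, because `p *
        -- v ≤ hi`.
        · rcases le_total v hi with h | h
          · rw [max_eq_right h, div_self hhi.ne', mul_one]
            exact hp1
          · rw [max_eq_left h, ← mul_div_assoc, div_le_one hhi]
            exact hpv
        · refine hKq.trans ?_
          gcongr
        · rintro ⟨I3, N3⟩ ⟨hI3, l1, ⟨i', l2⟩, l3, l4⟩
          obtain rfl : I3 = I' := hI3
          simp only at l1 l2 l3 l4
          have l1' : ∀ x, x ≠ 6 → N3 x = N2 x := fun x b1 => by
            rw [l1 x b1, Function.update_of_ne b1]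
          refine Runs.block ?_ le_rfl
          simp only [List.foldl, Instr.apply, Mem.setNum, Mem.getNum, Ref.addr, h5,
            l1' 2 (by omega), k2]
          refine ⟨trivial, fun x b1 b2 b3 => ?_, Or.inr ⟨hb', ⟨i, ?_⟩, ?_, ?_,
            Or.inr ⟨⟨i', ?_⟩, hc, ?_, ?_⟩⟩⟩
          · rw [Function.update_of_ne b3, l1' x b1, k1 x b1 b2, g x b2 b3]
          · rw [Function.update_of_ne hab, l1' a (by omega), ka, f2]
          · rw [Function.update_of_ne hab, l1' a (by omega), ka]
            exact f3
          · rw [Function.update_of_ne hab, l1' a (by omega), ka]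
            exact f4
          · rw [Function.update_self, l2]
          · rw [Function.update_self, div_mul_cancel₀ _ hr0.ne']
            exact l3
          · rw [Function.update_self, div_mul_cancel₀ _ hr0.ne']
            exact l4
  refine (Runs.seq (U := 6 * K + 13) (Runs.ite (T := 4) (fun hc => Runs.block ?_ le_rfl)
    fun hc => Runs.skip ?_ (by omega))).mono (by omega) fun _ h => h
  · simp [h4, hv, h4'] at hc
    simp only [List.foldl, Instr.apply, Mem.setNum, Mem.getNum, Ref.addr, h4, h5]
    refine hrest _ (fun x b1 b2 => ?_) ?_ ?_
    · simp [b1, b2]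
    · simp (disch := omega) [Function.update_of_ne, h4', hc.le]
    · simp (disch := omega) [Function.update_of_ne, h4', hv, hp, hab, hab.symm]
      rw [max_eq_left hc.le, mul_div_assoc]
  · simp [h4, hv, h4'] at hc
    refine hrest N (fun x _ _ => rfl) ?_ ?_
    · rw [min_eq_left hc, hv]
    · rw [max_eq_right hc, div_self hhi.ne', mul_one, hp]

end ProphetSecretary

/-! ### Rounding all variables, and the complete program -/

namespace ProphetSecretary

attribute [local simp] Instr.apply Mem.setIdx Mem.setNum Mem.getIdx Mem.getNum Ref.addr Test.Holds

/-- Supplies the nonlinear fact that the cells of different variables do not overlap, after which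
`omega` can treat the products as atoms. -/
theorem block_separated {c i i' : ℕ} (h : i ≠ i') :
    4 * c * i + 4 * c ≤ 4 * c * i' ∨ 4 * c * i' + 4 * c ≤ 4 * c * i := by
  rcases lt_or_gt_of_ne h with h | h
  · left
    calc 4 * c * i + 4 * c = 4 * c * (i + 1) := by ring
      _ ≤ _ := Nat.mul_le_mul_left _ h
  · right
    calc 4 * c * i' + 4 * c = 4 * c * (i' + 1) := by ring
      _ ≤ _ := Nat.mul_le_mul_left _ h

theorem runs_roundPass {c n K : ℕ} (I : ℕ → ℕ) (N : ℕ → ℝ) (hI : ConstRegs c n I)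
    {r lo hi q : ℝ} (h2 : N 2 = r) (h3 : N 3 = lo) (h4 : N 4 = hi) (h5 : N 5 = q) (hr : 1 < r)
    (hlo : 0 < lo) (hlohi : lo ≤ hi) (hK : hi ≤ lo * r ^ K) (hKq : 1 ≤ q * r ^ K)
    (hp1 : ∀ i < n, ∀ j < c, N (18 + 4 * c * i + 2 * c + 2 * j) ≤ 1)
    (hpv : ∀ i < n, ∀ j < c,
      N (18 + 4 * c * i + 2 * c + 2 * j) * N (18 + 4 * c * i + 2 * j) ≤ hi) :
    Runs (forPairs c roundBody) ⟨I, N⟩ (n * (c * (6 * K + 23) + 6) + 5) fun m =>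
      ConstRegs c n m.idx ∧ m.num 9 = N 9 ∧ ∀ i < n, ∀ j < c,
        RoundedPair r lo hi q (N (18 + 4 * c * i + 2 * j)) (N (18 + 4 * c * i + 2 * c + 2 * j))
          (m.num (18 + 4 * c * i + 2 * j)) (m.num (18 + 4 * c * i + 2 * c + 2 * j)) := by
  refine (runs_forPairs (T := 6 * K + 20) I N hI (fun i j N' =>
    (∀ a < 16, a ≠ 6 → N' a = N a) ∧
    (∀ i' < n, ∀ j' < c, (i' < i ∨ (i' = i ∧ j' < j)) →
      RoundedPair r lo hi q (N (18 + 4 * c * i' + 2 * j')) (N (18 + 4 * c * i' + 2 * c + 2 * j'))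
        (N' (18 + 4 * c * i' + 2 * j')) (N' (18 + 4 * c * i' + 2 * c + 2 * j'))) ∧
    (∀ i' < n, ∀ j' < c, ¬ (i' < i ∨ (i' = i ∧ j' < j)) →
      N' (18 + 4 * c * i' + 2 * j') = N (18 + 4 * c * i' + 2 * j') ∧
      N' (18 + 4 * c * i' + 2 * c + 2 * j') = N (18 + 4 * c * i' + 2 * c + 2 * j')))
    ?_ ?_ ?_).mono le_rfl ?_
  · rintro i hi' j hj I' N' e4 e5 ⟨g1, g2, g3⟩
    obtain ⟨ev, ep⟩ := g3 i hi' j hj (by omega)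
    refine (runs_roundBody I' N' e4 e5 (by omega) (by omega) (by omega) ev ep
      ((g1 2 (by omega) (by omega)).trans h2) ((g1 3 (by omega) (by omega)).trans h3)
      ((g1 4 (by omega) (by omega)).trans h4) ((g1 5 (by omega) (by omega)).trans h5) hr hlo hlohi
      (hp1 i hi' j hj) (hpv i hi' j hj) hK hKq).mono le_rfl ?_
    rintro ⟨I'', N''⟩ ⟨hI'', f1, f2⟩
    simp only at hI'' f1 f2
    have hother : ∀ i' j', j' < c → ¬ (i' = i ∧ j' = j) →
        N'' (18 + 4 * c * i' + 2 * j') = N' (18 + 4 * c * i' + 2 * j') ∧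
        N'' (18 + 4 * c * i' + 2 * c + 2 * j') = N' (18 + 4 * c * i' + 2 * c + 2 * j') := by
      intro i' j' hj' hne
      by_cases hii : i' = i
      · subst hii
        have hjj : j' ≠ j := fun h => hne ⟨rfl, h⟩
        exact ⟨f1 _ (by omega) (by omega) (by omega), f1 _ (by omega) (by omega) (by omega)⟩
      · have hsep := block_separated (c := c) hii
        exact ⟨f1 _ (by omega) (by omega) (by omega), f1 _ (by omega) (by omega) (by omega)⟩
    refine ⟨hI'', fun a ha ha6 => (f1 a ha6 (by omega) (by omega)).trans (g1 a ha ha6),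
      fun i' hi'' j' hj' h => ?_, fun i' hi'' j' hj' h => ?_⟩
    · by_cases heq : i' = i ∧ j' = j
      · obtain ⟨rfl, rfl⟩ := heq
        exact f2
      · obtain ⟨o1, o2⟩ := hother i' j' hj' heq
        simp only
        rw [o1, o2]
        exact g2 i' hi'' j' hj' (by omega)
    · obtain ⟨o1, o2⟩ := hother i' j' hj' (by omega)
      simp only
      rw [o1, o2]
      exact g3 i' hi'' j' hj' (by omega)
  · rintro i N' ⟨g1, g2, g3⟩
    exact ⟨g1, fun i' hi' j' hj' h => g2 i' hi' j' hj' (by omega),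
      fun i' hi' j' hj' h => g3 i' hi' j' hj' (by omega)⟩
  · exact ⟨fun _ _ _ => rfl, fun i' hi' j' hj' h => by omega, fun _ _ _ _ _ => ⟨rfl, rfl⟩⟩
  · rintro m ⟨g0, g1, g2, g3⟩
    exact ⟨g0, g1 9 (by omega) (by omega), fun i hi j hj => g2 i hi j hj (Or.inl hi)⟩

open Instr Ref in
/-- The parameters of the rounding. -/
def setScale (c : ℕ) : List Instr :=
  [constNum (dir 10) (1 / 8), mulNum (dir 10) (dir 10) (dir 16), constNum (dir 2) 1,
    addNum (dir 2) (dir 2) (dir 10), mulNum (dir 3) (dir 10) (dir 1), castNum (dir 11) (dir 0),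
    constNum (dir 12) c, mulNum (dir 11) (dir 11) (dir 12), mulNum (dir 4) (dir 11) (dir 1),
    divNum (dir 4) (dir 4) (dir 10), divNum (dir 5) (dir 10) (dir 11),
    mulNum (dir 5) (dir 5) (dir 5)]

theorem setScale_spec (c : ℕ) (I : ℕ → ℕ) (N : ℕ → ℝ) {ε M : ℝ} {n : ℕ} (h0 : I 0 = n)
    (hε : N 16 = ε) (hM : N 1 = M) :
    ∃ N', (setScale c).foldl Instr.apply ⟨I, N⟩ = ⟨I, N'⟩ ∧ N' 9 = N 9 ∧
      (∀ a, 16 ≤ a → N' a = N a) ∧ N' 2 = 1 + ε / 8 ∧ N' 3 = ε / 8 * M ∧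
      N' 4 = n * c * M / (ε / 8) ∧ N' 5 = (ε / 8) ^ 2 / (n * c : ℝ) ^ 2 := by
  have he : (8 : ℝ)⁻¹ * ε = ε / 8 := by ring
  refine ⟨_, rfl, ?_, fun a ha => ?_, ?_, ?_, ?_, ?_⟩
  · simp [setScale]
  · simp (disch := omega) [setScale, Function.update_of_ne]
  · simp [setScale, hε, he]
  · simp [setScale, hε, hM, he]
  · simp [setScale, hε, hM, he, h0]
  · simp [setScale, hε, hM, he, h0]
    rw [← sq, div_pow]

/-- The approximation algorithm. -/
def approxProg (c : ℕ) : Prog :=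
  .seq (prepare c) (.seq (forPairs c maxBody)
    (.ite (.ltNum (.dir 9) (.dir 1))
      (.seq (block (setScale c)) (.seq (forPairs c roundBody) (.seq (classify c) (dynProg c))))
      (block [.constNum (.dir 0) 0])))

/-! ### The layout of the input -/

theorem getD_flatMap {α : Type*} (f : α → List ℝ) (L : ℕ) (hf : ∀ x, (f x).length = L) (l : List α)
    (i : ℕ) (hi : i < l.length) (j : ℕ) (hj : j < L) :
    (l.flatMap f).getD (L * i + j) 0 = (f l[i]).getD j 0 := by
  induction l generalizing i with
  | nil => simp at hi
  | cons x l ih =>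
    rw [List.flatMap_cons]
    rcases i with _ | i
    · rw [List.getD_append _ _ _ _ (by rw [hf]; omega)]
      simp
    · rw [List.getD_append_right _ _ _ _ (by rw [hf, mul_add]; omega), hf,
        show L * (i + 1) + j - L = L * i + j by rw [mul_add]; omega, ih i (by simpa using hi)]
      simp

theorem inputMem_num_zero {c : ℕ} (ε : ℝ) (l : List (DiscreteVar c)) : (inputMem ε l).num 0 = ε := by
  simp [inputMem]

theorem inputMem_val {c : ℕ} (ε : ℝ) (l : List (DiscreteVar c)) (i : Fin l.length) (j : Fin c) :
    (inputMem ε l).num (1 + 2 * c * i + j) = l[i].val j := by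
  have := getD_flatMap (fun X : DiscreteVar c => List.ofFn X.val ++ List.ofFn X.prob) (2 * c)
    (fun X => by simp; ring) l i i.isLt j (by omega)
  simp only [inputMem]
  rw [show 1 + 2 * c * (i : ℕ) + j = (2 * c * i + j) + 1 by ring, List.getD_cons_succ, this,
    List.getD_append _ _ _ _ (by simp)]
  simp

theorem inputMem_prob {c : ℕ} (ε : ℝ) (l : List (DiscreteVar c)) (i : Fin l.length) (j : Fin c) :
    (inputMem ε l).num (1 + 2 * c * i + c + j) = l[i].prob j := by
  have := getD_flatMap (fun X : DiscreteVar c => List.ofFn X.val ++ List.ofFn X.prob) (2 * c)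
    (fun X => by simp; ring) l i i.isLt (c + j) (by omega)
  simp only [inputMem]
  rw [show 1 + 2 * c * (i : ℕ) + c + j = (2 * c * i + (c + j)) + 1 by ring, List.getD_cons_succ,
    this, List.getD_append_right _ _ _ _ (by simp)]
  simp

end ProphetSecretary

namespace ProphetSecretary

/-! ### Correctness and running time of the algorithm -/

theorem cellMix_eq_mixMax (c : ℕ) (N : ℕ → ℝ) (A : ℕ) :
    cellMix c N A = mixMax (fun j : Fin c => N (A + 2 * j)) fun j => N (A + 2 * c + 2 * j) := by
  funext T
  rw [cellMix, mixMax, Finset.sum_range fun j => N (A + 2 * c + 2 * j) * max (N (A + 2 * j) - T) 0]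

theorem eqCells_of_eq {c : ℕ} {N : ℕ → ℝ} {A A' : ℕ}
    (h : (fun j : Fin c => (N (A + 2 * j), N (A + 2 * c + 2 * j))) =
      fun j : Fin c => (N (A' + 2 * j), N (A' + 2 * c + 2 * j))) : EqCells c N A A' := by
  intro j hj
  rcases lt_or_ge j c with hjc | hjc
  · exact (Prod.ext_iff.1 (congrFun h ⟨j, hjc⟩)).1
  · have := (Prod.ext_iff.1 (congrFun h ⟨j - c, by omega⟩)).2
    simp only at this
    rwa [show A + 2 * c + 2 * (j - c) = A + 2 * j by omega,
      show A' + 2 * c + 2 * (j - c) = A' + 2 * j by omega] at this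

theorem EqCells.cellMix_eq {c : ℕ} {N : ℕ → ℝ} {A A' : ℕ} (h : EqCells c N A A') :
    cellMix c N A = cellMix c N A' := by
  funext T
  rw [cellMix, cellMix]
  congr 1
  refine Finset.sum_congr rfl fun j hj => ?_
  have hj := Finset.mem_range.1 hj
  rw [h j (by omega), show A + 2 * c + 2 * j = A + 2 * (c + j) by ring, h _ (by omega),
    show A' + 2 * c + 2 * j = A' + 2 * (c + j) by ring]

/-- The evaluation of the dynamic program on classified variables. -/
theorem runs_classify_dynProg {c n B : ℕ} (I : ℕ → ℕ) (N : ℕ → ℝ) (hI : ConstRegs c n I)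
    (hn : 0 < n) (hz : N 9 = 0)
    (hB : ∀ (k : ℕ) (ρ : Fin k → Fin n), (Function.Injective fun t => fun j : Fin c =>
      (N (18 + 4 * c * ρ t + 2 * j), N (18 + 4 * c * ρ t + 2 * c + 2 * j))) → k ≤ B) :
    Runs (.seq (classify c) (dynProg c)) ⟨I, N⟩
      (n * (n * (18 * c + 17) + 23) + 16 + (n + 1) ^ B * ((B + 1) * (9 * c + 40))) fun m =>
      m.num 0 = gopt ((List.finRange n).map fun i : Fin n => mixMax
        (fun j : Fin c => N (18 + 4 * c * i + 2 * j))
        fun j => N (18 + 4 * c * i + 2 * c + 2 * j)) := by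
  refine (Runs.seq (U := (n + 1) ^ B * ((B + 1) * (9 * c + 40)) + 6)
    ((runs_classify I N hI).mono le_rfl fun m hm => ?_)).mono (by omega) fun _ h => h
  obtain ⟨I', N'⟩ := m
  obtain ⟨hN, hI', k, ρ, τ, hk0, hC⟩ := hm
  obtain rfl : N' = N := hN
  simp only at hI' hk0 hC
  have hkB : k ≤ B := by
    refine hB k (fun t => ⟨ρ t, hC.repr_lt t t.isLt⟩) fun t t' h => ?_
    have hE := eqCells_of_eq h
    rcases lt_trichotomy t t' with hlt | heq | hlt
    · exact absurd (fun j hj => (hE j hj).symm) (hC.distinct t' t'.isLt t hlt)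
    · exact heq
    · exact absurd hE (hC.distinct t t.isLt t' hlt)
  set L : List ℕ := (List.range n).map τ with hL
  have hLk : ∀ t ∈ L, t < k := by
    intro t ht
    obtain ⟨i, hi, rfl⟩ := List.mem_map.1 ht
    exact hC.type_lt i (List.mem_range.1 hi)
  -- The address accumulated variable by variable is that of the state whose digits are the
  -- multiplicities of the types.
  have hsum : digitSum (n + 1) k (fun t => L.count t) = ∑ i ∈ Finset.range n, (n + 1) ^ τ i := by
    have := sum_map_eq_sum_range_count L hLk fun t => (n + 1) ^ t
    rw [digitSum]
    simp only [smul_eq_mul] at this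
    rw [← this, hL, List.map_map, Finset.sum_range, ← List.sum_ofFn]
    congr 1
    apply List.ext_getElem <;> simp
  refine (runs_dynProg (k := k) (α := fun t => 1 + 2 * c * ρ t) (d := fun t => L.count t) I' N' hI'
    hn hz hC.h11 ?_ hC.weight ?_ ?_ ?_).mono ?_ ?_
  · intro t ht
    rcases ht.lt_or_eq with h | rfl
    · exact hC.dig t h
    · exact hk0
  · intro t ht
    rw [hC.repr t ht]
    ring
  · intro t _
    exact List.count_le_length.trans (by simp [hL])
  · rw [hsum, hC.h15]
  · gcongr
    · omega
  · intro m hm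
    rw [hm, ← gopt_eq_countOpt k _ L hLk]
    congr 1
    apply List.ext_getElem
    · simp [hL]
    · intro i h1 h2
      have hi : i < n := by simpa [hL] using h1
      simp only [hL, List.map_map, List.getElem_map, List.getElem_range, Function.comp,
        List.getElem_finRange, Fin.val_cast]
      rw [← cellMix_eq_mixMax, show 16 + 2 * (1 + 2 * c * ρ (τ i)) = 18 + 4 * c * ρ (τ i) by ring]
      exact ((hC.eqCells i hi).cellMix_eq).symm

/-- A bound for the running time of the algorithm on `n` variables of support size `c`, with `K`
levels in the grids and at most `B` different rounded variables. -/
def runtimeBound (c n K B : ℕ) : ℕ :=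
  200 * (c + 1) * (n + 1) ^ 2 * (K + 1) + (n + 1) ^ B * ((B + 1) * (9 * c + 40))

/-- A single `K` serves both grids: `1 / q` equals `(n * c / δ) ^ 2` with `δ = ε / 8`, and `hi / lo
= n * c / δ ^ 2` is no larger. The bound `B` on the number of classes stays a hypothesis, so that
both parts of the theorem can use the same program. -/
theorem runs_approxProg {c K B : ℕ} (hc : 0 < c) {ε : ℝ} (hε : 0 < ε) (hε1 : ε < 1)
    (l : List (DiscreteVar c)) (hK : ((l.length : ℝ) * c / (ε / 8)) ^ 2 ≤ (1 + ε / 8) ^ K)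
    (hB : ∀ (lo hi q : ℝ) (k : ℕ) (w : Fin l.length → Fin c → ℝ × ℝ) (ρ : Fin k → Fin l.length),
      0 < lo → lo ≤ hi → 0 < q → hi ≤ lo * (1 + ε / 8) ^ K → 1 ≤ q * (1 + ε / 8) ^ K →
      (∀ i j, RoundedPair (1 + ε / 8) lo hi q (l[i].val j) (l[i].prob j) (w i j).1 (w i j).2) →
      (Function.Injective fun t => w (ρ t)) → k ≤ B) :
    Runs (approxProg c) (inputMem ε l) (runtimeBound c l.length K B) fun m =>
      (1 - ε) * opt l ≤ m.num 0 ∧ m.num 0 ≤ opt l := by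
  set n := l.length with hn
  refine (Runs.seq (U := (n * (c * 8 + 6) + 5) + ((13 + ((n * (c * (6 * K + 23) + 6) + 5) +
    (n * (n * (18 * c + 17) + 23) + 16 + (n + 1) ^ B * ((B + 1) * (9 * c + 40))))) + 1))
    ((runs_prepare (c := c) (n := n) (inputMem ε l).idx (inputMem ε l).num
      (by simp [inputMem, hn])).mono le_rfl fun m hm => ?_)).mono ?_ fun _ h => h
  swap
  · rw [runtimeBound]
    -- The constant 200 is generous enough for the expanded difference to have only nonnegative
    -- coefficients.
    have : (0 : ℤ) ≤ (200 * (c + 1) * (n + 1) ^ 2 * (K + 1) : ℤ) - (10 * c * n + 4 * c + 30 +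
        (n * (c * 8 + 6) + 5 + (13 + (n * (c * (6 * K + 23) + 6) + 5 +
        (n * (n * (18 * c + 17) + 23) + 16)) + 1))) := by
      ring_nf
      positivity
    zify
    linarith
  obtain ⟨I, N⟩ := m
  obtain ⟨hI, h9, h1, hcell⟩ := hm
  simp only at hI h9 h1 hcell
  have hlt : ∀ (i : Fin n) (j : Fin c), 2 * c * (i : ℕ) + c + j < 2 * c * n := by
    intro i j
    have := Nat.mul_le_mul_left (2 * c) i.isLt
    rw [Nat.mul_succ] at this
    omega
  have hNv : ∀ (i : Fin n) (j : Fin c), N (18 + 4 * c * i + 2 * j) = l[i].val j := by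
    intro i j
    rw [← inputMem_val ε l i j, ← hcell _ (by have := hlt i j; omega)]
    congr 1
    ring
  have hNp : ∀ (i : Fin n) (j : Fin c), N (18 + 4 * c * i + 2 * c + 2 * j) = l[i].prob j := by
    intro i j
    rw [← inputMem_prob ε l i j, ← hcell _ (by have := hlt i j; omega)]
    congr 1
    ring
  have hN16 : N 16 = ε := by
    rw [← inputMem_num_zero ε l, ← hcell 0 (Nat.zero_le _)]
  refine Runs.seq ((runs_maxPass I N hI h1).mono le_rfl fun m hm => ?_)
  obtain ⟨I₁, N₁⟩ := m
  obtain ⟨hI₁, hfr, hM0, hMle, hMatt⟩ := hm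
  simp only at hI₁ hfr hM0 hMle hMatt
  set M := N₁ 1 with hMdef
  have hMX : ∀ (i : Fin n) (j : Fin c), l[i].prob j * l[i].val j ≤ M := by
    intro i j
    rw [mul_comm, ← hNv, ← hNp]
    exact hMle i i.isLt j j.isLt
  refine Runs.ite (fun hb => ?_) fun hb => ?_
  swap
  · simp only [Test.Holds, Mem.getNum, Ref.addr, hfr 9 (by omega), h9, ← hMdef, not_lt] at hb
    -- If all products of a value and its probability vanish, the optimum is zero and there is no
    -- scale to round to.
    have hM : M = 0 := le_antisymm hb hM0
    have hopt : opt l = 0 := by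
      refine le_antisymm ((opt_le l M fun X hX j => ?_).trans (by rw [hM]; simp)) (opt_nonneg l)
      obtain ⟨i, hi, rfl⟩ := List.getElem_of_mem hX
      exact hMX ⟨i, hi⟩ j
    refine Runs.block ?_ (by simp; omega)
    simp [Instr.apply, Mem.setNum, Ref.addr, hopt]
  simp only [Test.Holds, Mem.getNum, Ref.addr, hfr 9 (by omega), h9, ← hMdef] at hb
  obtain ⟨i₀, hi₀, j₀, hj₀, hM⟩ := hMatt.resolve_left hb.ne'
  have hnpos : 0 < n := by omega
  have hMopt : M ≤ opt l := by
    rw [hM, hNv ⟨i₀, hi₀⟩ ⟨j₀, hj₀⟩, hNp ⟨i₀, hi₀⟩ ⟨j₀, hj₀⟩, mul_comm]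
    exact mul_le_opt l ⟨i₀, hi₀⟩ ⟨j₀, hj₀⟩
  obtain ⟨N₂, hN₂, g9, g16, g2, g3, g4, g5⟩ := setScale_spec c I₁ N₁ hI₁.h0
    ((hfr 16 (by omega)).trans hN16) hMdef.symm
  refine (Runs.seq (T := 13) (Runs.block ?_ (by simp [setScale])))
  rw [hN₂]
  set δ := ε / 8 with hδ
  have hδ0 : 0 < δ := by positivity
  have hn1 : (1 : ℝ) ≤ n := by exact_mod_cast hnpos
  have hc1 : (1 : ℝ) ≤ c := by exact_mod_cast hc
  have hnc : (1 : ℝ) ≤ n * c := by nlinarith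
  set lo := δ * M with hlo
  set hi := n * c * M / δ with hhi
  set q := δ ^ 2 / (n * c : ℝ) ^ 2 with hq
  have hlo0 : 0 < lo := by positivity
  have hq0 : 0 < q := by positivity
  have hMhi : M ≤ hi := by
    rw [hhi, le_div_iff₀ hδ0]
    nlinarith
  have hlohi : lo ≤ hi := by
    refine le_trans ?_ hMhi
    rw [hlo]
    nlinarith
  have hKhi : hi ≤ lo * (1 + δ) ^ K := by
    refine le_trans ?_ (mul_le_mul_of_nonneg_left hK hlo0.le)
    rw [hhi, hlo, div_pow, mul_div_assoc', div_le_div_iff₀ hδ0 (by positivity)]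
    have : (n * c : ℝ) ≤ (n * c : ℝ) ^ 2 := by nlinarith
    have := mul_le_mul_of_nonneg_left this (show 0 ≤ M * δ ^ 2 by positivity)
    nlinarith
  have hKq : 1 ≤ q * (1 + δ) ^ K := by
    refine le_trans (le_of_eq ?_) (mul_le_mul_of_nonneg_left hK hq0.le)
    rw [hq]
    field_simp
  have hNv₂ : ∀ (i : Fin n) (j : Fin c), N₂ (18 + 4 * c * i + 2 * j) = l[i].val j :=
    fun i j => by rw [g16 _ (by omega), hfr _ (by omega), hNv]
  have hNp₂ : ∀ (i : Fin n) (j : Fin c), N₂ (18 + 4 * c * i + 2 * c + 2 * j) = l[i].prob j :=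
    fun i j => by rw [g16 _ (by omega), hfr _ (by omega), hNp]
  refine Runs.seq ((runs_roundPass (K := K) I₁ N₂ hI₁ g2 g3 g4 g5 (by linarith) hlo0 hlohi hKhi hKq
    ?_ ?_).mono le_rfl fun m hm => ?_)
  · intro i hi j hj
    rw [hNp₂ ⟨i, hi⟩ ⟨j, hj⟩]
    have h := l[(⟨i, hi⟩ : Fin n)].sum_prob
    rw [← h]
    exact Finset.single_le_sum (f := fun j => l[(⟨i, hi⟩ : Fin n)].prob j)
      (fun j _ => DiscreteVar.prob_nonneg _ j) (Finset.mem_univ _)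
  · intro i hi j hj
    rw [hNp₂ ⟨i, hi⟩ ⟨j, hj⟩, hNv₂ ⟨i, hi⟩ ⟨j, hj⟩]
    exact (hMX _ _).trans hMhi
  obtain ⟨I₃, N₃⟩ := m
  obtain ⟨hI₃, f9, hR⟩ := hm
  simp only at hI₃ f9 hR
  have hR' : ∀ (i : Fin n) (j : Fin c), RoundedPair (1 + δ) lo hi q (l[i].val j) (l[i].prob j)
      (N₃ (18 + 4 * c * i + 2 * j)) (N₃ (18 + 4 * c * i + 2 * c + 2 * j)) := by
    intro i j
    rw [← hNv₂, ← hNp₂]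
    exact hR i i.isLt j j.isLt
  refine (runs_classify_dynProg I₃ N₃ hI₃ hnpos (by rw [f9, g9, hfr 9 (by omega), h9])
    fun k ρ hρ => hB lo hi q k (fun i j => (N₃ (18 + 4 * c * i + 2 * j),
      N₃ (18 + 4 * c * i + 2 * c + 2 * j))) ρ hlo0 hlohi hq0 hKhi hKq hR' hρ).mono le_rfl ?_
  intro m hm
  rw [hm]
  exact gopt_rounded l hε hε1 hb hMX hMopt hnpos hc rfl rfl rfl rfl _ _ hR'

end ProphetSecretary

namespace ProphetSecretary

/-! ### The approximation algorithms and their grid sizes -/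

/-- The guarantee of the policy needs the estimate on all sublists, so the outputs are collected
into one function, with the value zero on inadmissible inputs. -/
theorem isApproxAlgorithm_of_runs {c : ℕ} {S : DiscreteVar c → Prop} {P : Prog} {τ : ℝ → ℕ → ℕ}
    (h : ∀ ε : ℝ, 0 < ε → ε < 1 → ∀ l : List (DiscreteVar c), (∀ X ∈ l, S X) →
      Runs P (inputMem ε l) (τ ε l.length) fun m => (1 - ε) * opt l ≤ m.num 0 ∧ m.num 0 ≤ opt l) :
    IsApproxAlgorithm S P τ := by
  have key : ∀ (ε : ℝ) (l : List (DiscreteVar c)), ∃ y : ℝ, 0 < ε → ε < 1 → (∀ X ∈ l, S X) →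
      (∃ t ≤ τ ε l.length, P.Outputs ε l y t) ∧ (1 - ε) * opt l ≤ y ∧ y ≤ opt l := by
    intro ε l
    by_cases hl : 0 < ε ∧ ε < 1 ∧ ∀ X ∈ l, S X
    · obtain ⟨h0, h1, hS⟩ := hl
      obtain ⟨t, m, ht, hm, hy⟩ := h ε h0 h1 l hS
      exact ⟨m.num 0, fun _ _ _ => ⟨⟨t, ht, m, hm, rfl⟩, hy⟩⟩
    · exact ⟨0, fun h0 h1 hS => absurd ⟨h0, h1, hS⟩ hl⟩
  choose est hest using key
  refine ⟨est, fun ε h0 h1 l hl => ?_⟩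
  obtain ⟨hout, hlow, hupp⟩ := hest ε l h0 h1 hl
  exact ⟨hout, hlow, hupp, le_reward_thresholdPolicy (est ε) ε h0.le S
    (fun l hl => (hest ε l h0 h1 hl).2) l hl []⟩

theorem le_pow_ceil_log_div_log {r : ℝ} (hr : 1 < r) (x : ℝ) :
    x ≤ r ^ ⌈Real.log x / Real.log r⌉₊ := by
  rcases le_or_gt x 0 with hx | hx
  · exact hx.trans (by positivity)
  · rw [← Real.log_le_log_iff hx (by positivity), Real.log_pow]
    exact (div_le_iff₀ (Real.log_pos hr)).1 (Nat.le_ceil _)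

/-- The number of steps of ratio `1 + ε / 8` that cover the relevant range of values and
probabilities of `n` variables. -/
noncomputable def gridSize (c : ℕ) (ε : ℝ) (n : ℕ) : ℕ :=
  ⌈Real.log (((n : ℝ) * c / (ε / 8)) ^ 2) / Real.log (1 + ε / 8)⌉₊

/-- A bound on the number of classes of rounded variables with `c` support points. -/
noncomputable def classBound (c : ℕ) (ε : ℝ) (n : ℕ) : ℕ :=
  c * ((gridSize c ε n + 3) * (⌈Real.log c / Real.log (1 + ε / 8)⌉₊ + 3) *
    ((gridSize c ε n + 3) * (gridSize c ε n + 3)) ^ (c - 1))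

theorem isApproxAlgorithm_approxProg {c : ℕ} (hc : 0 < c) :
    IsApproxAlgorithm (c := c) (fun _ => True) (approxProg c)
      fun ε n => runtimeBound c n (gridSize c ε n) (classBound c ε n) := by
  refine isApproxAlgorithm_of_runs fun ε h0 h1 l _ => ?_
  have hr : (1 : ℝ) < 1 + ε / 8 := by linarith
  refine runs_approxProg hc h0 h1 l (le_pow_ceil_log_div_log hr _) ?_
  intro lo hi q k w ρ hlo hlohi hq hN hNq hw hρ
  exact count_le hr hlo hlohi hq hN hNq hc (le_pow_ceil_log_div_log hr _) (fun i => l[i]) w hw ρ hρ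

theorem isApproxAlgorithm_approxProg_two_point :
    IsApproxAlgorithm (c := 2) (fun X => X.val 0 = 0 ∧ 0 < X.val 1) (approxProg 2)
      fun ε n => runtimeBound 2 n (gridSize 2 ε n)
        ((gridSize 2 ε n + 3) * (gridSize 2 ε n + 3)) := by
  refine isApproxAlgorithm_of_runs fun ε h0 h1 l hl => ?_
  have hr : (1 : ℝ) < 1 + ε / 8 := by linarith
  refine runs_approxProg two_pos h0 h1 l (le_pow_ceil_log_div_log hr _) ?_
  intro lo hi q k w ρ hlo hlohi hq hN hNq hw hρ
  exact count_two_point_le hr hlo hlohi hq hN hNq (fun i => l[i])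
    (fun i => (hl _ (List.getElem_mem _)).1) w hw ρ hρ

theorem gridSize_mono {c : ℕ} {ε : ℝ} (h0 : 0 < ε) {m n : ℕ} (h : m ≤ n) :
    gridSize c ε m ≤ gridSize c ε n := by
  -- For `m * c = 0` the convention `Real.log 0 = 0` makes the grid size zero.
  rcases Nat.eq_zero_or_pos (m * c) with hm | hm
  · have : (m : ℝ) * c = 0 := by exact_mod_cast hm
    simp [gridSize, this]
  · have hm' : (0 : ℝ) < m * c := by exact_mod_cast hm
    have hr : (0 : ℝ) < Real.log (1 + ε / 8) := Real.log_pos (by linarith)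
    unfold gridSize
    gcongr

theorem runtimeBound_mono {c m n K K' B B' : ℕ} (h : m ≤ n) (hK : K ≤ K') (hB : B ≤ B') :
    runtimeBound c m K B ≤ runtimeBound c n K' B' := by
  unfold runtimeBound
  gcongr
  omega

end ProphetSecretary

namespace ProphetSecretary

/-! ### Asymptotics of the running time -/

/-- Polynomial factors are absorbed by enlarging the exponent from `B` to `B + 4`. Since `g ≤ √n`,
the base `n / g` is at least `√n`; and `n + 1 ≤ n ^ 2 = √n ^ 4` turns the exponent into `4 * B + 16
≤ g`. -/
theorem mul_runtimeBound_le {c K B n : ℕ} {g : ℝ} (hn : 2 ≤ n) (hK : K + 1 ≤ n)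
    (hB : 4 * (B : ℝ) + 16 ≤ g) (hg : g ^ 2 ≤ n) :
    ((n : ℝ) + 1) * runtimeBound c n K B ≤ (209 * c + 240) * ((n : ℝ) / g) ^ g := by
  have hB0 : (0 : ℝ) ≤ B := Nat.cast_nonneg B
  have hg1 : 1 ≤ g := by linarith
  have hn2 : (2 : ℝ) ≤ n := by exact_mod_cast hn
  have hBn : B + 1 ≤ n := by
    have : (B : ℝ) + 1 ≤ n := by nlinarith
    exact_mod_cast this
  have h1 : (n + 1) * runtimeBound c n K B ≤ (209 * c + 240) * (n + 1) ^ (B + 4) := by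
    have e1 : (n + 1) ^ 3 ≤ (n + 1) ^ (B + 3) := Nat.pow_le_pow_right (by omega) (by omega)
    have e2 : (n + 1) ^ B * (B + 1) ≤ (n + 1) ^ (B + 3) := by
      calc (n + 1) ^ B * (B + 1) ≤ (n + 1) ^ B * (n + 1) := by gcongr; omega
        _ = (n + 1) ^ (B + 1) := by ring
        _ ≤ _ := Nat.pow_le_pow_right (by omega) (by omega)
    calc (n + 1) * runtimeBound c n K B
        ≤ (n + 1) * (200 * (c + 1) * (n + 1) ^ 2 * (n + 1) +
          (n + 1) ^ B * ((B + 1) * (9 * c + 40))) := by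
          unfold runtimeBound
          gcongr
          omega
      _ = (n + 1) * (200 * (c + 1) * (n + 1) ^ 3 +
          ((n + 1) ^ B * (B + 1)) * (9 * c + 40)) := by ring
      _ ≤ (n + 1) * (200 * (c + 1) * (n + 1) ^ (B + 3) + (n + 1) ^ (B + 3) * (9 * c + 40)) := by
          gcongr
      _ = _ := by ring
  have h1' : ((n : ℝ) + 1) * runtimeBound c n K B ≤ (209 * c + 240) * ((n : ℝ) + 1) ^ (B + 4) := by
    exact_mod_cast h1
  refine h1'.trans ?_
  gcongr
  have hsqrt : Real.sqrt n ≤ n / g := by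
    rw [le_div_iff₀ (by linarith)]
    calc Real.sqrt n * g ≤ Real.sqrt n * Real.sqrt n := by
          gcongr
          exact Real.le_sqrt_of_sq_le hg
      _ = n := Real.mul_self_sqrt (by linarith)
  calc ((n : ℝ) + 1) ^ (B + 4) ≤ ((n : ℝ) ^ 2) ^ (B + 4) := by
        gcongr
        nlinarith
    _ = (Real.sqrt n ^ 4) ^ (B + 4) := by
        rw [show Real.sqrt n ^ 4 = (Real.sqrt n ^ 2) ^ 2 by ring, Real.sq_sqrt (by linarith)]
    _ = Real.sqrt n ^ ((4 * B + 16 : ℕ) : ℝ) := by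
        rw [Real.rpow_natCast, ← pow_mul]
        ring_nf
    _ ≤ Real.sqrt n ^ g := by
        refine Real.rpow_le_rpow_of_exponent_le (Real.one_le_sqrt.2 (by linarith)) ?_
        push_cast
        exact hB
    _ ≤ _ := Real.rpow_le_rpow (Real.sqrt_nonneg _) hsqrt (by linarith)

theorem sum_runtimeBound_le {c n : ℕ} {K B : ℕ → ℕ} (hK : Monotone K) (hB : Monotone B) :
    ∑ m ∈ Finset.range (n + 1), (runtimeBound c m (K m) (B m) : ℝ) ≤
      ((n : ℝ) + 1) * runtimeBound c n (K n) (B n) := by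
  have : ∀ m ∈ Finset.range (n + 1), (runtimeBound c m (K m) (B m) : ℝ) ≤
      runtimeBound c n (K n) (B n) := fun m hm => by
    have hmn : m ≤ n := Nat.lt_succ_iff.1 (Finset.mem_range.1 hm)
    exact_mod_cast runtimeBound_mono hmn (hK hmn) (hB hmn)
  refine (Finset.sum_le_card_nsmul _ _ _ this).trans_eq ?_
  rw [Finset.card_range, nsmul_eq_mul]
  push_cast
  rfl

/-- By Bernoulli's inequality; passing to the finer grid ratio costs only a constant factor. -/
theorem log_one_add_div_eight_ge {ε : ℝ} (h0 : 0 < ε) :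
    Real.log (1 + ε) / 8 ≤ Real.log (1 + ε / 8) := by
  have h : 1 + ε ≤ (1 + ε / 8) ^ 8 := by
    have := one_add_mul_le_pow (a := ε / 8) (by linarith) 8
    push_cast at this
    linarith
  have := Real.log_le_log (by linarith) h
  rw [Real.log_pow] at this
  push_cast at this
  linarith

theorem half_le_log_one_add {ε : ℝ} (h0 : 0 < ε) (h1 : ε < 1) : ε / 2 ≤ Real.log (1 + ε) := by
  refine le_trans ?_ (Real.one_sub_inv_le_log_of_pos (by linarith : (0 : ℝ) < 1 + ε))
  rw [show 1 - (1 + ε)⁻¹ = ε / (1 + ε) by field_simp; ring]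
  gcongr
  linarith

theorem log_one_add_le_one {ε : ℝ} (h0 : 0 < ε) (h1 : ε < 1) : Real.log (1 + ε) ≤ 1 := by
  have := Real.log_le_sub_one_of_pos (by linarith : (0 : ℝ) < 1 + ε)
  linarith

/-- For `s = n ^ (1 / A)` the hypothesis says `A / ε ≤ s`. Then `log (n / ε)` is at most `2 * A *
log s ≤ 2 * ε * s ^ 2`, and dividing by `log (1 + ε) ≥ ε / 2` leaves `4 * s ^ 2 ≤ s ^ 3`. So a fixed
power of the ratio is at most `n` once `A` is large. -/
theorem log_ratio_bounds {ε : ℝ} {A n : ℕ} (h0 : 0 < ε) (h1 : ε < 1) (hA : 4 ≤ A)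
    (hn : ((A : ℝ) / ε) ^ A ≤ n) :
    (A : ℝ) ≤ Real.log (n / ε) ∧
    ∃ s : ℝ, (A : ℝ) ≤ s ∧ s ^ A = n ∧ Real.log (n / ε) / Real.log (1 + ε) ≤ s ^ 3 := by
  have hA4 : (4 : ℝ) ≤ A := by exact_mod_cast hA
  have hAε : (A : ℝ) ≤ A / ε := by
    rw [le_div_iff₀ h0]
    nlinarith
  obtain ⟨s, hs0, hsA⟩ : ∃ s : ℝ, 0 ≤ s ∧ s ^ A = n :=
    ⟨(n : ℝ) ^ ((A : ℝ)⁻¹), by positivity, Real.rpow_inv_natCast_pow (by positivity) (by omega)⟩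
  have hs : (A : ℝ) / ε ≤ s := le_of_pow_le_pow_left₀ (by omega) hs0 (hsA ▸ hn)
  have hs4 : (4 : ℝ) ≤ s := by linarith
  have hlogs : 1 ≤ Real.log s := by
    rw [Real.le_log_iff_exp_le (by linarith)]
    have := Real.exp_one_lt_d9
    linarith
  have hlogn : Real.log n = A * Real.log s := by rw [← hsA, Real.log_pow]
  have hn0 : (0 : ℝ) < n := hsA ▸ by positivity
  have hlogL : Real.log (n / ε) = A * Real.log s - Real.log ε := by
    rw [Real.log_div hn0.ne' h0.ne', hlogn]
  have hinv : -Real.log ε ≤ Real.log s := by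
    rw [← Real.log_inv]
    refine Real.log_le_log (by positivity) (le_trans ?_ hs)
    rw [inv_eq_one_div]
    gcongr
    linarith
  have hlogε : Real.log ε ≤ 0 := Real.log_nonpos h0.le h1.le
  refine ⟨by nlinarith, s, by linarith, hsA, ?_⟩
  have hl := half_le_log_one_add h0 h1
  rw [div_le_iff₀ (by linarith)]
  have hAs : (A : ℝ) ≤ s * ε := (div_le_iff₀ h0).1 hs
  have hlss : Real.log s ≤ s := (Real.log_le_sub_one_of_pos (by linarith)).trans (by linarith)
  calc Real.log (n / ε) ≤ 2 * (A * Real.log s) := by rw [hlogL]; nlinarith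
    _ ≤ 2 * (s * ε * s) := by gcongr
    _ = 4 * s ^ 2 * (ε / 2) := by ring
    _ ≤ s * s ^ 2 * Real.log (1 + ε) := by gcongr
    _ = _ := by ring

theorem gridSize_add_three_le {c n : ℕ} {ε : ℝ} (hc : 0 < c) (h0 : 0 < ε) (h1 : ε < 1)
    (hn : 8 * c ≤ n) :
    (gridSize c ε n : ℝ) + 3 ≤ 36 * (Real.log (n / ε) / Real.log (1 + ε)) := by
  have hc1 : (1 : ℝ) ≤ c := by exact_mod_cast hc
  have hn8 : 8 * (c : ℝ) ≤ n := by exact_mod_cast hn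
  have hn0 : (0 : ℝ) < n := by linarith
  have hl := half_le_log_one_add h0 h1
  have hl0 : 0 < Real.log (1 + ε) := by linarith
  have hl1 := log_one_add_le_one h0 h1
  have h8 := log_one_add_div_eight_ge h0
  have hnε : (n : ℝ) ≤ n / ε := by
    rw [le_div_iff₀ h0]
    nlinarith
  have hL : Real.log (8 * c) ≤ Real.log (n / ε) := Real.log_le_log (by linarith) (by linarith)
  have hL1 : 1 ≤ Real.log (n / ε) := by
    rw [Real.le_log_iff_exp_le (by linarith)]
    have := Real.exp_one_lt_d9
    linarith
  have hx : 1 ≤ Real.log (n / ε) / Real.log (1 + ε) := by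
    rw [le_div_iff₀ hl0]
    linarith
  have hlog : Real.log (((n : ℝ) * c / (ε / 8)) ^ 2) ≤ 4 * Real.log (n / ε) := by
    rw [show (n : ℝ) * c / (ε / 8) = 8 * c * (n / ε) by field_simp, Real.log_pow,
      Real.log_mul (by positivity) (by positivity)]
    push_cast
    linarith
  -- The 32 is 4 from the logarithm times 8 from the finer ratio; rounding up and the summand 3 add
  -- at most 4 more, hence 36.
  have hq : Real.log (((n : ℝ) * c / (ε / 8)) ^ 2) / Real.log (1 + ε / 8) ≤
      32 * (Real.log (n / ε) / Real.log (1 + ε)) := by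
    calc _ ≤ 4 * Real.log (n / ε) / (Real.log (1 + ε) / 8) := by gcongr
      _ = _ := by field_simp; ring
  have := Nat.ceil_lt_add_one (a := Real.log (((n : ℝ) * c / (ε / 8)) ^ 2) / Real.log (1 + ε / 8))
    (div_nonneg (Real.log_nonneg (one_le_pow₀ (by
      rw [show (n : ℝ) * c / (ε / 8) = 8 * c * (n / ε) by field_simp]
      nlinarith))) (by linarith))
  unfold gridSize
  linarith

theorem ceil_log_div_log_add_three_le {c : ℕ} {ε : ℝ} (h0 : 0 < ε) (h1 : ε < 1) :
    (⌈Real.log c / Real.log (1 + ε / 8)⌉₊ : ℝ) + 3 ≤ (8 * c + 4) / Real.log (1 + ε) := by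
  have hl := half_le_log_one_add h0 h1
  have hl0 : 0 < Real.log (1 + ε) := by linarith
  have hl1 := log_one_add_le_one h0 h1
  have h8 := log_one_add_div_eight_ge h0
  have hlc : Real.log c ≤ c := Real.log_le_self (Nat.cast_nonneg c)
  have hlc0 : 0 ≤ Real.log c := Real.log_natCast_nonneg c
  have := Nat.ceil_lt_add_one (a := Real.log c / Real.log (1 + ε / 8))
    (div_nonneg hlc0 (by linarith))
  have h4 : 4 ≤ 4 / Real.log (1 + ε) := by
    rw [le_div_iff₀ hl0]
    linarith
  have hq : Real.log c / Real.log (1 + ε / 8) ≤ 8 * c / Real.log (1 + ε) := by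
    calc _ ≤ c / (Real.log (1 + ε) / 8) := by gcongr
      _ = _ := by field_simp
  rw [add_div]
  linarith

/-- Of the `2 * c` grid factors one is only of order `1 / log (1 + ε)`. The factor `log (n / ε)` on
the left completes it to a full ratio, which records the saving over the plain power `2 * c`. -/
theorem classBound_le {c n : ℕ} {ε : ℝ} (hc : 0 < c) (h0 : 0 < ε) (h1 : ε < 1) (hn : 8 * c ≤ n) :
    (classBound c ε n : ℝ) * Real.log (n / ε) ≤ c * (8 * c + 4) * 36 ^ (2 * c - 1) *
      (Real.log (n / ε) / Real.log (1 + ε)) ^ (2 * c) := by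
  have hl := half_le_log_one_add h0 h1
  have hl0 : 0 < Real.log (1 + ε) := by linarith
  have hG := gridSize_add_three_le hc h0 h1 hn
  have hP := ceil_log_div_log_add_three_le (c := c) h0 h1
  have hn1 : (1 : ℝ) ≤ n := by exact_mod_cast (by omega : 1 ≤ n)
  have hL0 : 0 ≤ Real.log (n / ε) := Real.log_nonneg (by
    rw [le_div_iff₀ h0]
    linarith)
  set x := Real.log (n / ε) / Real.log (1 + ε) with hx
  have hLx : Real.log (n / ε) = x * Real.log (1 + ε) := by rw [hx]; field_simp
  unfold classBound
  push_cast
  obtain ⟨b, rfl⟩ : ∃ b, c = b + 1 := ⟨c - 1, by omega⟩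
  rw [show 2 * (b + 1) - 1 = 2 * b + 1 by omega, Nat.add_sub_cancel]
  calc _ ≤ ((b + 1 : ℕ) : ℝ) * ((36 * x) * ((8 * (b + 1 : ℕ) + 4) / Real.log (1 + ε)) *
        ((36 * x) * (36 * x)) ^ b) * Real.log (n / ε) := by
        push_cast at hP ⊢
        gcongr
    _ = _ := by
        rw [hLx, show (36 * x) * (36 * x) = (36 * x) ^ 2 by ring, ← pow_mul, mul_pow]
        field_simp
        ring

end ProphetSecretary

/-! ### Choice of the constants and the main theorem -/

namespace ProphetSecretary

theorem monotone_gridSize {c : ℕ} {ε : ℝ} (h0 : 0 < ε) : Monotone (gridSize c ε) :=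
  fun _ _ h => gridSize_mono h0 h

theorem monotone_classBound {c : ℕ} {ε : ℝ} (h0 : 0 < ε) : Monotone (classBound c ε) := by
  intro m n h
  have := gridSize_mono (c := c) h0 h
  unfold classBound
  gcongr

theorem sum_runtime_le {c : ℕ} (hc : 1 ≤ c) : ∃ A : ℕ, ∀ (ε : ℝ) (n : ℕ), 0 < ε → ε < 1 →
    ((A : ℝ) / ε) ^ A ≤ n → ∀ g : ℝ,
      g = Real.log (n / ε) ^ (2 * c) / ((c - 1).factorial * Real.log (1 + ε) ^ (2 * c)) →
      ∑ m ∈ Finset.range (n + 1),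
          (runtimeBound c m (gridSize c ε m) (classBound c ε m) : ℝ) ≤
        (209 * c + 240) * ((n : ℝ) / g) ^ g := by
  set D : ℕ := c * (8 * c + 4) * 36 ^ (2 * c - 1) with hD
  set f : ℕ := (c - 1).factorial with hf
  have hD1 : 1 ≤ D := Nat.one_le_iff_ne_zero.2 (by positivity)
  have hf1 : 1 ≤ f := Nat.factorial_pos _
  -- The first summand makes `log (n / ε) ≥ 32 * f * D`, so the saved logarithm outweighs the
  -- constant `D` and the factorial `f`: the class bound is at most `g / 32`. The second one gives
  -- `12 * c ≤ A`, hence `g ^ 2 ≤ s ^ (12 * c) ≤ n`.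
  refine ⟨32 * f * D + 100 * c, fun ε n h0 h1 hn g hg => ?_⟩
  set A : ℕ := 32 * f * D + 100 * c with hA
  have hAf : 32 * f ≤ A := by nlinarith
  have hAc : 100 * c ≤ A := by omega
  obtain ⟨hL, s, hs, hsn, hxs⟩ := log_ratio_bounds h0 h1 (by omega) hn
  have hl := half_le_log_one_add h0 h1
  have hl0 : 0 < Real.log (1 + ε) := by linarith
  have hl1 := log_one_add_le_one h0 h1
  have hA100 : (100 : ℝ) ≤ A := by exact_mod_cast (by omega : 100 ≤ A)
  have hnA : A ≤ n := by
    have : (A : ℝ) ≤ n := hs.trans (hsn ▸ le_self_pow₀ (by linarith) (by omega))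
    exact_mod_cast this
  have hG := gridSize_add_three_le hc h0 h1 (by omega : 8 * c ≤ n)
  have hB := classBound_le hc h0 h1 (by omega : 8 * c ≤ n)
  have hxL : Real.log (n / ε) ≤ Real.log (n / ε) / Real.log (1 + ε) := by
    rw [le_div_iff₀ hl0]
    nlinarith
  rw [mul_comm (f : ℝ), ← div_div, ← div_pow] at hg
  set x := Real.log (n / ε) / Real.log (1 + ε)
  have hx1 : 1 ≤ x := by linarith
  have hs1 : 1 ≤ s := by linarith
  have hfR : (1 : ℝ) ≤ f := by exact_mod_cast hf1
  have hDR : (1 : ℝ) ≤ D := by exact_mod_cast hD1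
  have hgx : g * f = x ^ (2 * c) := by rw [hg]; field_simp
  have hg0 : 0 ≤ g := by rw [hg]; positivity
  have hg32 : 32 ≤ g := by
    have h2 : x ≤ x ^ (2 * c) := le_self_pow₀ hx1 (by omega)
    have h3 : (32 : ℝ) * f ≤ A := by exact_mod_cast hAf
    nlinarith
  refine (sum_runtimeBound_le (monotone_gridSize h0) (monotone_classBound h0)).trans ?_
  refine mul_runtimeBound_le (by omega) ?_ ?_ ?_
  · have : (gridSize c ε n : ℝ) + 1 ≤ n := by
      calc (gridSize c ε n : ℝ) + 1 ≤ 36 * s ^ 3 := by linarith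
        _ ≤ s * s ^ 3 := by gcongr; linarith
        _ = s ^ 4 := by ring
        _ ≤ s ^ A := pow_le_pow_right₀ hs1 (by omega)
        _ = n := hsn
    exact_mod_cast this
  · have hBL : (classBound c ε n : ℝ) * (32 * f * D) ≤ D * (g * f) := by
      have hLD : 32 * f * D ≤ Real.log (n / ε) := by
        refine le_trans ?_ hL
        exact_mod_cast (by omega : 32 * f * D ≤ A)
      calc _ ≤ (classBound c ε n : ℝ) * Real.log (n / ε) := by gcongr
        _ ≤ _ := by
          rw [hgx, hD]
          push_cast
          exact hB
    have : (classBound c ε n : ℝ) * 32 ≤ g := by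
      refine le_of_mul_le_mul_right ?_ (by positivity : (0 : ℝ) < f * D)
      linarith
    linarith
  · have hgs : g ≤ s ^ (6 * c) := by
      calc g ≤ g * f := le_mul_of_one_le_right hg0 hfR
        _ = x ^ (2 * c) := hgx
        _ ≤ (s ^ 3) ^ (2 * c) := by gcongr
        _ = s ^ (6 * c) := by rw [← pow_mul]; ring_nf
    calc g ^ 2 ≤ (s ^ (6 * c)) ^ 2 := by gcongr
      _ = s ^ (12 * c) := by rw [← pow_mul]; ring_nf
      _ ≤ s ^ A := pow_le_pow_right₀ hs1 (by omega)
      _ = n := hsn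

theorem sum_runtime_two_point_le (ε : ℝ) (n : ℕ) (h0 : 0 < ε) (h1 : ε < 1)
    (hn : ((10000 : ℕ) / ε : ℝ) ^ 10000 ≤ n) (g : ℝ)
    (hg : g = 10000 * (Real.log (n / ε) ^ 2 / Real.log (1 + ε) ^ 2)) :
    ∑ m ∈ Finset.range (n + 1), (runtimeBound 2 m (gridSize 2 ε m)
        ((gridSize 2 ε m + 3) * (gridSize 2 ε m + 3)) : ℝ) ≤
      (209 * (2 : ℕ) + 240) * ((n : ℝ) / g) ^ g := by
  obtain ⟨hL, s, hs, hsn, hxs⟩ := log_ratio_bounds (A := 10000) h0 h1 (by norm_num) hn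
  have hl := half_le_log_one_add h0 h1
  have hl0 : 0 < Real.log (1 + ε) := by linarith
  have hl1 := log_one_add_le_one h0 h1
  push_cast at hL hs
  have hs1 : 1 ≤ s := by linarith
  have hnA : 10000 ≤ n := by
    have : (10000 : ℝ) ≤ n := hs.trans (hsn ▸ le_self_pow₀ hs1 (by norm_num))
    exact_mod_cast this
  have hG := gridSize_add_three_le two_pos h0 h1 (by omega : 8 * 2 ≤ n)
  have hxL : Real.log (n / ε) ≤ Real.log (n / ε) / Real.log (1 + ε) := by
    rw [le_div_iff₀ hl0]
    nlinarith
  rw [← div_pow] at hg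
  set x := Real.log (n / ε) / Real.log (1 + ε)
  have hx1 : 1 ≤ x := by linarith
  have hmono := monotone_gridSize (c := 2) h0
  refine (sum_runtimeBound_le (B := fun m => (gridSize 2 ε m + 3) * (gridSize 2 ε m + 3)) hmono
    fun a b hab => ?_).trans ?_
  · have := hmono hab
    dsimp only
    gcongr
  refine mul_runtimeBound_le (by omega) ?_ ?_ ?_
  · have : (gridSize 2 ε n : ℝ) + 1 ≤ n := by
      calc (gridSize 2 ε n : ℝ) + 1 ≤ 36 * s ^ 3 := by linarith
        _ ≤ s * s ^ 3 := by gcongr; linarith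
        _ = s ^ 4 := by ring
        _ ≤ s ^ 10000 := pow_le_pow_right₀ hs1 (by norm_num)
        _ = n := hsn
    exact_mod_cast this
  · push_cast
    -- No logarithm is saved here; instead the constant in `g` is large enough, since `4 * 36 ^ 2 +
    -- 16 ≤ 10000` and `x ≥ 1`.
    have : ((gridSize 2 ε n : ℝ) + 3) * ((gridSize 2 ε n : ℝ) + 3) ≤ (36 * x) * (36 * x) := by
      gcongr
    nlinarith
  · have hgs : g ≤ s ^ 7 := by
      calc g = 10000 * x ^ 2 := hg
        _ ≤ s * (s ^ 3) ^ 2 := by gcongr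
        _ = s ^ 7 := by ring
    have hg0 : 0 ≤ g := by rw [hg]; positivity
    calc g ^ 2 ≤ (s ^ 7) ^ 2 := by gcongr
      _ = s ^ 14 := by ring
      _ ≤ s ^ 10000 := pow_le_pow_right₀ hs1 (by norm_num)
      _ = n := hsn

end ProphetSecretary

/-- Quasi-polynomial time approximation scheme for the prophet secretary problem with distributions
of support size at most `c`. The sum bounds the total time of the run on all `n` variables and of
the runs on the `n - 1, …, 1, 0` remaining variables that an online pass through the instance
needs. -/
theorem mainTheorem1 :
    (∃ C : ℝ, 0 < C ∧ ∀ c : ℕ, 1 ≤ c →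
      ∃ (P : ProphetSecretary.Prog) (τ : ℝ → ℕ → ℕ),
        ProphetSecretary.IsApproxAlgorithm (c := c) (fun _ => True) P τ ∧
        ∃ (K : ℝ) (A : ℕ), ∀ (ε : ℝ) (n : ℕ), 0 < ε → ε < 1 → ((A : ℝ) / ε) ^ A ≤ (n : ℝ) →
          ∀ g : ℝ, g = C * (Real.log ((n : ℝ) / ε) ^ (2 * c) /
              (((c - 1).factorial : ℝ) * Real.log (1 + ε) ^ (2 * c))) →
            ∑ m ∈ Finset.range (n + 1), (τ ε m : ℝ) ≤ K * ((n : ℝ) / g) ^ g) ∧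
    (∃ C : ℝ, 0 < C ∧
      ∃ (P : ProphetSecretary.Prog) (τ : ℝ → ℕ → ℕ),
        ProphetSecretary.IsApproxAlgorithm (c := 2)
          (fun X => X.val 0 = 0 ∧ 0 < X.val 1) P τ ∧
        ∃ (K : ℝ) (A : ℕ), ∀ (ε : ℝ) (n : ℕ), 0 < ε → ε < 1 → ((A : ℝ) / ε) ^ A ≤ (n : ℝ) →
          ∀ g : ℝ, g = C * (Real.log ((n : ℝ) / ε) ^ 2 / Real.log (1 + ε) ^ 2) →
            ∑ m ∈ Finset.range (n + 1), (τ ε m : ℝ) ≤ K * ((n : ℝ) / g) ^ g) := by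
  refine ⟨⟨1, one_pos, fun c hc => ?_⟩, 10000, by norm_num, ?_⟩
  · obtain ⟨A, hA⟩ := ProphetSecretary.sum_runtime_le hc
    exact ⟨_, _, ProphetSecretary.isApproxAlgorithm_approxProg hc, _, A,
      fun ε n h0 h1 hn g hg => hA ε n h0 h1 hn g (hg.trans (one_mul _))⟩
  · exact ⟨_, _, ProphetSecretary.isApproxAlgorithm_approxProg_two_point, _, 10000,
      ProphetSecretary.sum_runtime_two_point_le⟩
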